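/- **Problem and model.** 3SUM over $[U]=\{1,\dots,U\}$: given a set $A\subseteq[U]$ of size $n$, decide whether there are $a,b,c\in A$ (not necessarily distinct) with $a+b=c$. For a constant $k$, "3SUM over $[n^k]$" means the restriction to instances with $U=n^k$, $n=|A|$. The input is given as $n$ together with an array that lists the elements of $A$ in arbitrary order. Deterministic algorithms are programs of a word RAM with words of $O(\log n+\log U)$ bits, in which arithmetic, bitwise, memory-access and jump instructions each take one step. An algorithm runs in time $O(T(n,U))$ if there is a constant $C$ such that it makes at most $C\cdot T(n,U)$ steps on every instance with $n\ge 1$ and $U\ge 2$ (and it halts with the correct answer on all instances). The deterministic 3SUM hypothesis states that for every $\epsilon>0$ there is a constant $k$ such that no deterministic algorithm solves 3SUM over $[n^k]$ in time $O(n^{2-\epsilon})$. **Theorem (Deterministic Universe Reduction for 3SUM).** If, for some $\epsilon>0$, 3SUM over $[n^3]$ can be solved deterministically in time $O(n^{2-\epsilon})$, then there are constants $\epsilon',c>0$ such that 3SUM over $[U]$, for arbitrary $U$, can be solved deterministically in time $O\big(n^{2-\epsilon'}(\log U)^{c}\big)$. Consequently, if the deterministic 3SUM hypothesis holds, then for no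 $\epsilon>0$ can 3SUM over $[n^3]$ be solved deterministically in time $O(n^{2-\epsilon})$. -/

import Mathlib

namespace WordRAM

/-- The constant-time arithmetic and bitwise operations of the word RAM. -/
inductive BinOp where
  | add | sub | mul | div | mod | and | or | xor | shiftLeft | shiftRight

/-- The exact value of an operation on natural numbers (subtraction is truncated at `0`,
division rounds down, `x / 0 = 0` and `x mod 0 = x`). -/
def BinOp.eval : BinOp → ℕ → ℕ → ℕ
  | .add, x, y => x + y
  | .sub, x, y => x - y
  | .mul, x, y => x * y
  | .div, x, y => x / y
  | .mod, x, y => x % y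
  | .and, x, y => x &&& y
  | .or, x, y => x ||| y
  | .xor, x, y => x ^^^ y
  | .shiftLeft, x, y => x <<< y
  | .shiftRight, x, y => x >>> y

/-- The instructions of the word RAM. The natural numbers `d a b s` name registers `R d`, … and
`l` names a position in the program. -/
inductive Instr where
  /-- `R d := v` -/
  | const (d v : ℕ)
  /-- `R d := R a ∘ R b` -/
  | op (o : BinOp) (d a b : ℕ)
  /-- `R d := M[R a]` -/
  | load (d a : ℕ)
  /-- `M[R a] := R s` -/
  | store (a s : ℕ)
  /-- continue at position `l` -/
  | jump (l : ℕ)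
  /-- if `R a < R b`, continue at position `l` -/
  | jumpLt (a b l : ℕ)
  /-- stop with the answer `answer` -/
  | halt (answer : Bool)

/-- A program: a finite list of instructions, fixed once and for all inputs. -/
abbrev Program := List Instr

/-- A configuration: program counter, registers and memory. -/
structure Config where
  pc : ℕ
  reg : ℕ → ℕ
  mem : ℕ → ℕ

/-- A machine is running, has halted with an answer, or has crashed. -/
inductive State where
  | running (c : Config)
  | halted (answer : Bool)
  | crashed

/-- Write `v` into register `d` and go to the next instruction. A value that does not fit into a
word of `w` bits makes the machine crash. Hence registers, memory cells and memory addresses always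
hold `w`-bit words (if the input does). -/
def Config.write (w : ℕ) (c : Config) (d v : ℕ) : State :=
  if v < 2 ^ w then
    .running { c with pc := c.pc + 1, reg := Function.update c.reg d v }
  else .crashed

/-- Execute one instruction on the RAM with word length `w`. -/
def Instr.exec (w : ℕ) (c : Config) : Instr → State
  | .const d v => c.write w d v
  | .op o d a b => c.write w d (o.eval (c.reg a) (c.reg b))
  | .load d a => c.write w d (c.mem (c.reg a))
  | .store a s =>
      .running { c with pc := c.pc + 1, mem := Function.update c.mem (c.reg a) (c.reg s) }
  | .jump l => .running { c with pc := l }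
  | .jumpLt a b l => .running { c with pc := if c.reg a < c.reg b then l else c.pc + 1 }
  | .halt answer => .halted answer

/-- One step of the program `P`: execute the instruction at the program counter. Leaving the program
is a crash; a machine that has halted or crashed stays so. -/
def step (w : ℕ) (P : Program) : State → State
  | .running c =>
      match P[c.pc]? with
      | some i => i.exec w c
      | none => .crashed
  | .halted answer => .halted answer
  | .crashed => .crashed

/-- The initial state on the input `x₀, …, xₙ₋₁`: register `0` holds `n`, memory cell `i` holds `xᵢ`
for `i < n`, and everything else is `0`. -/
def init (xs : List ℕ) : State :=
  .running
    { pc := 0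
      reg := Function.update (fun _ => 0) 0 xs.length
      mem := fun i => xs.getD i 0 }

/-- The state of the program `P` after `t` steps on the input `xs`, on the RAM with word
length `w`. -/
def run (w : ℕ) (P : Program) (xs : List ℕ) (t : ℕ) : State :=
  (step w P)^[t] (init xs)

end WordRAM

/-- `A` is a yes-instance of 3SUM. -/
def HasThreeSum (A : Finset ℕ) : Prop :=
  ∃ a ∈ A, ∃ b ∈ A, ∃ c ∈ A, a + b = c

/-- The word length `κ · ⌈log₂ (n + U + 2)⌉ = Θ(log n + log U)`. -/
def wordLength (κ n U : ℕ) : ℕ :=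
  κ * Nat.clog 2 (n + U + 2)

/-- 3SUM, restricted to instances `A ⊆ [U] = {1, …, U}` of size `n` such that `adm n U` holds, is
solved in deterministic time `O(T n U)`: there is one program that, on a word RAM with words of
`O(log n + log U)` bits, halts with the correct answer on all these instances, given as a list of
the elements of `A` in any order, and whose number of steps is at most a constant times `T n U`
whenever `n ≥ 1` and `U ≥ 2`. -/
def ThreeSumSolvable (adm : ℕ → ℕ → Prop) (T : ℕ → ℕ → ℝ) : Prop :=
  ∃ (P : WordRAM.Program) (κ : ℕ) (C : ℝ), 1 ≤ κ ∧
    ∀ (U : ℕ) (xs : List ℕ), xs.Nodup → xs.toFinset ⊆ Finset.Icc 1 U → adm xs.length U →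
      ∃ (t : ℕ) (answer : Bool),
        WordRAM.run (wordLength κ xs.length U) P xs t = .halted answer ∧
        (answer = true ↔ HasThreeSum xs.toFinset) ∧
        (1 ≤ xs.length → 2 ≤ U → (t : ℝ) ≤ C * T xs.length U)

/-- 3SUM over `[n ^ k]` can be solved in deterministic time `O(n ^ e)`. -/
def ThreeSumOverPowSolvable (k : ℕ) (e : ℝ) : Prop :=
  ThreeSumSolvable (fun n U => U = n ^ k) (fun n _ => (n : ℝ) ^ e)

/-- 3SUM over an arbitrary universe `[U]` can be solved in deterministic time
`O(n ^ e * (log U) ^ c)`. -/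
def ThreeSumOverAnySolvable (e c : ℝ) : Prop :=
  ThreeSumSolvable (fun _ _ => True) (fun n U => (n : ℝ) ^ e * Real.log U ^ c)

/-- The deterministic 3SUM hypothesis: for every `ε > 0` there is a constant `k` such that 3SUM over
`[n ^ k]` has no deterministic algorithm of running time `O(n ^ (2 - ε))`. -/
def DeterministicThreeSumHypothesis : Prop :=
  ∀ ε : ℝ, 0 < ε → ∃ k : ℕ, ¬ ThreeSumOverPowSolvable k (2 - ε)

/-! Let `b = ⌊n ^ (1 / (10H))⌋` for a large constant `H`, and measure everything in powers of `b`,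
up to constants and powers of `l ≈ log U`. Since `n ^ 2` is about `b ^ (20H)`, it suffices to save
one factor `b`.

Elements are hashed to their residues modulo a number `m`. A nonzero integer below `2 ^ (l + 1)` has
at most `l` prime divisors, and there are at least `b / (2l)` primes up to `b`. So multiplying `m`
by an average prime `p ≤ b` reduces the false solutions modulo `m` by a factor of about `b / (2l ^
2)`. Randomness is avoided by trying all multipliers up to `b`, counting the collisions exactly, and
keeping the best (`falseColl_step`). Genuine solutions do not disturb the comparison, because they
contribute equally for every modulus (`coll_eq`). The count is a trilinear form in the histogram of
residues, and Karatsuba's identity (`triForm_two_mul`) evaluates it within about `3 ^ (log₂ m)`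
operations. As `m ≤ b ^ (12H)` and `log₂ 3 < 8/5`, this is at most about `b ^ (20H - 2)` for each
candidate.

After `12H` multipliers, `m = m₁ * m₂` with `m₁ ≤ b ^ (9H + 6)` and `m₂ ≤ b ^ (3H - 6)`. The
elements go into `m₁` buckets of capacity `b ^ (H - 2)`. Elements of overfull buckets and elements
whose residue modulo `m` is not unique number about `b ^ (10H - 4)` at most, and each is treated in
linear time. For two buckets of summands, the bucket of the sum is determined, and what remains is a
3SUM problem modulo `m₂` for the quotients, with a carry (`sum_mod_iff`). It is encoded as an
instance of size `N = b ^ (H - 1)` over `[N ^ 3]` (`instVal_sum`). One call of the assumed algorithm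
costs about `b ^ ((H - 1)(2 - δ)) ≤ b ^ (2H - 13)` when `δ (H - 1) ≥ 11`, so all `m₁ ^ 2` calls cost
about `b ^ (20H - 1)`.

A positive answer may be false, so it is checked in time about `b ^ (2H - 4)` by looking at all
pairs of the two buckets. A failed check is charged to a false triple modulo `m`, and only about `b
^ (18H)` of these are left. A successful check happens once.

At the level of the machine, the algorithm is written in a small structured language with a weakest
precondition calculus that includes a clock. `Com.sound` shows that its compilation to the word RAM
is correct, and `Com.oracle_sound` that the assumed program can be simulated in a memory region of
its own.

The second statement follows because on universes `[n ^ k]` the power of the logarithm is absorbed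
by half of the saving in the exponent (`pow_solvable_of_any`). -/

set_option linter.constructorNameAsVariable false

namespace WordRAM

/-! ### A structured language over the word RAM -/

/-- The variables of the structured language. -/
inductive Var where
  | n | mx | g | y | cst | i | j | t | u | ans | dd | b | pw
  | md | rr | n2 | lv | r | z | n22 | len | nb | o | h | o2 | lev | q | s1 | s2 | s3 | d1 | d2
  | phi | best | bm | p | m | st | k1 | k2 | m1 | m2 | s | x | r2 | c1 | c2 | d
  | e | cx | cy | cz | id | nn | el | val | t2 | res | yy
  deriving DecidableEq

/-- The statically allocated arrays of the structured language; `input` holds the input. -/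
inductive Arr where
  | input | table | X | B | C | cntB | cntR | bucket | fill
  deriving DecidableEq

/-- The operations allowed in expressions. -/
inductive Op where
  | add | sub | mul | div | mod

def Op.toBin : Op → BinOp
  | .add => .add
  | .sub => .sub
  | .mul => .mul
  | .div => .div
  | .mod => .mod

/-- Expressions; `get a x` is the entry of the array `a` whose index is the value of `x`. -/
inductive Exp where
  | var (x : Var)
  | num (c : ℕ)
  | bin (o : Op) (a b : Exp)
  | get (a : Arr) (x : Var)

/-- Commands. `loop i n c` runs `c` for `i = 0, …, n - 1`. -/
inductive Com where
  | skip
  | setc (x : Var) (c : ℕ)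
  | assign (x : Var) (e : Exp)
  | store (a : Arr) (x : Var) (e : Exp)
  | storeDyn (d x : Var) (e : Exp)
  | seq (a b : Com)
  | ite (e₁ e₂ : Exp) (a b : Com)
  | loop (i n : Var) (c : Com)
  | oracle (x d n : Var)

/-- States of the structured language: variables, static arrays, dynamically addressed arrays, and
a clock. -/
structure St where
  reg : Var → ℕ
  arr : Arr → ℕ → ℕ
  dyn : ℕ → ℕ → ℕ
  time : ℕ

namespace St

def set (s : St) (x : Var) (v : ℕ) : St :=
  { s with reg := fun y => if y = x then v else s.reg y }

def setArr (s : St) (a : Arr) (i v : ℕ) : St :=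
  { s with arr := fun a' i' => if a' = a then (if i' = i then v else s.arr a' i') else s.arr a' i' }

def setDyn (s : St) (d i v : ℕ) : St :=
  { s with dyn := fun d' i' => if d' = d then (if i' = i then v else s.dyn d' i') else s.dyn d' i' }

def setRegion (s : St) (d : ℕ) (f : ℕ → ℕ) : St :=
  { s with dyn := fun d' => if d' = d then f else s.dyn d' }

def tick (s : St) (t : ℕ) : St :=
  { s with time := s.time + t }

section simps
variable (s : St) (x y : Var) (a a' : Arr) (d d' i i' v t : ℕ) (f : ℕ → ℕ)

@[simp] theorem set_reg : (s.set x v).reg y = if y = x then v else s.reg y := rfl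
@[simp] theorem set_arr : (s.set x v).arr = s.arr := rfl
@[simp] theorem set_dyn : (s.set x v).dyn = s.dyn := rfl
@[simp] theorem set_time : (s.set x v).time = s.time := rfl
@[simp] theorem setArr_reg : (s.setArr a i v).reg = s.reg := rfl
@[simp] theorem setArr_arr : (s.setArr a i v).arr a' i' =
    if a' = a then (if i' = i then v else s.arr a' i') else s.arr a' i' := rfl
@[simp] theorem setArr_dyn : (s.setArr a i v).dyn = s.dyn := rfl
@[simp] theorem setArr_time : (s.setArr a i v).time = s.time := rfl
@[simp] theorem setDyn_reg : (s.setDyn d i v).reg = s.reg := rfl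
@[simp] theorem setDyn_arr : (s.setDyn d i v).arr = s.arr := rfl
@[simp] theorem setDyn_dyn : (s.setDyn d i v).dyn d' i' =
    if d' = d then (if i' = i then v else s.dyn d' i') else s.dyn d' i' := rfl
@[simp] theorem setDyn_time : (s.setDyn d i v).time = s.time := rfl
@[simp] theorem setRegion_reg : (s.setRegion d f).reg = s.reg := rfl
@[simp] theorem setRegion_arr : (s.setRegion d f).arr = s.arr := rfl
@[simp] theorem setRegion_dyn : (s.setRegion d f).dyn d' =
    if d' = d then f else s.dyn d' := rfl
@[simp] theorem setRegion_time : (s.setRegion d f).time = s.time := rfl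
@[simp] theorem tick_reg : (s.tick t).reg = s.reg := rfl
@[simp] theorem tick_arr : (s.tick t).arr = s.arr := rfl
@[simp] theorem tick_dyn : (s.tick t).dyn = s.dyn := rfl
@[simp] theorem tick_time : (s.tick t).time = s.time + t := rfl
end simps

end St

/-- The value of an operation. -/
def Op.eval : Op → ℕ → ℕ → ℕ
  | .add, x, y => x + y
  | .sub, x, y => x - y
  | .mul, x, y => x * y
  | .div, x, y => x / y
  | .mod, x, y => x % y

namespace Exp

def eval (s : St) : Exp → ℕ
  | var x => s.reg x
  | num c => c
  | bin o a b => o.eval (a.eval s) (b.eval s)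
  | get a x => s.arr a (s.reg x)

/-- The number of instructions that evaluate an expression. -/
def cost : Exp → ℕ
  | var _ => 1
  | num _ => 1
  | bin _ a b => a.cost + b.cost + 1
  | get _ _ => 4

/-- If all entries of the state are below `Y`, the value is below `Y ^ deg`. -/
def deg : Exp → ℕ
  | var _ => 1
  | num c => c
  | get _ _ => 1
  | bin .add a b => max a.deg b.deg + 1
  | bin .sub a _ => a.deg
  | bin .mul a b => a.deg + b.deg
  | bin .div a _ => a.deg
  | bin .mod a _ => a.deg

/-- The threshold 40 matches the assumption `X.Y ^ 40 ≤ 2 ^ w` of the soundness theorems: all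
intermediate values of a well-formed expression fit into a word, so its evaluation does not crash.
-/
def wf : Exp → Bool
  | var _ => true
  | num c => c ≤ 40
  | get _ _ => true
  | bin o a b => (bin o a b).deg ≤ 40 && a.wf && b.wf

/-- Such expressions can be evaluated before the size of the memory regions is known: the input is
array number 0, so its address does not depend on that size. -/
def inputOnly : Exp → Bool
  | var _ => true
  | num _ => true
  | get a _ => a = .input
  | bin _ a b => a.inputOnly && b.inputOnly

instance : Add Exp := ⟨bin .add⟩
instance : Sub Exp := ⟨bin .sub⟩
instance : Mul Exp := ⟨bin .mul⟩
instance : Div Exp := ⟨bin .div⟩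
instance : Mod Exp := ⟨bin .mod⟩

section
variable (s : St) (a b : Exp)
@[simp] theorem eval_var (x : Var) : (var x).eval s = s.reg x := rfl
@[simp] theorem eval_num (c : ℕ) : (num c).eval s = c := rfl
@[simp] theorem eval_get (a : Arr) (x : Var) : (get a x).eval s = s.arr a (s.reg x) := rfl
@[simp] theorem eval_add : (a + b).eval s = a.eval s + b.eval s := rfl
@[simp] theorem eval_sub : (a - b).eval s = a.eval s - b.eval s := rfl
@[simp] theorem eval_mul : (a * b).eval s = a.eval s * b.eval s := rfl
@[simp] theorem eval_div : (a / b).eval s = a.eval s / b.eval s := rfl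
@[simp] theorem eval_mod : (a % b).eval s = a.eval s % b.eval s := rfl
@[simp] theorem cost_var (x : Var) : (var x).cost = 1 := rfl
@[simp] theorem cost_num (c : ℕ) : (num c).cost = 1 := rfl
@[simp] theorem cost_get (a : Arr) (x : Var) : (get a x).cost = 4 := rfl
@[simp] theorem cost_add : (a + b).cost = a.cost + b.cost + 1 := rfl
@[simp] theorem cost_sub : (a - b).cost = a.cost + b.cost + 1 := rfl
@[simp] theorem cost_mul : (a * b).cost = a.cost + b.cost + 1 := rfl
@[simp] theorem cost_div : (a / b).cost = a.cost + b.cost + 1 := rfl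
@[simp] theorem cost_mod : (a % b).cost = a.cost + b.cost + 1 := rfl
end

end Exp

infixr:60 " ;; " => Com.seq
infix:62 " ::= " => Com.assign

/-- An upper bound for the registers that an instruction mentions. -/
def Instr.regBound : Instr → ℕ
  | .const d _ => d + 1
  | .op _ d a b => d + a + b + 1
  | .load d a => d + a + 1
  | .store a s => a + s + 1
  | .jump _ => 0
  | .jumpLt a b _ => a + b + 1
  | .halt _ => 0

/-- An upper bound for the registers that a program mentions. -/
def Program.regBound (O : Program) : ℕ :=
  (O.map Instr.regBound).sum + 1

/-- The number of steps of an oracle call for a program `O` that makes at most `T` steps. -/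
def oracleCost (O : Program) (T : ℕ) : ℕ :=
  2 * T + O.regBound + 4

namespace Com

/-- The variables that a command may change. -/
def wr : Com → Var → Bool
  | skip, _ => false
  | setc x _, y => y = x
  | assign x _, y => y = x
  | store _ _ _, _ => false
  | storeDyn _ _ _, _ => false
  | seq a b, y => a.wr y || b.wr y
  | ite _ _ a b, y => a.wr y || b.wr y
  | loop i _ c, y => y = i || c.wr y
  | oracle x _ _, y => y = x

/-- The static arrays that a command may change. -/
def wa : Com → Arr → Bool
  | store a _ _, a' => a' = a
  | seq a b, y => a.wa y || b.wa y
  | ite _ _ a b, y => a.wa y || b.wa y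
  | loop _ _ c, y => c.wa y
  | _, _ => false

/-- Can the command change dynamically addressed arrays? -/
def wd : Com → Bool
  | storeDyn _ _ _ => true
  | oracle _ _ _ => true
  | seq a b => a.wd || b.wd
  | ite _ _ a b => a.wd || b.wd
  | loop _ _ c => c.wd
  | _ => false

def wf : Com → Bool
  | skip => true
  | setc _ _ => true
  | assign _ e => e.wf
  | store _ _ e => e.wf
  | storeDyn _ _ e => e.wf
  | seq a b => a.wf && b.wf
  | ite e₁ e₂ a b => e₁.wf && e₂.wf && a.wf && b.wf
  | loop _ _ c => c.wf
  | oracle _ _ _ => true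

/-- The command accesses no array but the input, which it does not change. -/
def inputOnly : Com → Bool
  | skip => true
  | setc _ _ => true
  | assign _ e => e.inputOnly
  | store _ _ _ => false
  | storeDyn _ _ _ => false
  | seq a b => a.inputOnly && b.inputOnly
  | ite e₁ e₂ a b => e₁.inputOnly && e₂.inputOnly && a.inputOnly && b.inputOnly
  | loop _ _ c => c.inputOnly
  | oracle _ _ _ => false

end Com

/-! ### Weakest preconditions with a clock and an oracle -/

/-- The data of the semantics: a bound `Y` for all values, and an oracle program `O`, run with
word length parameter `κ` and a bound `T` for its number of steps. -/
structure Ctx where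
  Y : ℕ
  O : Program
  κ : ℕ
  T : ℕ → ℕ

/-- The weakest precondition of a command. -/
def wp (X : Ctx) : Com → (St → Prop) → St → Prop
  | .skip, Q, s => Q s
  | .setc x c, Q, s => c < X.Y ∧ Q ((s.set x c).tick 1)
  | .assign x e, Q, s => e.eval s < X.Y ∧ Q ((s.set x (e.eval s)).tick (e.cost + 1))
  | .store a x e, Q, s => e.eval s < X.Y ∧ Q ((s.setArr a (s.reg x) (e.eval s)).tick (e.cost + 4))
  | .storeDyn d x e, Q, s =>
      e.eval s < X.Y ∧ Q ((s.setDyn (s.reg d) (s.reg x) (e.eval s)).tick (e.cost + 6))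
  | .seq a b, Q, s => wp X a (wp X b Q) s
  | .ite e₁ e₂ a b, Q, s =>
      (e₁.eval s < e₂.eval s → wp X a Q (s.tick (e₁.cost + e₂.cost + 2))) ∧
      (¬ e₁.eval s < e₂.eval s → wp X b Q (s.tick (e₁.cost + e₂.cost + 2)))
  | .loop i n c, Q, s =>
      ∃ I : ℕ → St → Prop, I 0 ((s.set i 0).tick 1) ∧
        (∀ k s', I k s' → s'.reg i = k ∧ s'.reg n = s.reg n) ∧
        (∀ k < s.reg n, ∀ s', I k s' → wp X c (fun s'' => s''.reg i = k ∧
          I (k + 1) ((s''.set i (k + 1)).tick 4)) s') ∧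
        (∀ s', I (s.reg n) s' → Q (s'.tick 2))
  | .oracle x d n, Q, s =>
      2 ≤ s.reg n ∧ 2 ^ wordLength X.κ (s.reg n) (s.reg n ^ 3) ≤ X.Y ∧
      (∀ i < s.reg n, ∀ j < s.reg n, s.dyn (s.reg d) i = s.dyn (s.reg d) j → i = j) ∧
      (∀ i < s.reg n, 1 ≤ s.dyn (s.reg d) i ∧ s.dyn (s.reg d) i ≤ s.reg n ^ 3) ∧
      (∀ i, s.reg n ≤ i → s.dyn (s.reg d) i = 0) ∧
      ∀ f : ℕ → ℕ, ∀ a ≤ 1,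
        (a = 1 ↔ ∃ i < s.reg n, ∃ j < s.reg n, ∃ k < s.reg n,
          s.dyn (s.reg d) i + s.dyn (s.reg d) j = s.dyn (s.reg d) k) →
        ∀ t ≤ oracleCost X.O (X.T (s.reg n)), Q (((s.setRegion (s.reg d) f).set x a).tick t)

theorem wp_mono {X : Ctx} {c : Com} {Q Q' : St → Prop} (hQ : ∀ s, Q s → Q' s) :
    ∀ {s}, wp X c Q s → wp X c Q' s := by
  induction c generalizing Q Q' with
  | skip => exact fun h => hQ _ h
  | setc x c => exact fun h => ⟨h.1, hQ _ h.2⟩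
  | assign x e => exact fun h => ⟨h.1, hQ _ h.2⟩
  | store a x e => exact fun h => ⟨h.1, hQ _ h.2⟩
  | storeDyn d x e => exact fun h => ⟨h.1, hQ _ h.2⟩
  | seq a b iha ihb => exact fun h => iha (fun s => ihb hQ) h
  | ite e₁ e₂ a b iha ihb => exact fun h => ⟨fun h' => iha hQ (h.1 h'), fun h' => ihb hQ (h.2 h')⟩
  | loop i n c ih => exact fun ⟨I, h0, h1, h2, h3⟩ => ⟨I, h0, h1, h2, fun s h => hQ _ (h3 s h)⟩
  | oracle x d n =>
    exact fun ⟨h0, h1, h2, h3, h4, h5⟩ => ⟨h0, h1, h2, h3, h4,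
      fun f a ha h t ht => hQ _ (h5 f a ha h t ht)⟩

/-- What a command leaves unchanged. -/
def Com.Frame (c : Com) (s s' : St) : Prop :=
  (∀ x, c.wr x = false → s'.reg x = s.reg x) ∧ (∀ a, c.wa a = false → s'.arr a = s.arr a) ∧
    (c.wd = false → s'.dyn = s.dyn)

theorem Com.Frame.reg {c : Com} {s s' : St} (h : c.Frame s s') {x : Var} {v : ℕ}
    (hv : s.reg x = v) (hx : c.wr x = false) : s'.reg x = v := (h.1 x hx).trans hv

theorem Com.Frame.arr {c : Com} {s s' : St} (h : c.Frame s s') (a : Arr)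
    (hx : c.wa a = false) : s'.arr a = s.arr a := h.2.1 a hx

/-- The sets of written variables and arrays are syntactic, and everything outside them survives
each command. Specifications therefore mention only what changes, and `rfl` settles the side
conditions. -/
theorem wp_frame {X : Ctx} {c : Com} {Q : St → Prop} :
    ∀ {s}, wp X c Q s → wp X c (fun s' => Q s' ∧ c.Frame s s') s := by
  induction c generalizing Q with
  | skip => exact fun h => ⟨h, fun _ _ => rfl, fun _ _ => rfl, fun _ => rfl⟩
  | setc x c =>
    intro s h
    refine ⟨h.1, h.2, fun y hy => ?_, fun _ _ => rfl, fun _ => rfl⟩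
    have : y ≠ x := by simpa [Com.wr] using hy
    simp [this]
  | assign x e =>
    intro s h
    refine ⟨h.1, h.2, fun y hy => ?_, fun _ _ => rfl, fun _ => rfl⟩
    have : y ≠ x := by simpa [Com.wr] using hy
    simp [this]
  | store a x e =>
    intro s h
    refine ⟨h.1, h.2, fun y hy => rfl, fun a' ha => ?_, fun _ => rfl⟩
    have : a' ≠ a := by simpa [Com.wa] using ha
    funext i
    simp [this]
  | storeDyn d x e =>
    intro s h
    exact ⟨h.1, h.2, fun y hy => rfl, fun a' ha => rfl, fun h => by simp [Com.wd] at h⟩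
  | seq a b iha ihb =>
    intro s h
    refine wp_mono (c := a) ?_ (iha h)
    rintro s1 ⟨h1, f1⟩
    refine wp_mono (c := b) ?_ (ihb h1)
    rintro s2 ⟨h2, f2⟩
    refine ⟨h2, fun x hx => ?_, fun x hx => ?_, fun hx => ?_⟩
    · simp only [Com.wr, Bool.or_eq_false_iff] at hx
      rw [f2.1 x hx.2, f1.1 x hx.1]
    · simp only [Com.wa, Bool.or_eq_false_iff] at hx
      rw [f2.2.1 x hx.2, f1.2.1 x hx.1]
    · simp only [Com.wd, Bool.or_eq_false_iff] at hx
      rw [f2.2.2 hx.2, f1.2.2 hx.1]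
  | ite e₁ e₂ a b iha ihb =>
    intro s h
    refine ⟨fun h' => wp_mono ?_ (iha (h.1 h')), fun h' => wp_mono ?_ (ihb (h.2 h'))⟩ <;>
    · rintro s1 ⟨h1, f1⟩
      refine ⟨h1, fun x hx => ?_, fun x hx => ?_, fun hx => ?_⟩
      · simp only [Com.wr, Bool.or_eq_false_iff] at hx
        first | exact f1.1 x hx.1 | exact f1.1 x hx.2
      · simp only [Com.wa, Bool.or_eq_false_iff] at hx
        first | exact f1.2.1 x hx.1 | exact f1.2.1 x hx.2
      · simp only [Com.wd, Bool.or_eq_false_iff] at hx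
        first | exact f1.2.2 hx.1 | exact f1.2.2 hx.2
  | loop i n c ih =>
    rintro s ⟨I, h0, h1, h2, h3⟩
    refine ⟨fun k s' => I k s' ∧ (Com.loop i n c).Frame s s', ⟨h0, fun x hx => ?_, fun _ _ => rfl,
      fun _ => rfl⟩, fun k s' h => h1 k s' h.1, ?_, fun s' h => ⟨h3 s' h.1, h.2⟩⟩
    · simp only [Com.wr, Bool.or_eq_false_iff, decide_eq_false_iff_not] at hx
      simp [hx.1]
    · rintro k hk s' ⟨hI, hf⟩
      refine wp_mono ?_ (ih (h2 k hk s' hI))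
      rintro s'' ⟨⟨h4, h5⟩, f2⟩
      refine ⟨h4, h5, fun x hx => ?_, fun x hx => ?_, fun hx => ?_⟩
      · rw [← hf.1 x hx]
        simp only [Com.wr, Bool.or_eq_false_iff, decide_eq_false_iff_not] at hx
        simp [hx.1, f2.1 x hx.2]
      · rw [← hf.2.1 x hx]
        exact f2.2.1 x hx
      · rw [← hf.2.2 hx]
        exact f2.2.2 hx
  | oracle x d n =>
    rintro s ⟨h0, h1, h2, h3, h4, h5⟩
    refine ⟨h0, h1, h2, h3, h4, fun f a ha h t ht => ⟨h5 f a ha h t ht, fun y hy => ?_,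
      fun _ _ => rfl, fun h => by simp [Com.wd] at h⟩⟩
    have : y ≠ x := by simpa [Com.wr] using hy
    simp [this]

/-- Replace a command by its specification. -/
theorem wp_use {X : Ctx} {c : Com} {Q Q' : St → Prop} {s : St} (h : wp X c Q s)
    (hQ : ∀ s', Q s' → c.Frame s s' → Q' s') : wp X c Q' s :=
  wp_mono (fun s' h' => hQ s' h'.1 h'.2) (wp_frame h)

/-- The rule for loops: the invariant may use what the loop leaves unchanged. -/
theorem wp_loop {X : Ctx} {i n : Var} {c : Com} {Q : St → Prop} {s : St} (I : ℕ → St → Prop)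
    (hi : c.wr i = false) (hn : (Com.loop i n c).wr n = false)
    (h0 : I 0 ((s.set i 0).tick 1))
    (hstep : ∀ k < s.reg n, ∀ s', (Com.loop i n c).Frame s s' → s'.reg i = k → I k s' →
      wp X c (fun s'' => I (k + 1) ((s''.set i (k + 1)).tick 4)) s')
    (hQ : ∀ s', (Com.loop i n c).Frame s s' → I (s.reg n) s' → Q (s'.tick 2)) :
    wp X (.loop i n c) Q s := by
  refine ⟨fun k s' => I k s' ∧ s'.reg i = k ∧ (Com.loop i n c).Frame s s', ⟨h0, by simp, ?_⟩,
    fun k s' h => ⟨h.2.1, h.2.2.1 n hn⟩, ?_, fun s' h => hQ s' h.2.2 h.1⟩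
  · refine ⟨fun x hx => ?_, fun _ _ => rfl, fun _ => rfl⟩
    simp only [Com.wr, Bool.or_eq_false_iff, decide_eq_false_iff_not] at hx
    simp [hx.1]
  · rintro k hk s' ⟨hI, hk', hf⟩
    refine wp_use (hstep k hk s' hf hk' hI) ?_
    rintro s'' h5 f2
    refine ⟨by rw [f2.1 i hi, hk'], h5, by simp, fun x hx => ?_, fun x hx => ?_, fun hx => ?_⟩
    · rw [← hf.1 x hx]
      simp only [Com.wr, Bool.or_eq_false_iff, decide_eq_false_iff_not] at hx
      simp [hx.1, f2.1 x hx.2]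
    · rw [← hf.2.1 x hx]
      exact f2.2.1 x hx
    · rw [← hf.2.2 hx]
      exact f2.2.2 hx

/-- The rule for loops whose iterations cost at most `K` steps each. -/
theorem wp_loop_time {X : Ctx} {i n : Var} {c : Com} {Q : St → Prop} {s : St} (K : ℕ)
    (I : ℕ → St → Prop)
    (hi : c.wr i = false) (hn : (Com.loop i n c).wr n = false)
    (h0 : I 0 ((s.set i 0).tick 1))
    (hstep : ∀ k < s.reg n, ∀ s', (Com.loop i n c).Frame s s' → s'.reg i = k → I k s' →
      wp X c (fun s'' => s''.time + 4 ≤ s'.time + K ∧ I (k + 1) ((s''.set i (k + 1)).tick 4)) s')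
    (hQ : ∀ s', (Com.loop i n c).Frame s s' → I (s.reg n) s' →
      s'.time + 2 ≤ s.time + (s.reg n * K + 3) → Q (s'.tick 2)) :
    wp X (.loop i n c) Q s := by
  -- The additive 1 pays for initialising the counter. The overhead of 4 steps per iteration is part
  -- of `K`, and leaving the loop costs 2 more.
  refine wp_loop (fun k s' => I k s' ∧ s'.time ≤ s.time + (k * K + 1)) hi hn ⟨h0, by simp⟩ ?_ ?_
  · rintro k hk s' hf hk' ⟨hI, ht⟩
    refine wp_mono ?_ (hstep k hk s' hf hk' hI)
    rintro s'' ⟨h1, h2⟩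
    refine ⟨h2, ?_⟩
    simp only [St.tick_time, St.set_time]
    rw [Nat.add_mul]
    omega
  · rintro s' hf ⟨hI, ht⟩
    exact hQ s' hf hI (by omega)

/-! ### Compilation -/

/-- The machine register of a variable. -/
def Var.mreg (x : Var) : ℕ := 3 * x.ctorIdx

/-- The machine registers for temporary values. -/
def tmp (t : ℕ) : ℕ := 3 * t + 1

/-- The machine registers of a simulated program. -/
def oreg (r : ℕ) : ℕ := 3 * r + 11

/-- Machine register `2` holds the size of the memory region of an array, registers `5` and `8`
serve the simulation of an oracle. -/
def Exp.code (t : ℕ) : Exp → List Instr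
  | .var x => [.op .or (tmp t) x.mreg x.mreg]
  | .num c => [.const (tmp t) c]
  | .bin o a b => a.code t ++ (b.code (t + 1) ++ [.op o.toBin (tmp t) (tmp t) (tmp (t + 1))])
  | .get a x => [.const (tmp t) a.ctorIdx, .op .mul (tmp t) (tmp t) 2,
      .op .add (tmp t) (tmp t) x.mreg, .load (tmp t) (tmp t)]

/-- The simulation of one instruction by two instructions; the simulated program begins at position
`p`, its memory begins at the address in register `5`; its answer goes to register `d`, and the
execution continues at position `l`. -/
def Instr.sim (p l d : ℕ) : Instr → List Instr
  | .const r v => [.const (oreg r) v, .const 8 0]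
  | .op o r a b => [.op o (oreg r) (oreg a) (oreg b), .const 8 0]
  | .load r a => [.op .add 8 (oreg a) 5, .load (oreg r) 8]
  | .store a x => [.op .add 8 (oreg a) 5, .store 8 (oreg x)]
  | .jump k => [.jump (p + 2 * k), .const 8 0]
  | .jumpLt a b k => [.jumpLt (oreg a) (oreg b) (p + 2 * k), .const 8 0]
  | .halt ans => [.const d (if ans then 1 else 0), .jump l]

/-- The code of an oracle call: find the memory region, clear the registers, run the program. -/
def oracleCode (O : Program) (x d n : Var) (p : ℕ) : List Instr :=
  [.const (tmp 0) 16, .op .add (tmp 0) (tmp 0) d.mreg, .op .mul 5 (tmp 0) 2] ++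
  ((List.range O.regBound).map (fun r => Instr.const (oreg r) 0) ++
  ([.op .or (oreg 0) n.mreg n.mreg] ++
  O.flatMap (Instr.sim (p + (O.regBound + 4)) (p + (O.regBound + 4) + 2 * O.length) x.mreg)))

/-- The code of a command that is placed at position `p` of the program. -/
def Com.code (O : Program) : Com → ℕ → List Instr
  | .skip, _ => []
  | .setc x c, _ => [.const x.mreg c]
  | .assign x e, _ => e.code 0 ++ [.op .or x.mreg (tmp 0) (tmp 0)]
  | .store a x e, _ => e.code 0 ++ [.const (tmp 1) a.ctorIdx, .op .mul (tmp 1) (tmp 1) 2,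
      .op .add (tmp 1) (tmp 1) x.mreg, .store (tmp 1) (tmp 0)]
  | .storeDyn d x e, _ => e.code 0 ++ [.const (tmp 1) 16, .op .add (tmp 1) (tmp 1) d.mreg,
      .op .mul (tmp 1) (tmp 1) 2, .op .add (tmp 1) (tmp 1) x.mreg, .store (tmp 1) (tmp 0)]
  | .seq a b, p => a.code O p ++ b.code O (p + (a.code O p).length)
  | .ite e₁ e₂ a b, p =>
      let p₁ := p + (e₁.cost + e₂.cost) + 1
      let p₂ := p₁ + (b.code O p₁).length + 1
      e₁.code 0 ++ (e₂.code 1 ++ ([.jumpLt (tmp 0) (tmp 1) p₂] ++ (b.code O p₁ ++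
        ([.jump (p₂ + (a.code O p₂).length)] ++ a.code O p₂))))
  | .loop i n c, p =>
      [.const i.mreg 0, .jumpLt i.mreg n.mreg (p + 3),
        .jump (p + 3 + (c.code O (p + 3)).length + 3)] ++ (c.code O (p + 3) ++
      [.const (tmp 0) 1, .op .add i.mreg i.mreg (tmp 0), .jump (p + 1)])
  | .oracle x d n, p => oracleCode O x d n p

/-- The code of an expression is straight-line, so its length equals its running time; the jump
targets in `Com.code` rely on this. -/
theorem Exp.length_code (e : Exp) : ∀ t, (e.code t).length = e.cost := by
  induction e with
  | var x => intro t; rfl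
  | num c => intro t; rfl
  | get a x => intro t; rfl
  | bin o a b iha ihb => intro t; simp [code, cost, iha, ihb]; omega

/-! ### Code fragments and reachability -/

/-- The instructions `l` are at position `p` of the program `P`. -/
def At (P : Program) (p : ℕ) (l : List Instr) : Prop :=
  ∀ i, i < l.length → P[p + i]? = l[i]?

theorem At.append {P : Program} {p : ℕ} {l l' : List Instr} :
    At P p (l ++ l') ↔ At P p l ∧ At P (p + l.length) l' := by
  constructor
  · intro h
    refine ⟨fun i hi => ?_, fun i hi => ?_⟩
    · rw [h i (by simp; omega), List.getElem?_append_left hi]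
    · rw [Nat.add_assoc, h _ (by simp; omega), List.getElem?_append_right (by omega)]
      simp
  · rintro ⟨h, h'⟩ i hi
    rcases lt_or_ge i l.length with h1 | h1
    · rw [h i h1, List.getElem?_append_left h1]
    · rw [List.getElem?_append_right h1, ← h' (i - l.length) (by simp at hi; omega)]
      congr 1
      omega

theorem At.cons {P : Program} {p : ℕ} {a : Instr} {l : List Instr} :
    At P p (a :: l) ↔ P[p]? = some a ∧ At P (p + 1) l := by
  rw [show a :: l = [a] ++ l from rfl, At.append]
  refine and_congr ⟨fun h => by simpa using h 0 (by simp), fun h i hi => ?_⟩ Iff.rfl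
  obtain rfl : i = 0 := by simpa using hi
  simpa using h

/-- From configuration `c`, the program reaches `c'` in `t` steps. -/
def Reach (w : ℕ) (P : Program) (t : ℕ) (c c' : Config) : Prop :=
  (step w P)^[t] (.running c) = .running c'

theorem Reach.refl {w : ℕ} {P : Program} {c : Config} : Reach w P 0 c c := rfl

theorem Reach.trans {w : ℕ} {P : Program} {t t' : ℕ} {c c' c'' : Config}
    (h : Reach w P t c c') (h' : Reach w P t' c' c'') : Reach w P (t + t') c c'' := by
  unfold Reach at *
  rw [Nat.add_comm, Function.iterate_add_apply, h, h']

theorem Reach.one {w : ℕ} {P : Program} {c c' : Config} {i : Instr} (hi : P[c.pc]? = some i)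
    (h : i.exec w c = .running c') : Reach w P 1 c c' := by
  simp [Reach, step, hi, h]

section steps

variable {w : ℕ} {P : Program} {t : ℕ} {c₀ c : Config} (hr : Reach w P t c₀ c) {p d a b v l : ℕ}
include hr

theorem Reach.const (h : P[p]? = some (.const d v)) (hp : c.pc = p) (hv : v < 2 ^ w) :
    Reach w P (t + 1) c₀ ⟨p + 1, Function.update c.reg d v, c.mem⟩ :=
  hr.trans (Reach.one (hp ▸ h) (by simp [Instr.exec, Config.write, hv, hp]))

theorem Reach.op {o : BinOp} (h : P[p]? = some (.op o d a b)) (hp : c.pc = p)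
    (he : o.eval (c.reg a) (c.reg b) = v) (hv : v < 2 ^ w) :
    Reach w P (t + 1) c₀ ⟨p + 1, Function.update c.reg d v, c.mem⟩ :=
  hr.trans (Reach.one (hp ▸ h) (by simp [Instr.exec, Config.write, he, hv, hp]))

theorem Reach.load (h : P[p]? = some (.load d a)) (hp : c.pc = p)
    (he : c.mem (c.reg a) = v) (hv : v < 2 ^ w) :
    Reach w P (t + 1) c₀ ⟨p + 1, Function.update c.reg d v, c.mem⟩ :=
  hr.trans (Reach.one (hp ▸ h) (by simp [Instr.exec, Config.write, he, hv, hp]))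

theorem Reach.store (h : P[p]? = some (.store a d)) (hp : c.pc = p)
    (he : c.reg a = l) (hv : c.reg d = v) :
    Reach w P (t + 1) c₀ ⟨p + 1, c.reg, Function.update c.mem l v⟩ :=
  hr.trans (Reach.one (hp ▸ h) (by simp [Instr.exec, he, hv, hp]))

theorem Reach.jump (h : P[p]? = some (.jump l)) (hp : c.pc = p) :
    Reach w P (t + 1) c₀ ⟨l, c.reg, c.mem⟩ :=
  hr.trans (Reach.one (hp ▸ h) (by simp [Instr.exec]))

theorem Reach.jumpLt_of_lt (h : P[p]? = some (.jumpLt a b l)) (hp : c.pc = p)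
    (hab : c.reg a < c.reg b) :
    Reach w P (t + 1) c₀ ⟨l, c.reg, c.mem⟩ :=
  hr.trans (Reach.one (hp ▸ h) (by simp [Instr.exec, hab]))

theorem Reach.jumpLt_of_not_lt (h : P[p]? = some (.jumpLt a b l)) (hp : c.pc = p)
    (hab : ¬ c.reg a < c.reg b) :
    Reach w P (t + 1) c₀ ⟨p + 1, c.reg, c.mem⟩ :=
  hr.trans (Reach.one (hp ▸ h) (by simp [Instr.exec, hab, hp]))

end steps

/-! ### Soundness of the weakest preconditions -/

section sound

variable {X : Ctx} {w : ℕ} {P : Program} {ρ : ℕ}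

/-- The configuration `c` represents the state `s`, where arrays have memory regions of size `ρ`. -/
structure Rel (X : Ctx) (ρ : ℕ) (s : St) (c : Config) : Prop where
  reg : ∀ x : Var, c.reg x.mreg = s.reg x
  bdd : ∀ x, s.reg x < X.Y
  size : c.reg 2 = ρ
  arr : ∀ a i, i < X.Y → (ρ = X.Y ∨ a = .input) → c.mem (a.ctorIdx * ρ + i) = s.arr a i
  arrBdd : ∀ a i, i < X.Y → s.arr a i < X.Y
  dyn : ρ = X.Y → ∀ d i, i < X.Y → c.mem ((16 + d) * ρ + i) = s.dyn d i
  dynBdd : ∀ d i, i < X.Y → s.dyn d i < X.Y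

theorem Arr.ctorIdx_lt (a : Arr) : a.ctorIdx < 16 := by cases a <;> decide

theorem Arr.ctorIdx_inj {a b : Arr} (h : a.ctorIdx = b.ctorIdx) : a = b := by
  rw [← Arr.ofNat_ctorIdx a, ← Arr.ofNat_ctorIdx b, h]

theorem Var.mreg_inj {x y : Var} : x.mreg = y.mreg ↔ x = y := by
  refine ⟨fun h => ?_, fun h => by rw [h]⟩
  have h : x.ctorIdx = y.ctorIdx := by unfold Var.mreg at h; omega
  rw [← Var.ofNat_ctorIdx x, ← Var.ofNat_ctorIdx y, h]

/-- The kinds of registers are separated modulo 3: variables have residue 0, temporaries residue 1,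
and residue 2 is left for the reserved registers 2, 5, 8 and, from 11 on, for the simulated program.
-/
theorem Var.mreg_ne_tmp (x : Var) (t : ℕ) : x.mreg ≠ tmp t := by
  unfold Var.mreg tmp; omega

theorem Var.mreg_ne_two (x : Var) : x.mreg ≠ 2 := by unfold Var.mreg; omega

theorem two_ne_tmp (t : ℕ) : 2 ≠ tmp t := by unfold tmp; omega

/-- Representation does not depend on temporary registers. -/
theorem Rel.congr {s : St} {c c' : Config} (h : Rel X ρ s c)
    (hr : ∀ x : Var, c'.reg x.mreg = c.reg x.mreg) (h2 : c'.reg 2 = c.reg 2)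
    (hm : c'.mem = c.mem) : Rel X ρ s c' :=
  ⟨fun x => (hr x).trans (h.reg x), h.bdd, h2.trans h.size, by rw [hm]; exact h.arr, h.arrBdd,
    by rw [hm]; exact h.dyn, h.dynBdd⟩

theorem Rel.tick {s : St} {c c' : Config} (h : Rel X ρ s c) (t : ℕ)
    (hr : ∀ x : Var, c'.reg x.mreg = c.reg x.mreg) (h2 : c'.reg 2 = c.reg 2)
    (hm : c'.mem = c.mem) : Rel X ρ (s.tick t) c' :=
  let h' := h.congr hr h2 hm
  ⟨h'.reg, h'.bdd, h'.size, h'.arr, h'.arrBdd, h'.dyn, h'.dynBdd⟩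

theorem Rel.setReg {s : St} {c c' : Config} (h : Rel X ρ s c) (x : Var) (v t : ℕ) (hv : v < X.Y)
    (hx : c'.reg x.mreg = v) (hr : ∀ y : Var, y ≠ x → c'.reg y.mreg = c.reg y.mreg)
    (h2 : c'.reg 2 = c.reg 2) (hm : c'.mem = c.mem) : Rel X ρ ((s.set x v).tick t) c' := by
  refine ⟨fun y => ?_, fun y => ?_, h2.trans h.size, by rw [hm]; exact h.arr, h.arrBdd,
    by rw [hm]; exact h.dyn, h.dynBdd⟩
  · by_cases hy : y = x
    · subst hy; simp [hx]
    · simp [hy, hr y hy, h.reg y]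
  · by_cases hy : y = x
    · simp [hy, hv]
    · simp [hy, h.bdd y]

/-- Two cells of the memory layout coincide only if they are the same. -/
theorem cell_inj {Y a b i j : ℕ} (hi : i < Y) (hj : j < Y) (h : a * Y + i = b * Y + j) :
    a = b ∧ i = j := by
  have hY : 0 < Y := by omega
  have h1 : (a * Y + i) / Y = a := by
    rw [Nat.mul_comm, Nat.mul_add_div hY, Nat.div_eq_of_lt hi, Nat.add_zero]
  have h2 : (b * Y + j) / Y = b := by
    rw [Nat.mul_comm, Nat.mul_add_div hY, Nat.div_eq_of_lt hj, Nat.add_zero]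
  have : a = b := by rw [← h1, ← h2, h]
  subst this
  exact ⟨rfl, by omega⟩

/-- A constant `c` has degree `c` because `c < 2 ^ c ≤ Y ^ c`, and a sum gains one degree because `2
≤ Y`. -/
theorem Exp.eval_lt {s : St} (hY : 2 ≤ X.Y) (hs : ∀ x, s.reg x < X.Y)
    (ha : ∀ a i, i < X.Y → s.arr a i < X.Y) (e : Exp) : e.eval s < X.Y ^ e.deg := by
  have key : ∀ {a b : ℕ}, a ≤ b → X.Y ^ a ≤ X.Y ^ b := fun h => Nat.pow_le_pow_right (by omega) h
  induction e with
  | var x => simpa [Exp.deg] using hs x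
  | num c => exact lt_of_lt_of_le Nat.lt_two_pow_self (Nat.pow_le_pow_left hY c)
  | get a x => simpa [Exp.deg] using ha a _ (hs x)
  | bin o a b iha ihb =>
    cases o with
    | add =>
      simp only [Exp.eval, Op.eval, Exp.deg]
      have h1 := key (le_max_left a.deg b.deg)
      have h2 := key (le_max_right a.deg b.deg)
      rw [pow_succ]
      nlinarith
    | sub => exact lt_of_le_of_lt (Nat.sub_le _ _) iha
    | mul =>
      simp only [Exp.eval, Op.eval, Exp.deg, pow_add]
      exact Nat.mul_lt_mul'' iha ihb
    | div => exact lt_of_le_of_lt (Nat.div_le_self _ _) iha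
    | mod => exact lt_of_le_of_lt (Nat.mod_le _ _) iha

theorem Op.eval_toBin (o : Op) (a b : ℕ) : o.toBin.eval a b = o.eval a b := by
  cases o <;> rfl

/-- Temporaries form a stack: code at depth `t` changes only `tmp k` with `t ≤ k`, so the left
operand survives the evaluation of the right one at depth `t + 1`. The case `ρ = 0` is the situation
before the region size is known. -/
theorem Exp.sound (hY : 2 ≤ X.Y) (hw : X.Y ^ 40 ≤ 2 ^ w) (s : St) (e : Exp) :
    ∀ (t : ℕ) (c : Config), At P c.pc (e.code t) → e.wf = true →
      (ρ = X.Y ∨ (ρ = 0 ∧ e.inputOnly = true)) → Rel X ρ s c →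
      ∃ c', Reach w P e.cost c c' ∧ c'.pc = c.pc + e.cost ∧ c'.mem = c.mem ∧
        c'.reg (tmp t) = e.eval s ∧ ∀ r, (∀ k, t ≤ k → r ≠ tmp k) → c'.reg r = c.reg r := by
  have key : ∀ {a b : ℕ}, a ≤ b → X.Y ^ a ≤ X.Y ^ b := fun h => Nat.pow_le_pow_right (by omega) h
  have hYw : X.Y < 2 ^ w := lt_of_lt_of_le (by
    calc X.Y = X.Y ^ 1 := (pow_one _).symm
      _ < X.Y ^ 40 := Nat.pow_lt_pow_right (by omega) (by omega)) hw
  induction e with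
  | var x =>
    intro t c hat _ _ hr
    rw [Exp.code, At.cons] at hat
    have hv : BinOp.or.eval (c.reg x.mreg) (c.reg x.mreg) = s.reg x := by
      rw [hr.reg, BinOp.eval, Nat.or_self]
    exact ⟨_, Reach.refl.op hat.1 rfl hv ((hr.bdd x).trans hYw), rfl,
      rfl, by simp, fun r hk => by simp [hk t le_rfl]⟩
  | num n =>
    intro t c hat hwf _ hr
    rw [Exp.code, At.cons] at hat
    refine ⟨_, Reach.refl.const hat.1 rfl ?_, rfl,
      rfl, by simp, fun r hk => by simp [hk t le_rfl]⟩
    simp only [Exp.wf, decide_eq_true_eq] at hwf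
    calc n < 2 ^ n := Nat.lt_two_pow_self
      _ ≤ X.Y ^ n := Nat.pow_le_pow_left hY n
      _ ≤ X.Y ^ 40 := key hwf
      _ ≤ 2 ^ w := hw
  | get a x =>
    intro t c hat hwf hin hr
    simp only [Exp.code, At.cons] at hat
    obtain ⟨h1, h2, h3, h4, -⟩ := hat
    have ha := Arr.ctorIdx_lt a
    have hρ : ρ ≤ X.Y := by rcases hin with h | h <;> omega
    have hx := hr.bdd x
    have h16 : 16 * X.Y + X.Y ≤ 2 ^ w := le_trans (by
      calc 16 * X.Y + X.Y ≤ 2 ^ 5 * X.Y := by omega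
        _ ≤ X.Y ^ 5 * X.Y := Nat.mul_le_mul_right _ (Nat.pow_le_pow_left hY 5)
        _ = X.Y ^ 6 := by ring
        _ ≤ X.Y ^ 40 := key (by omega)) hw
    have hmul : a.ctorIdx * ρ ≤ 16 * X.Y := Nat.mul_le_mul ha.le hρ
    have hval : c.mem (a.ctorIdx * ρ + s.reg x) = s.arr a (s.reg x) :=
      hr.arr a _ hx (hin.imp id fun h => by simpa [Exp.inputOnly] using h.2)
    have hlt := hr.arrBdd a _ hx
    have r1 := (Reach.refl (w := w) (P := P) (c := c)).const h1 rfl (by omega)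
    have r2 := r1.op (v := a.ctorIdx * ρ) h2 rfl (by
      simp [BinOp.eval, Function.update_of_ne (two_ne_tmp t), hr.size]) (by omega)
    have r3 := r2.op (v := a.ctorIdx * ρ + s.reg x) h3 rfl (by
      simp [BinOp.eval, Function.update_of_ne (x.mreg_ne_tmp t), hr.reg]) (by omega)
    have r4 := r3.load (v := s.arr a (s.reg x)) h4 rfl (by simp [hval]) (by omega)
    refine ⟨_, r4, by simp [Exp.cost], rfl, by simp,
      fun r hk => by simp [hk t le_rfl]⟩
  | bin o a b iha ihb =>
    intro t c hat hwf hin hr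
    rw [Exp.code, At.append, At.append, At.cons, Exp.length_code, Exp.length_code] at hat
    have hwf' := hwf
    simp only [Exp.wf, Bool.and_eq_true, decide_eq_true_eq] at hwf
    have hin' : (ρ = X.Y ∨ (ρ = 0 ∧ a.inputOnly = true)) ∧
        (ρ = X.Y ∨ (ρ = 0 ∧ b.inputOnly = true)) := by
      simp only [Exp.inputOnly, Bool.and_eq_true] at hin
      tauto
    obtain ⟨c1, r1, p1, m1, v1, f1⟩ := iha t c hat.1 hwf.1.2 hin'.1 hr
    have hr1 : Rel X ρ s c1 := hr.congr (fun x => f1 _ fun k _ => x.mreg_ne_tmp k)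
      (f1 _ fun k _ => two_ne_tmp k) m1
    obtain ⟨c2, r2, p2, m2, v2, f2⟩ := ihb (t + 1) c1 (by rw [p1]; exact hat.2.1) hwf.2 hin'.2 hr1
    have hv1 : c2.reg (tmp t) = a.eval s := by
      rw [f2 _ fun k hk => by unfold tmp; omega, v1]
    have h3 := hat.2.2.1
    refine ⟨_, (r1.trans r2).op (v := (Exp.bin o a b).eval s) h3 (by rw [p2, p1]) ?_ ?_, ?_, ?_,
      by simp, ?_⟩
    · rw [hv1, v2, Op.eval_toBin]; rfl
    · exact (Exp.eval_lt hY hr.bdd hr.arrBdd _).trans_le ((key hwf.1.1).trans hw)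
    · simp [Exp.cost]; omega
    · simp [m2, m1]
    · intro r hk
      simp [hk t le_rfl]
      rw [f2 r fun k hk' => hk k (by omega), f1 r hk]

end sound

variable {X : Ctx} {w : ℕ} {P : Program} {ρ : ℕ}

theorem Rel.setArr {s : St} {c c' : Config} (h : Rel X X.Y s c) (a : Arr) (i v t : ℕ) (hi : i < X.Y)
    (hv : v < X.Y) (hr : ∀ y : Var, c'.reg y.mreg = c.reg y.mreg)
    (h2 : c'.reg 2 = c.reg 2) (hm : c'.mem = Function.update c.mem (a.ctorIdx * X.Y + i) v) :
    Rel X X.Y ((s.setArr a i v).tick t) c' := by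
  refine ⟨fun y => (hr y).trans (h.reg y), h.bdd, h2.trans h.size, fun a' i' hi' _ => ?_,
    fun a' i' hi' => ?_, fun _ d i' hi' => ?_, h.dynBdd⟩
  · rw [hm]
    by_cases hc : a' = a ∧ i' = i
    · simp [hc.1, hc.2]
    · rw [Function.update_of_ne, h.arr a' i' hi' (Or.inl rfl)]
      · simp only [St.tick_arr, St.setArr_arr]
        split_ifs <;> tauto
      · intro he
        exact hc ⟨Arr.ctorIdx_inj (cell_inj hi' hi he).1, (cell_inj hi' hi he).2⟩
  · simp only [St.tick_arr, St.setArr_arr]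
    split_ifs
    · exact hv
    · exact h.arrBdd a' i' hi'
    · exact h.arrBdd a' i' hi'
  · rw [hm, Function.update_of_ne, h.dyn rfl d i' hi']
    · rfl
    · intro he
      have := (cell_inj hi' hi he).1
      have := Arr.ctorIdx_lt a
      omega

theorem Rel.setDyn {s : St} {c c' : Config} (h : Rel X X.Y s c) (d i v t : ℕ) (hi : i < X.Y)
    (hv : v < X.Y) (hr : ∀ y : Var, c'.reg y.mreg = c.reg y.mreg)
    (h2 : c'.reg 2 = c.reg 2) (hm : c'.mem = Function.update c.mem ((16 + d) * X.Y + i) v) :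
    Rel X X.Y ((s.setDyn d i v).tick t) c' := by
  refine ⟨fun y => (hr y).trans (h.reg y), h.bdd, h2.trans h.size, fun a' i' hi' _ => ?_,
    h.arrBdd, fun _ d' i' hi' => ?_, fun d' i' hi' => ?_⟩
  · rw [hm, Function.update_of_ne, h.arr a' i' hi' (Or.inl rfl)]
    · rfl
    · intro he
      have := (cell_inj hi' hi he).1
      have := Arr.ctorIdx_lt a'
      omega
  · rw [hm]
    by_cases hc : d' = d ∧ i' = i
    · simp [hc.1, hc.2]
    · rw [Function.update_of_ne, h.dyn rfl d' i' hi']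
      · simp only [St.tick_dyn, St.setDyn_dyn]
        split_ifs <;> tauto
      · intro he
        have := cell_inj hi' hi he
        omega
  · simp only [St.tick_dyn, St.setDyn_dyn]
    split_ifs
    · exact hv
    · exact h.dynBdd d' i' hi'
    · exact h.dynBdd d' i' hi'

/-! ### Simulation of the oracle program -/

/-- The oracle of the semantics decides 3SUM over `[N ^ 3]`, for `N ≥ 2`. -/
def Ctx.OracleOK (X : Ctx) : Prop :=
  1 ≤ X.κ ∧ ∀ (N : ℕ) (xs : List ℕ), 2 ≤ N → xs.length = N → xs.Nodup →
    xs.toFinset ⊆ Finset.Icc 1 (N ^ 3) → ∃ (t : ℕ) (ans : Bool), t ≤ X.T N ∧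
      run (wordLength X.κ N (N ^ 3)) X.O xs t = .halted ans ∧
      (ans = true ↔ HasThreeSum xs.toFinset)

/-- The code of a command simulates every state that satisfies its weakest precondition. -/
def Com.Sound (X : Ctx) (w : ℕ) (P : Program) (ρ : ℕ) (c : Com) : Prop :=
  ∀ (p : ℕ) (cf : Config) (s : St) (Q : St → Prop), At P p (c.code X.O p) → cf.pc = p →
    c.wf = true → (ρ = X.Y ∨ (ρ = 0 ∧ c.inputOnly = true)) → Rel X ρ s cf → wp X c Q s →
    ∃ s' cf' t, Reach w P t cf cf' ∧ cf'.pc = p + (c.code X.O p).length ∧ Rel X ρ s' cf' ∧ Q s' ∧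
      s.time + t ≤ s'.time

/-- Every instruction is simulated by exactly two, which is why a jump to `k` can be translated into
a jump to `p + 2 * k`. -/
theorem List.At_flatMap {P : Program} {f : Instr → List Instr} (hf : ∀ i, (f i).length = 2)
    {O : List Instr} : ∀ {p : ℕ}, At P p (O.flatMap f) → ∀ {k : ℕ} {i : Instr}, O[k]? = some i →
      At P (p + 2 * k) (f i) := by
  induction O with
  | nil => intro p _ k i h; simp at h
  | cons a O ih =>
    intro p hat k i h
    rw [List.flatMap_cons, At.append, hf] at hat
    cases k with
    | zero =>
      obtain rfl : a = i := by simpa using h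
      exact hat.1
    | succ k =>
      have := ih hat.2 (k := k) (i := i) (by simpa using h)
      rwa [Nat.mul_add, show p + (2 * k + 2 * 1) = p + 2 + 2 * k by omega]

theorem Instr.length_sim (p l d : ℕ) (i : Instr) : (i.sim p l d).length = 2 := by
  cases i <;> rfl

theorem Program.regBound_of_mem {O : Program} {i : Instr} (hi : i ∈ O) :
    i.regBound < O.regBound := by
  have := List.single_le_sum (l := O.map Instr.regBound) (fun _ _ => Nat.zero_le _) _
    (List.mem_map_of_mem hi)
  unfold Program.regBound
  omega

/-- The configuration `c` simulates the configuration `c₀` of a machine with word length `w₀`, in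
the memory from address `β` on; everything else is as in `cf`. -/
structure Sim (β p K w₀ : ℕ) (cf c₀ c : Config) : Prop where
  pc : c.pc = p + 2 * c₀.pc
  reg : ∀ r < K, c.reg (oreg r) = c₀.reg r
  base : c.reg 5 = β
  mem : ∀ a < 2 ^ w₀, c.mem (β + a) = c₀.mem a
  regBdd : ∀ r, c₀.reg r < 2 ^ w₀
  memBdd : ∀ a, c₀.mem a < 2 ^ w₀
  regFrame : ∀ r, (∀ k, r ≠ oreg k) → r ≠ 5 → r ≠ 8 → c.reg r = cf.reg r
  memFrame : ∀ a, a < β ∨ β + 2 ^ w₀ ≤ a → c.mem a = cf.mem a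

theorem oreg_inj {a b : ℕ} : oreg a = oreg b ↔ a = b := by unfold oreg; omega

theorem oreg_ne (a : ℕ) : oreg a ≠ 5 ∧ oreg a ≠ 8 := by unfold oreg; omega

/-- Writing a register is simulated by writing a register. -/
theorem Sim.write {β p K w₀ : ℕ} {cf c₀ c c₀' c' : Config} (h : Sim β p K w₀ cf c₀ c)
    {r v : ℕ} (h₀ : c₀.write w₀ r v = .running c₀') (hpc : c'.pc = c.pc + 2)
    (hreg : ∀ q, q ≠ 8 → c'.reg q = Function.update c.reg (oreg r) v q)
    (hmem : c'.mem = c.mem) : Sim β p K w₀ cf c₀' c' := by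
  unfold Config.write at h₀
  split_ifs at h₀ with hv
  simp only [State.running.injEq] at h₀
  subst h₀
  refine ⟨by rw [hpc, h.pc]; simp only; omega, fun q hq => ?_, ?_, by rw [hmem]; exact h.mem,
    fun q => ?_, h.memBdd, fun q hq h5 h8 => ?_, by rw [hmem]; exact h.memFrame⟩
  · rw [hreg _ (oreg_ne q).2]
    by_cases hqr : q = r
    · simp [hqr]
    · simp [hqr, oreg_inj, h.reg q hq]
  · rw [hreg _ (by decide), Function.update_of_ne (oreg_ne r).1.symm, h.base]
  · by_cases hqr : q = r
    · simp [hqr, hv]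
    · simp [hqr, h.regBdd q]
  · rw [hreg _ h8, Function.update_of_ne (hq r), h.regFrame q hq h5 h8]

section sim

variable {O : Program} {β p l d w₀ : ℕ} {cf c₀ c : Config}
  (hat : At P p (O.flatMap (Instr.sim p l d))) (hw : β + 2 ^ w₀ ≤ 2 ^ w) (hw1 : 2 ≤ 2 ^ w)
include hat hw hw1

/-- Loads and stores spend one of their two instructions on adding the base address; arithmetic and
jumps are padded by a write to the scratch register 8. A value that fits into a word of the
simulated machine also fits into a word of the simulating one, so no step that succeeds there
crashes here. -/
theorem Sim.step {c₀' : Config} {i : Instr} (h : Sim β p O.regBound w₀ cf c₀ c)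
    (hi : O[c₀.pc]? = some i) (he : i.exec w₀ c₀ = .running c₀') :
    ∃ t c', t ≤ 2 ∧ Reach w P t c c' ∧ Sim β p O.regBound w₀ cf c₀' c' := by
  have hat' := List.At_flatMap (Instr.length_sim p l d) hat hi
  have hK := Program.regBound_of_mem (List.mem_of_getElem? hi)
  have hR : Reach w P 0 c c := Reach.refl
  have hv : ∀ {r v}, c₀.write w₀ r v = .running c₀' → v < 2 ^ w := by
    intro r v hv
    unfold Config.write at hv
    split_ifs at hv
    omega
  rw [← h.pc] at hat'
  cases i with
  | const r v =>
    simp only [Instr.sim, At.cons] at hat'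
    refine ⟨_, _, le_rfl, (hR.const hat'.1 rfl (hv he)).const hat'.2.1 rfl (by omega),
      h.write he rfl (fun q hq => ?_) rfl⟩
    simp [Function.update_of_ne hq]
  | op o r a b =>
    simp only [Instr.sim, At.cons] at hat'
    simp only [Instr.regBound] at hK
    refine ⟨_, _, le_rfl, (hR.op hat'.1 rfl (by rw [h.reg a (by omega), h.reg b (by omega)])
      (hv he)).const hat'.2.1 rfl (by omega), h.write he rfl (fun q hq => ?_) rfl⟩
    simp [Function.update_of_ne hq]
  | load r a =>
    simp only [Instr.sim, At.cons] at hat'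
    simp only [Instr.regBound] at hK
    have ha := h.regBdd a
    refine ⟨_, _, le_rfl, (hR.op (v := β + c₀.reg a) hat'.1 rfl (by
      rw [h.reg a (by omega), h.base, BinOp.eval, Nat.add_comm]) (by omega)).load
      (v := c₀.mem (c₀.reg a)) hat'.2.1 rfl (by simp [h.mem _ ha])
      (hv he), h.write he rfl (fun q hq => ?_) rfl⟩
    by_cases hq' : q = oreg r
    · simp [hq']
    · simp [Function.update_of_ne hq']
      rw [Function.update_of_ne hq]
  | store a x =>
    simp only [Instr.sim, At.cons] at hat'
    simp only [Instr.regBound] at hK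
    have ha := h.regBdd a
    simp only [Instr.exec, State.running.injEq] at he
    subst he
    refine ⟨_, _, le_rfl, (hR.op (v := β + c₀.reg a) hat'.1 rfl (by
      rw [h.reg a (by omega), h.base, BinOp.eval, Nat.add_comm]) (by omega)).store
      (l := β + c₀.reg a) (v := c₀.reg x) hat'.2.1 rfl (by simp) (by
      simp [Function.update_of_ne (oreg_ne x).2, h.reg x (by omega)]), ?_, ?_, ?_, ?_, h.regBdd, ?_,
      ?_, ?_⟩
    · simp only [h.pc]; omega
    · intro q hq
      simp [Function.update_of_ne (oreg_ne q).2, h.reg q hq]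
    · simp [h.base]
    · intro b hb
      by_cases hab : b = c₀.reg a
      · simp [hab]
      · simp [hab, h.mem b hb]
    · intro b
      by_cases hab : b = c₀.reg a
      · simp [hab, h.regBdd]
      · simp [hab, h.memBdd]
    · intro q hq h5 h8
      simp [h8, h.regFrame q hq h5 h8]
    · intro b hb
      simp only
      rw [Function.update_of_ne (by omega), h.memFrame b hb]
  | jump k =>
    simp only [Instr.sim, At.cons] at hat'
    simp only [Instr.exec, State.running.injEq] at he
    subst he
    exact ⟨_, _, one_le_two, hR.jump hat'.1 rfl, rfl, h.reg, h.base, h.mem, h.regBdd, h.memBdd,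
      h.regFrame, h.memFrame⟩
  | jumpLt a b k =>
    simp only [Instr.sim, At.cons] at hat'
    simp only [Instr.regBound] at hK
    simp only [Instr.exec, State.running.injEq] at he
    subst he
    by_cases hab : c₀.reg a < c₀.reg b
    · refine ⟨_, _, one_le_two, hR.jumpLt_of_lt hat'.1 rfl (by
        rw [h.reg a (by omega), h.reg b (by omega)]; exact hab), by simp [hab], h.reg, h.base,
        h.mem, h.regBdd, h.memBdd, h.regFrame, h.memFrame⟩
    · refine ⟨_, _, le_rfl, (hR.jumpLt_of_not_lt hat'.1 rfl (by
        rw [h.reg a (by omega), h.reg b (by omega)]; exact hab)).const hat'.2.1 rfl (by omega),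
        by simp [hab, h.pc]; omega, fun q hq => ?_, ?_,
        h.mem, h.regBdd, h.memBdd, fun q hq h5 h8 => ?_, h.memFrame⟩
      · simp [Function.update_of_ne (oreg_ne q).2, h.reg q hq]
      · simp [h.base]
      · simp [h8, h.regFrame q hq h5 h8]
  | halt ans => simp [Instr.exec] at he

/-- Registers of the simulated machine stay below `2 ^ w₀`, so all its memory accesses remain
between `β` and `β + 2 ^ w₀`. This gives the frame condition for the other regions. -/
theorem Sim.run {t : ℕ} {ans : Bool} :
    ∀ {c₀ c : Config}, Sim β p O.regBound w₀ cf c₀ c →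
      (WordRAM.step w₀ O)^[t] (.running c₀) = .halted ans →
      ∃ t' c', t' ≤ 2 * t ∧ Reach w P t' c c' ∧ c'.pc = l ∧ c'.reg d = (if ans then 1 else 0) ∧
        (∀ a < 2 ^ w₀, c'.mem (β + a) < 2 ^ w₀) ∧
        (∀ r, (∀ k, r ≠ oreg k) → r ≠ 5 → r ≠ 8 → r ≠ d → c'.reg r = cf.reg r) ∧
        (∀ a, a < β ∨ β + 2 ^ w₀ ≤ a → c'.mem a = cf.mem a) := by
  have stuck : ∀ t, (WordRAM.step w₀ O)^[t] .crashed = .crashed := fun t =>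
    Function.iterate_fixed rfl t
  induction t with
  | zero => intro c₀ c _ h; simp at h
  | succ t ih =>
    intro c₀ c hsim h
    rw [Function.iterate_succ_apply] at h
    rcases hi : O[c₀.pc]? with _ | i
    · rw [WordRAM.step, hi] at h
      simp [stuck] at h
    · rw [show WordRAM.step w₀ O (.running c₀) = i.exec w₀ c₀ by rw [WordRAM.step, hi]] at h
      rcases he : i.exec w₀ c₀ with c₀' | b | _
      · rw [he] at h
        obtain ⟨t1, c1, ht1, r1, hsim1⟩ := Sim.step hat hw hw1 hsim hi he
        obtain ⟨t2, c2, ht2, r2, hrest⟩ := ih hsim1 h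
        exact ⟨_, c2, by omega, r1.trans r2, hrest⟩
      · rw [he, Function.iterate_fixed rfl] at h
        obtain rfl : b = ans := by simpa using h
        -- No other instruction leads to a halted state.
        obtain rfl : i = .halt b := by
          cases i <;> simp [Instr.exec, Config.write] at he <;> try (split_ifs at he)
          rw [he]
        have hat' := List.At_flatMap (Instr.length_sim p l d) hat hi
        rw [← hsim.pc] at hat'
        simp only [Instr.sim, At.cons] at hat'
        refine ⟨_, _, by omega, ((Reach.refl (w := w) (P := P) (c := c)).const hat'.1 rfl (by
          split_ifs <;> omega)).jump hat'.2.1 rfl, rfl, by simp, fun a ha => ?_,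
          fun r hk h5 h8 hrd => ?_, hsim.memFrame⟩
        · simp only [hsim.mem a ha]
          exact hsim.memBdd a
        · simp [hrd, hsim.regFrame r hk h5 h8]
      · rw [he, stuck] at h
        simp at h

end sim

theorem Reach.clear {w : ℕ} {P : Program} {t : ℕ} {c₀ c : Config} (hr : Reach w P t c₀ c) {p K : ℕ}
    (hp : c.pc = p) (hat : At P p ((List.range K).map fun r => Instr.const (oreg r) 0)) :
    ∃ c', Reach w P (t + K) c₀ c' ∧ c'.pc = p + K ∧ c'.mem = c.mem ∧
      (∀ r < K, c'.reg (oreg r) = 0) ∧ ∀ r, (∀ k, r ≠ oreg k) → c'.reg r = c.reg r := by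
  induction K with
  | zero => exact ⟨c, hr, hp, rfl, fun r hr => by omega, fun r _ => rfl⟩
  | succ K ih =>
    rw [List.range_succ, List.map_append, At.append] at hat
    obtain ⟨c1, r1, p1, m1, z1, f1⟩ := ih hat.1
    have h2 := hat.2
    simp only [List.map_cons, List.map_nil, At.cons, List.length_map, List.length_range] at h2
    refine ⟨_, r1.const h2.1 p1 (Nat.two_pow_pos w), rfl, m1, fun r hr => ?_, fun r hk => ?_⟩
    · by_cases h : r = K
      · simp [h]
      · simp [h, oreg_inj, z1 r (by omega)]
    · simp [hk K, f1 r hk]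

/-- The simulated program expects a memory that is zero outside its input, and leaves arbitrary
words behind. Hence the rule for the oracle demands a region that vanishes beyond the instance, and
forgets its content afterwards (the function `f`). As `2 ^ w₀ ≤ Y`, the whole address space of the
simulated machine fits into one region, and only its registers have to be cleared. -/
theorem Com.oracle_sound (hY : 2 ≤ X.Y) (hw : (16 + X.Y) * X.Y + X.Y < 2 ^ w) (hO : X.OracleOK)
    (x d n : Var) : (Com.oracle x d n).Sound X w P ρ := by
  intro p cf s Q hat hp hwf hin hr hwp
  obtain rfl : ρ = X.Y := by simpa [Com.inputOnly] using hin
  obtain ⟨h2n, hwY, hinj, hrange, hzero, hpost⟩ := hwp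
  have hYw : X.Y < 2 ^ w := by nlinarith
  set N := s.reg n with hN
  set D := s.reg d with hD
  set w₀ := wordLength X.κ N (N ^ 3) with hw₀
  set xs := (List.range N).map (s.dyn D) with hxs
  have hDY := hr.bdd d
  have hmul : (16 + D) * X.Y ≤ (16 + X.Y) * X.Y := Nat.mul_le_mul_right _ (by omega)
  have hxl : xs.length = N := by simp [hxs]
  have hmem : ∀ v, v ∈ xs ↔ ∃ i < N, s.dyn D i = v := by simp [hxs]
  have hget : ∀ i, xs.getD i 0 = s.dyn D i := by
    intro i
    rcases lt_or_ge i N with h | h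
    · simp [hxs, List.getD, h]
    · rw [List.getD_eq_default _ _ (by omega), hzero i h]
  obtain ⟨t, ans, ht, hrun, hans⟩ := hO.2 N xs h2n hxl (by
      rw [hxs, List.nodup_map_iff_inj_on List.nodup_range]
      intro a ha b hb h
      exact hinj a (by simpa using ha) b (by simpa using hb) h) (by
      intro v hv
      rw [List.mem_toFinset, hmem] at hv
      obtain ⟨i, hi, rfl⟩ := hv
      exact Finset.mem_Icc.2 (hrange i hi))
  have hNw : N + N ^ 3 + 2 ≤ 2 ^ w₀ := by
    refine (Nat.le_pow_clog one_lt_two _).trans (Nat.pow_le_pow_right two_pos ?_)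
    exact Nat.le_mul_of_pos_left _ hO.1
  have hsimp : (oracleCode X.O x d n p).length = X.O.regBound + 4 + 2 * X.O.length := by
    have : (X.O.flatMap (Instr.sim (p + (X.O.regBound + 4))
        (p + (X.O.regBound + 4) + 2 * X.O.length) x.mreg)).length = 2 * X.O.length := by
      rw [List.length_flatMap]
      simp [Instr.length_sim, Nat.mul_comm]
    simp only [oracleCode, List.length_append, this]
    simp
    omega
  rw [Com.code, oracleCode] at hat
  simp only [At.append, At.cons, List.length_cons, List.length_nil, List.length_map,
    List.length_range] at hat
  obtain ⟨⟨h1, h2, h3, -⟩, h4, ⟨h5, -⟩, h6⟩ := hat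
  have hne : ∀ (y : Var) (k : ℕ), y.mreg ≠ oreg k := fun y k => by unfold Var.mreg oreg; omega
  have hne5 : ∀ (y : Var), y.mreg ≠ 5 := fun y => by unfold Var.mreg; omega
  have hne8 : ∀ (y : Var), y.mreg ≠ 8 := fun y => by unfold Var.mreg; omega
  have hne2 : ∀ k, 2 ≠ oreg k := fun k => by unfold oreg; omega
  have htmp : ∀ k, tmp 0 ≠ oreg k := fun k => by unfold tmp oreg; omega
  have r1 := (Reach.refl (w := w) (P := P) (c := cf)).const h1 hp (by nlinarith)
  have r2 := r1.op (v := 16 + D) h2 rfl (by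
    simp [BinOp.eval, Function.update_of_ne (d.mreg_ne_tmp 0), hr.reg, hD]) (by nlinarith)
  have r3 := r2.op (v := (16 + D) * X.Y) h3 rfl (by
    simp [BinOp.eval, Function.update_of_ne (two_ne_tmp 0), hr.size]) (by omega)
  obtain ⟨c4, r4, p4, m4, z4, f4⟩ := r3.clear (p := p + 3) rfl h4
  have e4n : c4.reg n.mreg = N := by
    rw [f4 _ (hne n)]
    simp [hne5, Function.update_of_ne (n.mreg_ne_tmp 0), hr.reg, hN]
  have hNY : N < X.Y := hr.bdd n
  have r5 := r4.op (v := N) h5 (by rw [p4])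
    (by rw [e4n, BinOp.eval, Nat.or_self]) (by omega)
  -- The first configuration is only a reference for the frame conditions. These exclude register 5,
  -- so its value 0 there is arbitrary.
  have hsim : Sim ((16 + D) * X.Y) (p + (X.O.regBound + 4)) X.O.regBound w₀
      ⟨0, Function.update (Function.update cf.reg (tmp 0) (16 + D)) 5 0, cf.mem⟩
      ⟨0, Function.update (fun _ => 0) 0 xs.length, fun i => xs.getD i 0⟩
      ⟨p + (X.O.regBound + 4), Function.update c4.reg (oreg 0) N, c4.mem⟩ := by
    refine ⟨by simp, fun r hrK => ?_, ?_, fun a ha => ?_, fun r => ?_, fun a => ?_,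
      fun r hk h5 h8 => ?_, fun a _ => by rw [m4]⟩
    · by_cases h0 : r = 0
      · simp [h0, hxl]
      · simp [h0, oreg_inj, z4 r hrK]
    · simp only
      rw [Function.update_of_ne (oreg_ne 0).1.symm, f4 _ fun k => (oreg_ne k).1.symm]
      simp
    · rw [m4]
      simp only
      rw [hget, hr.dyn rfl D a (by omega)]
    · by_cases h0 : r = 0
      · simp only [h0, Function.update_self, hxl]; omega
      · simp [h0]
    · simp only [hget]
      rcases lt_or_ge a N with h | h
      · have := (hrange a h).2
        omega
      · rw [hzero a h]
        exact Nat.two_pow_pos _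
    · simp only
      rw [Function.update_of_ne (hk 0), f4 _ hk]
      simp only
      rw [Function.update_of_ne h5, Function.update_of_ne h5]
      by_cases hr0 : r = tmp 0
      · simp [hr0]
      · simp [hr0]
  obtain ⟨t7, c7, ht7, r7, p7, v7, b7, f7, fm7⟩ := Sim.run (w := w) (ans := ans) (t := t) (by
      rw [show p + (X.O.regBound + 4) = p + (0 + 1 + 1 + 1) + X.O.regBound + (0 + 1) by omega] at h6 ⊢
      exact h6) (by omega) (by omega)
      hsim hrun
  have hsumiff : HasThreeSum xs.toFinset ↔ ∃ i < N, ∃ j < N, ∃ k < N,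
      s.dyn D i + s.dyn D j = s.dyn D k := by
    simp only [HasThreeSum, List.mem_toFinset, hmem]
    constructor
    · rintro ⟨_, ⟨i, hi, rfl⟩, _, ⟨j, hj, rfl⟩, _, ⟨k, hk, rfl⟩, h⟩
      exact ⟨i, hi, j, hj, k, hk, h⟩
    · rintro ⟨i, hi, j, hj, k, hk, h⟩
      exact ⟨_, ⟨i, hi, rfl⟩, _, ⟨j, hj, rfl⟩, _, ⟨k, hk, rfl⟩, h⟩
  have hT : X.O.regBound + 4 + t7 ≤ oracleCost X.O (X.T N) := by
    unfold oracleCost; omega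
  refine ⟨_, c7, _, r5.trans (by
      convert r7 using 2; omega), ?_, ?_, hpost (fun i => c7.mem ((16 + D) * X.Y + i))
      (if ans then 1 else 0) (by split_ifs <;> omega) (by rw [← hsumiff, ← hans]; simp) _ hT, ?_⟩
  · rw [p7, Com.code, hsimp]; omega
  · refine ⟨fun y => ?_, fun y => ?_, ?_, fun a i hi _ => ?_, hr.arrBdd, fun _ d' i hi => ?_,
      fun d' i hi => ?_⟩
    · by_cases hy : y = x
      · simp [hy, v7]
      · rw [f7 _ (hne y) (hne5 y) (hne8 y) (fun h => hy (Var.mreg_inj.1 h))]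
        simp [hne5, Function.update_of_ne (y.mreg_ne_tmp 0), hy, hr.reg]
    · by_cases hy : y = x
      · simp only [St.tick_reg, St.set_reg, hy, if_true]
        split_ifs <;> omega
      · simp [hy, hr.bdd y]
    · rw [f7 2 hne2 (by decide) (by decide) (x.mreg_ne_two.symm)]
      simp [two_ne_tmp 0, hr.size]
    · rw [fm7 _ ?_]
      · exact hr.arr a i hi (Or.inl rfl)
      · left
        have := Nat.mul_le_mul_right X.Y (show a.ctorIdx + 1 ≤ 16 + D from by
          have := Arr.ctorIdx_lt a; omega)
        rw [Nat.add_mul] at this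
        omega
    · by_cases hdd : d' = D
      · simp [hdd]
      · simp only [St.tick_dyn, St.set_dyn, St.setRegion_dyn, hdd, if_false]
        rw [fm7 _ ?_]
        · exact hr.dyn rfl d' i hi
        · rcases lt_or_gt_of_ne hdd with h | h
          · left
            have := Nat.mul_le_mul_right X.Y (show 16 + d' + 1 ≤ 16 + D by omega)
            rw [Nat.add_mul] at this
            omega
          · right
            have := Nat.mul_le_mul_right X.Y (show 16 + D + 1 ≤ 16 + d' by omega)
            rw [Nat.add_mul (16 + D)] at this
            omega
    · by_cases hdd : d' = D
      · simp only [St.tick_dyn, St.set_dyn, St.setRegion_dyn, hdd, if_true]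
        rcases lt_or_ge i (2 ^ w₀) with h | h
        · exact (b7 i h).trans_le hwY
        · rw [fm7 _ (Or.inr (by omega))]
          simp only
          rw [hr.dyn rfl D i hi]
          exact hr.dynBdd D i hi
      · simp [hdd, hr.dynBdd d' i hi]
  · simp only [St.tick_time, St.set_time, St.setRegion_time]
    have := r7
    omega

theorem Com.loop_sound (hY : 2 ≤ X.Y) (hw : X.Y ^ 40 ≤ 2 ^ w) (i n : Var) (c : Com)
    (ih : c.Sound X w P ρ) : (Com.loop i n c).Sound X w P ρ := by
  intro p cf s Q hat hp hwf hin hr hwp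
  obtain ⟨I, h0, h1, h2, h3⟩ := hwp
  have hYw : X.Y < 2 ^ w := lt_of_lt_of_le (by
    calc X.Y = X.Y ^ 1 := (pow_one _).symm
      _ < X.Y ^ 40 := Nat.pow_lt_pow_right (by omega) (by omega)) hw
  simp only [Com.code, At.append, At.cons] at hat
  obtain ⟨⟨a1, a2, a3, -⟩, a4, a5, a6, a7, -⟩ := hat
  simp only [List.length_cons, List.length_nil] at a4 a5 a6 a7
  generalize hl : (c.code X.O (p + 3)).length = l at *
  have hlen : ((Com.loop i n c).code X.O p).length = l + 6 := by
    simp [Com.code, hl]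
  rw [hlen]
  -- Induction on the number `m` of remaining iterations, each starting at the test in the head of
  -- the loop.
  have main : ∀ (m k : ℕ) (s' : St) (cf' : Config), k + m = s.reg n → I k s' → cf'.pc = p + 1 →
      Rel X ρ s' cf' → ∃ s'' cf'' t, Reach w P t cf' cf'' ∧ cf''.pc = p + (l + 6) ∧
        Rel X ρ s'' cf'' ∧ Q s'' ∧ s'.time + t ≤ s''.time := by
    intro m
    induction m with
    | zero =>
      intro k s' cf' hk hI hpc hrel
      have hk' : k = s.reg n := by omega
      have hreg := h1 k s' hI
      subst hk'
      have r1 := (Reach.refl (w := w) (P := P) (c := cf')).jumpLt_of_not_lt a2 hpc (by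
        rw [hrel.reg, hrel.reg, hreg.1, hreg.2]; omega)
      have r2 := r1.jump a3 rfl
      refine ⟨_, _, _, r2, ?_, hrel.tick 2 (fun _ => rfl) rfl rfl, h3 s' hI, ?_⟩
      · simp only; omega
      · simp
    | succ m ihm =>
      intro k s' cf' hk hI hpc hrel
      have hreg := h1 k s' hI
      have r1 := (Reach.refl (w := w) (P := P) (c := cf')).jumpLt_of_lt a2 hpc (by
        rw [hrel.reg, hrel.reg, hreg.1, hreg.2]; omega)
      obtain ⟨s2, c2, t2, r2, p2, hrel2, ⟨hi2, hI2⟩, ht2⟩ := ih (p + 3) _ s' _ a4 rfl hwf (by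
        simpa [Com.inputOnly] using hin) (hrel.congr (c' := ⟨p + 3, cf'.reg, cf'.mem⟩)
          (fun _ => rfl) rfl rfl) (h2 k (by omega) s' hI)
      rw [hl] at p2
      have hkn : k + 1 ≤ s.reg n := by omega
      have hkY : k + 1 < X.Y := by
        have := hrel.bdd n
        rw [hreg.2] at this
        omega
      have r3 := (r1.trans r2).const a5 (by rw [p2]) (by omega)
      have r4 := r3.op (v := k + 1) a6 rfl (by
        simp [BinOp.eval, Function.update_of_ne (i.mreg_ne_tmp 0), hrel2.reg, hi2]) (by omega)
      have r5 := r4.jump a7 rfl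
      have hrel5 : Rel X ρ ((s2.set i (k + 1)).tick 4) ⟨p + 1,
          Function.update (Function.update c2.reg (tmp 0) 1) i.mreg (k + 1), c2.mem⟩ :=
        hrel2.setReg i (k + 1) 4 hkY (by simp) (fun y hy => by
          simp [Function.update_of_ne (y.mreg_ne_tmp 0),
            Function.update_of_ne (fun h => hy (Var.mreg_inj.1 h))])
          (by simp [Function.update_of_ne (two_ne_tmp 0), Function.update_of_ne i.mreg_ne_two.symm])
          rfl
      obtain ⟨s6, c6, t6, r6, p6, hrel6, hQ, ht6⟩ := ihm (k + 1) _ _ (by omega) hI2 rfl hrel5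
      refine ⟨s6, c6, _, r5.trans r6, p6, hrel6, hQ, ?_⟩
      simp only [St.tick_time, St.set_time] at ht6
      omega
  have r1 := (Reach.refl (w := w) (P := P) (c := cf)).const a1 hp (by omega)
  have hrel1 : Rel X ρ ((s.set i 0).tick 1) ⟨p + 1, Function.update cf.reg i.mreg 0, cf.mem⟩ :=
    hr.setReg i 0 1 (by omega) (by simp) (fun y hy => by
      simp [Function.update_of_ne (fun h => hy (Var.mreg_inj.1 h))])
      (by simp [Function.update_of_ne i.mreg_ne_two.symm]) rfl
  obtain ⟨s2, c2, t2, r2, p2, hrel2, hQ, ht2⟩ := main (s.reg n) 0 _ _ (by omega) h0 rfl hrel1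
  refine ⟨s2, c2, _, r1.trans r2, p2, hrel2, hQ, ?_⟩
  simp only [St.tick_time, St.set_time] at ht2
  omega

/-- The word length leaves room for intermediate values up to `Y ^ 40` and for all addresses, which
are below `(16 + Y) * Y + Y`: the first 16 regions are set aside for static arrays, and a dynamic
array number is below `Y`. The clock of the structured language bounds the number of machine steps
from above. -/
theorem Com.sound (hY : 2 ≤ X.Y) (hw : X.Y ^ 40 ≤ 2 ^ w) (hO : X.OracleOK) (c : Com) :
    c.Sound X w P ρ := by
  have key : ∀ {a b : ℕ}, a ≤ b → X.Y ^ a ≤ X.Y ^ b := fun h => Nat.pow_le_pow_right (by omega) h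
  have hbig : (16 + X.Y) * X.Y + X.Y < 2 ^ w := lt_of_lt_of_le (by
    calc (16 + X.Y) * X.Y + X.Y < (2 ^ 4 + X.Y + 2) * X.Y := by nlinarith
      _ ≤ (X.Y ^ 4 + X.Y ^ 4 + X.Y ^ 4) * X.Y := by
        have h1 := Nat.pow_le_pow_left hY 4
        have h2 := key (a := 1) (b := 4) (by omega)
        rw [pow_one] at h2
        gcongr; omega
      _ ≤ (X.Y * X.Y * X.Y ^ 4) * X.Y := by
        apply Nat.mul_le_mul_right
        have : 4 ≤ X.Y * X.Y := by nlinarith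
        have := Nat.mul_le_mul_right (X.Y ^ 4) this
        omega
      _ = X.Y ^ 7 := by ring
      _ ≤ X.Y ^ 40 := key (by omega)) hw
  have hYw : X.Y < 2 ^ w := by nlinarith
  induction c with
  | skip =>
    intro p cf s Q hat hp hwf hin hr hwp
    exact ⟨s, cf, 0, Reach.refl, by simpa [Com.code] using hp, hr, hwp, le_rfl⟩
  | setc x v =>
    intro p cf s Q hat hp hwf hin hr hwp
    simp only [Com.code, At.cons] at hat
    refine ⟨_, _, _, Reach.refl.const hat.1 hp (hwp.1.trans hYw), rfl, hr.setReg x v 1 hwp.1 (by simp)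
      (fun y hy => by simp [Function.update_of_ne (fun h => hy (Var.mreg_inj.1 h))])
      (by simp [Function.update_of_ne x.mreg_ne_two.symm]) rfl, hwp.2, by simp⟩
  | assign x e =>
    intro p cf s Q hat hp hwf hin hr hwp
    simp only [Com.code, At.append, At.cons, Exp.length_code] at hat
    obtain ⟨c1, r1, p1, m1, v1, f1⟩ := Exp.sound hY hw s e 0 cf (hp ▸ hat.1) hwf hin hr
    have r2 := r1.op (v := e.eval s) hat.2.1 (by omega)
      (by rw [v1, BinOp.eval, Nat.or_self]) (hwp.1.trans hYw)
    refine ⟨_, _, _, r2, by simp [Com.code, Exp.length_code]; omega,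
      hr.setReg x _ _ hwp.1 (by simp) (fun y hy => ?_) ?_ m1, hwp.2, by
        simp⟩
    · simp [Function.update_of_ne (fun h => hy (Var.mreg_inj.1 h)), f1 _ fun k _ => y.mreg_ne_tmp k]
    · simp [Function.update_of_ne x.mreg_ne_two.symm, f1 _ fun k _ => two_ne_tmp k]
  | store a x e =>
    intro p cf s Q hat hp hwf hin hr hwp
    obtain rfl : ρ = X.Y := by simpa [Com.inputOnly] using hin
    simp only [Com.code, At.append, At.cons, Exp.length_code] at hat
    obtain ⟨h0, h1, h2, h3, h4, -⟩ := hat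
    obtain ⟨c1, r1, p1, m1, v1, f1⟩ := Exp.sound hY hw s e 0 cf (hp ▸ h0) hwf (Or.inl rfl) hr
    have hx := hr.bdd x
    have ha := Arr.ctorIdx_lt a
    have hmul : a.ctorIdx * X.Y ≤ 16 * X.Y := Nat.mul_le_mul_right _ ha.le
    have hmul' : 16 * X.Y + X.Y < 2 ^ w := by nlinarith
    have r2 := r1.const h1 (by omega) (by omega)
    have r3 := r2.op (v := a.ctorIdx * X.Y) h2 rfl (by
      simp [BinOp.eval, Function.update_of_ne (two_ne_tmp 1), f1 _ fun k _ => two_ne_tmp k,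
        hr.size]) (by omega)
    have r4 := r3.op (v := a.ctorIdx * X.Y + s.reg x) h3 rfl (by
      simp [BinOp.eval, Function.update_of_ne (x.mreg_ne_tmp 1), f1 _ fun k _ => x.mreg_ne_tmp k,
        hr.reg]) (by omega)
    have r5 := r4.store (l := a.ctorIdx * X.Y + s.reg x) (v := e.eval s) h4 rfl (by simp) (by
      simp [Function.update_of_ne (show tmp 0 ≠ tmp 1 by decide), v1])
    refine ⟨_, _, _, r5, by simp [Com.code, Exp.length_code]; omega,
      hr.setArr a _ _ _ hx hwp.1 (fun y => ?_) ?_ ?_, hwp.2, by simp⟩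
    · simp [Function.update_of_ne (y.mreg_ne_tmp 1), f1 _ fun k _ => y.mreg_ne_tmp k]
    · simp [Function.update_of_ne (two_ne_tmp 1), f1 _ fun k _ => two_ne_tmp k]
    · simp [m1]
  | storeDyn d x e =>
    intro p cf s Q hat hp hwf hin hr hwp
    obtain rfl : ρ = X.Y := by simpa [Com.inputOnly] using hin
    simp only [Com.code, At.append, At.cons, Exp.length_code] at hat
    obtain ⟨h0, h1, h2, h3, h4, h5, -⟩ := hat
    obtain ⟨c1, r1, p1, m1, v1, f1⟩ := Exp.sound hY hw s e 0 cf (hp ▸ h0) hwf (Or.inl rfl) hr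
    have hx := hr.bdd x
    have hd := hr.bdd d
    have hmul : (16 + s.reg d) * X.Y ≤ (16 + X.Y) * X.Y := Nat.mul_le_mul_right _ (by omega)
    have r2 := r1.const h1 (by omega) (by nlinarith)
    have r3 := r2.op (v := 16 + s.reg d) h2 rfl (by
      simp [BinOp.eval, Function.update_of_ne (d.mreg_ne_tmp 1), f1 _ fun k _ => d.mreg_ne_tmp k,
        hr.reg]) (by nlinarith)
    have r4 := r3.op (v := (16 + s.reg d) * X.Y) h3 rfl (by
      simp [BinOp.eval, Function.update_of_ne (two_ne_tmp 1), f1 _ fun k _ => two_ne_tmp k,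
        hr.size]) (by omega)
    have r5 := r4.op (v := (16 + s.reg d) * X.Y + s.reg x) h4 rfl (by
      simp [BinOp.eval, Function.update_of_ne (x.mreg_ne_tmp 1), f1 _ fun k _ => x.mreg_ne_tmp k,
        hr.reg]) (by omega)
    have r6 := r5.store (l := (16 + s.reg d) * X.Y + s.reg x) (v := e.eval s) h5 rfl (by simp) (by
      simp [Function.update_of_ne (show tmp 0 ≠ tmp 1 by decide), v1])
    refine ⟨_, _, _, r6, by simp [Com.code, Exp.length_code]; omega,
      hr.setDyn _ _ _ _ hx hwp.1 (fun y => ?_) ?_ ?_, hwp.2, by simp⟩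
    · simp [Function.update_of_ne (y.mreg_ne_tmp 1), f1 _ fun k _ => y.mreg_ne_tmp k]
    · simp [Function.update_of_ne (two_ne_tmp 1), f1 _ fun k _ => two_ne_tmp k]
    · simp [m1]
  | seq a b iha ihb =>
    intro p cf s Q hat hp hwf hin hr hwp
    simp only [Com.code, At.append] at hat
    simp only [Com.wf, Bool.and_eq_true] at hwf
    simp only [Com.inputOnly, Bool.and_eq_true] at hin
    obtain ⟨s1, c1, t1, r1, p1, hr1, hQ1, ht1⟩ :=
      iha p cf s _ hat.1 hp hwf.1 (by tauto) hr hwp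
    obtain ⟨s2, c2, t2, r2, p2, hr2, hQ2, ht2⟩ :=
      ihb _ c1 s1 _ hat.2 p1 hwf.2 (by tauto) hr1 hQ1
    exact ⟨s2, c2, _, r1.trans r2, by rw [p2]; simp [Com.code]; omega, hr2, hQ2, by omega⟩
  | ite e₁ e₂ a b iha ihb =>
    intro p cf s Q hat hp hwf hin hr hwp
    simp only [Com.wf, Bool.and_eq_true] at hwf
    simp only [Com.inputOnly, Bool.and_eq_true] at hin
    simp only [Com.code, At.append, At.cons, Exp.length_code, List.length_cons, List.length_nil,
      zero_add] at hat
    obtain ⟨h1, h2, ⟨h3, -⟩, h4, ⟨h5, -⟩, h6⟩ := hat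
    simp only [← Nat.add_assoc] at h2 h3 h4 h5 h6
    have hlen : ((Com.ite e₁ e₂ a b).code X.O p).length = e₁.cost + e₂.cost + 1 +
        (b.code X.O (p + e₁.cost + e₂.cost + 1)).length + 1 + (a.code X.O (p + e₁.cost + e₂.cost + 1 +
        (b.code X.O (p + e₁.cost + e₂.cost + 1)).length + 1)).length := by
      simp [Com.code, Exp.length_code, ← Nat.add_assoc]; omega
    rw [hlen]
    obtain ⟨c1, r1, p1, m1, v1, f1⟩ := Exp.sound hY hw s e₁ 0 cf (hp ▸ h1) hwf.1.1.1 (by tauto) hr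
    have hr1 : Rel X ρ s c1 := hr.congr (fun x => f1 _ fun k _ => x.mreg_ne_tmp k)
      (f1 _ fun k _ => two_ne_tmp k) m1
    obtain ⟨c2, r2, p2, m2, v2, f2⟩ := Exp.sound hY hw s e₂ 1 c1 (by rw [p1, hp]; exact h2)
      hwf.1.1.2 (by tauto) hr1
    have hr2 : Rel X ρ s c2 := hr1.congr (fun x => f2 _ fun k _ => x.mreg_ne_tmp k)
      (f2 _ fun k _ => two_ne_tmp k) m2
    have hv1 : c2.reg (tmp 0) = e₁.eval s := by
      rw [f2 _ fun k hk => by unfold tmp; omega, v1]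
    by_cases hlt : e₁.eval s < e₂.eval s
    · have r3 := (r1.trans r2).jumpLt_of_lt h3 (by omega) (by rw [hv1, v2]; exact hlt)
      obtain ⟨s4, c4, t4, r4, p4, hr4, hQ4, ht4⟩ := iha _ ⟨_, _, _⟩ _ _ h6 rfl hwf.1.2 (by tauto)
        (hr2.tick (c' := ⟨p + e₁.cost + e₂.cost + 1 +
          (b.code X.O (p + e₁.cost + e₂.cost + 1)).length + 1, c2.reg, c2.mem⟩) (e₁.cost + e₂.cost + 2) (fun _ => rfl) rfl rfl)
        (hwp.1 hlt)
      refine ⟨s4, c4, _, r3.trans r4, by rw [p4]; omega, hr4, hQ4, ?_⟩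
      simp only [St.tick_time] at ht4
      omega
    · have r3 := (r1.trans r2).jumpLt_of_not_lt h3 (by omega) (by rw [hv1, v2]; exact hlt)
      obtain ⟨s4, c4, t4, r4, p4, hr4, hQ4, ht4⟩ := ihb _ ⟨_, _, _⟩ _ _ h4 rfl hwf.2 (by tauto)
        (hr2.tick (c' := ⟨p + e₁.cost + e₂.cost + 1, c2.reg, c2.mem⟩) (e₁.cost + e₂.cost + 2) (fun _ => rfl) rfl rfl)
        (hwp.2 hlt)
      have r5 := (r3.trans r4).jump h5 (by rw [p4])
      refine ⟨s4, _, _, r5, by simp only; omega, hr4.congr (fun _ => rfl) rfl rfl, hQ4, ?_⟩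
      simp only [St.tick_time] at ht4
      omega
  | loop i n c ih => exact Com.loop_sound hY hw i n c ih
  | oracle x d n => exact Com.oracle_sound hY hbig hO x d n

end WordRAM

/-! ### The trilinear form of Karatsuba's algorithm -/

/-- The coefficients of the product of two polynomials `X`, `B` of degree less than `l`, paired
with `C`. -/
def triForm {K : Type*} [CommRing K] (l : ℕ) (X B C : ℕ → K) : K :=
  ∑ i ∈ Finset.range l, ∑ j ∈ Finset.range l, X i * B j * C (i + j)

/-- With halves `X₀, X₁`, `B₀, B₁` and shifts `C₀, C₁, C₂` of `C` by `0, h, 2h`, the form is `X₀B₀C₀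
+ (X₀B₁ + X₁B₀)C₁ + X₁B₁C₂`. Karatsuba's formula for the middle product turns it into `X₀B₀(C₀ - C₁)
+ (X₀ + X₁)(B₀ + B₁)C₁ + X₁B₁(C₂ - C₁)`, with three products instead of four. -/
theorem triForm_two_mul {K : Type*} [CommRing K] (h : ℕ) (X B C : ℕ → K) :
    triForm (h + h) X B C = triForm h X B (fun t => C t - C (t + h)) +
      triForm h (fun t => X t + X (t + h)) (fun t => B t + B (t + h)) (fun t => C (t + h)) +
      triForm h (fun t => X (t + h)) (fun t => B (t + h)) (fun t => C (t + h + h) - C (t + h)) := by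
  unfold triForm
  simp only [Finset.sum_range_add]
  simp only [← Finset.sum_add_distrib]
  refine Finset.sum_congr rfl fun i _ => Finset.sum_congr rfl fun j _ => ?_
  rw [show i + (h + j) = i + j + h by omega, show h + i + j = i + j + h by omega,
    show h + i + (h + j) = i + j + h + h by omega, Nat.add_comm h i, Nat.add_comm h j]
  ring

theorem triForm_congr {K : Type*} [CommRing K] {l : ℕ} {X B C X' B' C' : ℕ → K}
    (hX : ∀ i < l, X i = X' i) (hB : ∀ i < l, B i = B' i) (hC : ∀ i < 2 * l, C i = C' i) :
    triForm l X B C = triForm l X' B' C' := by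
  refine Finset.sum_congr rfl fun i hi => Finset.sum_congr rfl fun j hj => ?_
  rw [Finset.mem_range] at hi hj
  rw [hX i hi, hB j hj, hC (i + j) (by omega)]

/-! ### Prime divisors -/

/-- In absolute value `v = m * u`, and `m * p ∣ v` means `p ∣ u`, even if `p` already divides `m`.
The distinct primes that divide `u` have a product at most `u < 2 ^ (l + 1)`, so there are at most
`l` of them. -/
theorem card_prime_dvd_le {S : Finset ℕ} (hS : ∀ p ∈ S, p.Prime) {m l : ℕ} {v : ℤ} (hv : v ≠ 0)
    (hm : (m : ℤ) ∣ v) (hl : v.natAbs < 2 ^ (l + 1)) :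
    (S.filter fun p => ((m * p : ℕ) : ℤ) ∣ v).card ≤ l := by
  obtain ⟨u, hu⟩ := Int.natCast_dvd.1 hm
  have hv' : v.natAbs ≠ 0 := Int.natAbs_ne_zero.2 hv
  have hm0 : m ≠ 0 := by rintro rfl; simp at hu; exact hv hu
  have hu0 : u ≠ 0 := by rintro rfl; simp at hu; exact hv hu
  have hsub : S.filter (fun p => ((m * p : ℕ) : ℤ) ∣ v) ⊆ u.primeFactors := by
    intro p hp
    rw [Finset.mem_filter, Int.natCast_dvd, hu] at hp
    exact Nat.mem_primeFactors.2 ⟨hS p hp.1,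
      Nat.dvd_of_mul_dvd_mul_left (Nat.pos_of_ne_zero hm0) hp.2, hu0⟩
  refine (Finset.card_le_card hsub).trans ?_
  have h1 : 2 ^ u.primeFactors.card ≤ u := by
    calc 2 ^ u.primeFactors.card ≤ ∏ p ∈ u.primeFactors, p :=
          Finset.pow_card_le_prod _ _ _ fun p hp => (Nat.prime_of_mem_primeFactors hp).two_le
      _ ≤ u := Nat.le_of_dvd (Nat.pos_of_ne_zero hu0) (Nat.prod_primeFactors_dvd u)
  have h2 : u ≤ v.natAbs := by
    rw [hu]; exact Nat.le_mul_of_pos_left _ (Nat.pos_of_ne_zero hm0)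
  have := (Nat.pow_lt_pow_iff_right (a := 2) one_lt_two).1 ((h1.trans h2).trans_lt hl)
  omega

/-- On average over the primes `p` of a set, few of the nonzero integers `v t` that are divisible
by `m` are divisible by `m * p`. -/
theorem sum_card_dvd_le {ι : Type*} (T : Finset ι) (v : ι → ℤ) {S : Finset ℕ}
    (hS : ∀ p ∈ S, p.Prime) {l : ℕ} (hv : ∀ t ∈ T, v t ≠ 0)
    (hl : ∀ t ∈ T, (v t).natAbs < 2 ^ (l + 1)) (m : ℕ) :
    ∑ p ∈ S, (T.filter fun t => ((m * p : ℕ) : ℤ) ∣ v t).card ≤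
      l * (T.filter fun t => (m : ℤ) ∣ v t).card := by
  have h1 : ∀ p ∈ S, (T.filter fun t => ((m * p : ℕ) : ℤ) ∣ v t).card =
      ∑ t ∈ T.filter fun t => (m : ℤ) ∣ v t, if ((m * p : ℕ) : ℤ) ∣ v t then 1 else 0 := by
    intro p _
    rw [← Finset.card_filter, Finset.filter_filter]
    congr 1
    refine Finset.filter_congr fun t _ => ⟨fun h => ⟨?_, h⟩, fun h => h.2⟩
    exact (Int.natCast_dvd_natCast.2 (Nat.dvd_mul_right m p)).trans h
  rw [Finset.sum_congr rfl h1, Finset.sum_comm, Nat.mul_comm, ← smul_eq_mul]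
  refine Finset.sum_le_card_nsmul _ _ _ fun t ht => ?_
  rw [← Finset.card_filter]
  rw [Finset.mem_filter] at ht
  exact card_prime_dvd_le hS (hv t ht.1) ht.2 (hl t ht.1)

/-- Chebyshev's lower bound for the number of primes up to `b`. -/
theorem le_primeCounting_mul_clog {b : ℕ} (hb : 2 ≤ b) :
    b ≤ 2 * Nat.clog 2 (b + 1) * ((Finset.range (b + 1)).filter Nat.Prime).card := by
  set π := ((Finset.range (b + 1)).filter Nat.Prime).card with hπ
  have hp : 1 ≤ π := Finset.card_pos.2 ⟨2, by simp [Nat.prime_two]; omega⟩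
  -- Each prime contributes to the least common multiple its largest power that is at most `b`. The
  -- claim then follows from `2 ^ b ≤ (b + 1) * lcmUpto b`.
  have h1 : Nat.lcmUpto b ≤ (b + 1) ^ π := by
    rw [Nat.lcmUpto_eq_prod_pow_log]
    have : (Nat.primesLE b).card = π := by
      rw [hπ]
      congr 1
    rw [← this]
    refine Finset.prod_le_pow_card _ _ _ fun p _ => ?_
    exact (Nat.pow_log_le_self p (by omega)).trans (by omega)
  have h2 : 2 ^ b ≤ 2 ^ (Nat.clog 2 (b + 1) * (π + 1)) := by
    calc 2 ^ b ≤ (b + 1) * Nat.lcmUpto b := Chebyshev.two_pow_le_mul_lcmUpto b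
      _ ≤ (b + 1) * (b + 1) ^ π := Nat.mul_le_mul_left _ h1
      _ = (b + 1) ^ (π + 1) := by ring
      _ ≤ (2 ^ Nat.clog 2 (b + 1)) ^ (π + 1) :=
          Nat.pow_le_pow_left (Nat.le_pow_clog one_lt_two _) _
      _ = _ := by rw [pow_mul]
  have h3 := (Nat.pow_le_pow_iff_right (a := 2) one_lt_two).1 h2
  nlinarith [Nat.zero_le (Nat.clog 2 (b + 1))]

/-! ### Counting collisions modulo `M` -/

section collisions

variable (n : ℕ) (a : ℕ → ℕ)

/-- All triples of indices. -/
def triples : Finset (ℕ × ℕ × ℕ) :=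
  Finset.range n ×ˢ Finset.range n ×ˢ Finset.range n

def pairs : Finset (ℕ × ℕ) := Finset.range n ×ˢ Finset.range n

/-- The number of solutions of `a i + a j = a k` modulo `M` plus `n` times the number of solutions
of `a i = a k`. -/
def coll (M : ℕ) : ℕ :=
  ((triples n).filter fun t => (a t.1 + a t.2.1) % M = a t.2.2 % M).card +
    n * ((pairs n).filter fun t => a t.1 % M = a t.2 % M).card

/-- Solutions of `a i + a j = a k` modulo `M` that are not solutions over the integers. -/
def falseTriples (M : ℕ) : Finset (ℕ × ℕ × ℕ) :=
  (triples n).filter fun t => (a t.1 + a t.2.1) % M = a t.2.2 % M ∧ a t.1 + a t.2.1 ≠ a t.2.2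

def falsePairs (M : ℕ) : Finset (ℕ × ℕ) :=
  (pairs n).filter fun t => a t.1 % M = a t.2 % M ∧ a t.1 ≠ a t.2

def falseColl (M : ℕ) : ℕ := (falseTriples n a M).card + n * (falsePairs n a M).card

/-- The genuine solutions add the same amount for every modulus. So moduli can be compared by
`coll`, which can be computed quickly, although `falseColl` is what has to become small. -/
theorem coll_eq (M : ℕ) : coll n a M = falseColl n a M +
    (((triples n).filter fun t => a t.1 + a t.2.1 = a t.2.2).card +
      n * ((pairs n).filter fun t => a t.1 = a t.2).card) := by
  have h1 : ((triples n).filter fun t => (a t.1 + a t.2.1) % M = a t.2.2 % M).card =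
      (falseTriples n a M).card + ((triples n).filter fun t => a t.1 + a t.2.1 = a t.2.2).card := by
    rw [← Finset.card_filter_add_card_filter_not (s := (triples n).filter _)
      (p := fun t => a t.1 + a t.2.1 ≠ a t.2.2), Finset.filter_filter, Finset.filter_filter]
    congr 2
    refine Finset.filter_congr fun t _ => ⟨fun h => not_not.1 h.2, fun h => ⟨by rw [h], by simpa⟩⟩
  have h2 : ((pairs n).filter fun t => a t.1 % M = a t.2 % M).card =
      (falsePairs n a M).card + ((pairs n).filter fun t => a t.1 = a t.2).card := by
    rw [← Finset.card_filter_add_card_filter_not (s := (pairs n).filter _)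
      (p := fun t => a t.1 ≠ a t.2), Finset.filter_filter, Finset.filter_filter]
    congr 2
    refine Finset.filter_congr fun t _ => ⟨fun h => not_not.1 h.2, fun h => ⟨by rw [h], by simpa⟩⟩
  rw [coll, falseColl, h1, h2]
  ring

/-- This permits the count to be computed modulo `2 * n ^ 3 + 1`, which keeps all numbers small. -/
theorem coll_le (M : ℕ) : coll n a M ≤ 2 * n ^ 3 := by
  have h1 := Finset.card_filter_le (triples n) fun t => (a t.1 + a t.2.1) % M = a t.2.2 % M
  have h2 := Finset.card_filter_le (pairs n) fun t => a t.1 % M = a t.2 % M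
  have h3 : (triples n).card = n ^ 3 := by simp [triples]; ring
  have h4 : (pairs n).card = n ^ 2 := by simp [pairs]; ring
  rw [coll]
  nlinarith [Nat.mul_le_mul_left n (h4 ▸ h2)]

theorem falseColl_le (M : ℕ) : falseColl n a M ≤ 2 * n ^ 3 :=
  le_trans (by rw [coll_eq]; omega) (coll_le n a M)

/-- A false collision modulo `M` is a nonzero difference, `a k - (a i + a j)` or `a k - a i`,
divisible by `M`. `sum_card_dvd_le` gives the same factor `l` for both kinds, hence also for their
weighted sum. -/
theorem sum_falseColl_le {S : Finset ℕ} (hS : ∀ p ∈ S, p.Prime) {l : ℕ}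
    (ha : ∀ i < n, 2 * a i < 2 ^ (l + 1)) (m : ℕ) :
    ∑ p ∈ S, falseColl n a (m * p) ≤ l * falseColl n a m := by
  have h1 := sum_card_dvd_le ((triples n).filter fun t => a t.1 + a t.2.1 ≠ a t.2.2)
    (fun t => (a t.2.2 : ℤ) - (a t.1 + a t.2.1 : ℕ)) hS (l := l) (fun t ht => by
      rw [Finset.mem_filter] at ht; have := ht.2; omega) (fun t ht => by
      simp only [Finset.mem_filter, triples, Finset.mem_product, Finset.mem_range] at ht
      have h1 := ha _ ht.1.1
      have h2 := ha _ ht.1.2.1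
      have h3 := ha _ ht.1.2.2
      omega) m
  have h2 := sum_card_dvd_le ((pairs n).filter fun t => a t.1 ≠ a t.2)
    (fun t => (a t.2 : ℤ) - (a t.1 : ℕ)) hS (l := l) (fun t ht => by
      rw [Finset.mem_filter] at ht; have := ht.2; omega) (fun t ht => by
      simp only [Finset.mem_filter, pairs, Finset.mem_product, Finset.mem_range] at ht
      have h1 := ha _ ht.1.1
      have h3 := ha _ ht.1.2
      omega) m
  have e1 : ∀ M : ℕ, (((triples n).filter fun t => a t.1 + a t.2.1 ≠ a t.2.2).filter
      fun t => (M : ℤ) ∣ (a t.2.2 : ℤ) - (a t.1 + a t.2.1 : ℕ)) = falseTriples n a M := by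
    intro M
    rw [falseTriples, Finset.filter_filter]
    refine Finset.filter_congr fun t _ => ?_
    rw [and_comm, ← Nat.modEq_iff_dvd, Nat.ModEq]
  have e2 : ∀ M : ℕ, (((pairs n).filter fun t => a t.1 ≠ a t.2).filter
      fun t => (M : ℤ) ∣ (a t.2 : ℤ) - (a t.1 : ℕ)) = falsePairs n a M := by
    intro M
    rw [falsePairs, Finset.filter_filter]
    refine Finset.filter_congr fun t _ => ?_
    rw [and_comm, ← Nat.modEq_iff_dvd, Nat.ModEq]
  simp only [e1, e2] at h1 h2
  simp only [falseColl, Finset.sum_add_distrib, ← Finset.mul_sum]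
  nlinarith [Nat.mul_le_mul_left n h2]

/-- If `m'` minimizes the number of collisions among the multiples `m * p` with `p ≤ b`, then it has
few collisions. -/
theorem falseColl_step {b l m m' : ℕ} (ha : ∀ i < n, 2 * a i < 2 ^ (l + 1))
    (hm' : ∀ p, 1 ≤ p → p ≤ b → coll n a m' ≤ coll n a (m * p)) :
    falseColl n a m' * ((Finset.range (b + 1)).filter Nat.Prime).card ≤
      l * falseColl n a m := by
  refine le_trans ?_ (sum_falseColl_le n a (S := (Finset.range (b + 1)).filter Nat.Prime)
    (fun p hp => (Finset.mem_filter.1 hp).2) ha m)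
  rw [Nat.mul_comm, ← smul_eq_mul]
  refine Finset.card_nsmul_le_sum _ _ _ fun p hp => ?_
  rw [Finset.mem_filter, Finset.mem_range] at hp
  -- The minimum runs over all `p ≤ b`, so it is at most each term that belongs to a prime, and thus
  -- at most their average.
  have := hm' p hp.2.one_lt.le (by omega)
  rw [coll_eq, coll_eq] at this
  omega

end collisions

namespace WordRAM

open Exp (num get)
open Exp renaming var → v

section rules

variable {X : Ctx} {Q : St → Prop} {s : St}

@[simp] theorem wp_skip : wp X .skip Q s ↔ Q s := Iff.rfl
@[simp] theorem wp_setc (x : Var) (v : ℕ) :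
    wp X (.setc x v) Q s ↔ v < X.Y ∧ Q ((s.set x v).tick 1) := Iff.rfl
@[simp] theorem wp_assign (x : Var) (e : Exp) : wp X (x ::= e) Q s ↔
    e.eval s < X.Y ∧ Q ((s.set x (e.eval s)).tick (e.cost + 1)) := Iff.rfl
@[simp] theorem wp_store (a : Arr) (x : Var) (e : Exp) : wp X (.store a x e) Q s ↔
    e.eval s < X.Y ∧ Q ((s.setArr a (s.reg x) (e.eval s)).tick (e.cost + 4)) := Iff.rfl
@[simp] theorem wp_storeDyn (d x : Var) (e : Exp) : wp X (.storeDyn d x e) Q s ↔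
    e.eval s < X.Y ∧ Q ((s.setDyn (s.reg d) (s.reg x) (e.eval s)).tick (e.cost + 6)) := Iff.rfl
@[simp] theorem wp_seq (a b : Com) : wp X (a ;; b) Q s ↔ wp X a (wp X b Q) s := Iff.rfl
@[simp] theorem wp_ite (e₁ e₂ : Exp) (a b : Com) : wp X (.ite e₁ e₂ a b) Q s ↔
    (e₁.eval s < e₂.eval s → wp X a Q (s.tick (e₁.cost + e₂.cost + 2))) ∧
      (¬ e₁.eval s < e₂.eval s → wp X b Q (s.tick (e₁.cost + e₂.cost + 2))) := Iff.rfl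

end rules

variable {X : Ctx}

/-! ### Counting collisions: choosing the length of the transform -/

/-- Compute `n2 = 2 ^ lv`, the smallest power of two that is at least `md`. -/
def sizeCom : Com :=
  .n2 ::= num 1 ;; .lv ::= num 0 ;;
  .loop .i .md (.ite (v .n2) (v .md) (.n2 ::= v .n2 * num 2 ;; .lv ::= v .lv + num 1) .skip)

theorem sizeCom_spec {M : ℕ} {s : St} (hM : s.reg .md = M) (h0 : 1 ≤ M) (hY : 2 * M < X.Y) :
    wp X sizeCom (fun s' => s'.reg .n2 = 2 ^ Nat.clog 2 M ∧ s'.reg .lv = Nat.clog 2 M ∧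
      s'.time ≤ s.time + (20 * M + 20)) s := by
  simp only [sizeCom, wp_seq, wp_assign]
  refine ⟨by simp; omega, by simp; omega, ?_⟩
  -- There are only counting loops, so doubling is attempted `M` times; `M ≤ 2 ^ M` shows that this
  -- is enough.
  refine wp_loop_time 20 (fun k s' => s'.reg .n2 = 2 ^ s'.reg .lv ∧ s'.reg .lv ≤ Nat.clog 2 M ∧
    (s'.reg .lv = k ∨ M ≤ s'.reg .n2)) rfl rfl (by simp) ?_ ?_
  · rintro k hk s' hf hi ⟨h1, h2, h3⟩
    have hmd : s'.reg .md = M := hf.reg (by simpa using hM) rfl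
    have hclog : Nat.clog 2 M ≤ M := by
      rw [Nat.clog_le_iff_le_pow one_lt_two]
      exact Nat.lt_two_pow_self.le
    simp only [wp_ite, wp_seq, wp_assign, wp_skip]
    refine ⟨fun hlt => ?_, fun hlt => ?_⟩
    · simp [hmd] at hlt
      have h4 : s'.reg .lv + 1 ≤ Nat.clog 2 M := by
        rw [Nat.succ_le_iff, Nat.lt_clog_iff_pow_lt one_lt_two, ← h1]
        exact hlt
      simp
      refine ⟨by omega, by omega, ?_, h4, by omega⟩
      rw [h1, pow_succ]
    · simp [hmd] at hlt
      simp
      exact ⟨h1, h2, by omega⟩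
  · rintro s' hf ⟨h1, h2, h3⟩ ht
    simp [hM] at ht h3
    have h4 : M ≤ 2 ^ s'.reg .lv := by
      rcases h3 with h3 | h3
      · rw [h3]; exact Nat.lt_two_pow_self.le
      · rwa [← h1]
    have h5 : s'.reg .lv = Nat.clog 2 M :=
      le_antisymm h2 ((Nat.clog_le_iff_le_pow one_lt_two).2 h4)
    refine ⟨by simp [h1, h5], by simp [h5], ?_⟩
    simp
    omega

/-! ### Counting collisions: the histogram -/

/-- The number of indices `k < n` with `a k % M = i`. -/
def hist (n : ℕ) (a : ℕ → ℕ) (M i : ℕ) : ℕ :=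
  ((Finset.range n).filter fun k => a k % M = i).card

theorem hist_succ (n : ℕ) (a : ℕ → ℕ) (M i : ℕ) :
    hist (n + 1) a M i = hist n a M i + if a n % M = i then 1 else 0 := by
  unfold hist
  rw [Finset.range_add_one, Finset.filter_insert]
  split_ifs
  · rw [Finset.card_insert_of_notMem (by simp)]
  · rfl

theorem hist_le (n : ℕ) (a : ℕ → ℕ) (M i : ℕ) : hist n a M i ≤ n :=
  (Finset.card_filter_le _ _).trans (Finset.card_range n).le

/-- The input array represents the sequence `a` of length `n`. -/
def St.Input (s : St) (n : ℕ) (a : ℕ → ℕ) : Prop :=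
  s.reg .n = n ∧ ∀ i < n, s.arr .input i = a i

theorem St.Input.frame {s s' : St} {n : ℕ} {a : ℕ → ℕ} (h : s.Input n a) {c : Com}
    (hf : c.Frame s s') (hn : c.wr .n = false) (ha : c.wa .input = false) : s'.Input n a :=
  ⟨hf.reg h.1 hn, fun i hi => by rw [hf.arr _ ha, h.2 i hi]⟩

/-- Fill the arrays `X`, `B` and `C` for the trilinear form that counts collisions. -/
def histCom : Com :=
  .loop .i .n2 (.store .X .i (num 0)) ;;
  .loop .i .n (.t ::= get .input .i ;; .r ::= v .t % v .md ;; .store .X .r (get .X .r + num 1)) ;;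
  .loop .i .n2 (.store .B .i (get .X .i)) ;;
  .z ::= num 0 ;; .store .B .z (get .B .z + v .n) ;;
  .n22 ::= v .n2 * num 2 ;;
  .loop .i .n22 (.t ::= v .i % v .md ;; .store .C .i (get .X .t))

/-- `C` repeats the histogram periodically up to `2 * N`, because the transform pairs it with sums
`i + j` that are not reduced modulo `M`. The extra `n` at `B 0` contributes the terms `n * X i * C
i`, so a single trilinear form counts the triples and, with weight `n`, the pairs. -/
theorem histCom_spec {n M N : ℕ} {a : ℕ → ℕ} {s : St} (ha : s.Input n a)
    (hM : s.reg .md = M) (h0 : 1 ≤ M) (hN : s.reg .n2 = N) (hMN : M ≤ N) (hY : 2 * N < X.Y)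
    (hY' : 2 * n + 1 < X.Y) (haY : ∀ i < n, a i < X.Y) :
    wp X histCom (fun s' => (∀ i < N, s'.arr .X i = hist n a M i) ∧
      (∀ i < N, s'.arr .B i = hist n a M i + if i = 0 then n else 0) ∧
      (∀ i < 2 * N, s'.arr .C i = hist n a M (i % M)) ∧
      s'.time ≤ s.time + (100 * N + 40 * n + 100)) s := by
  simp only [histCom, wp_seq]
  refine wp_loop_time 20 (fun k s' => ∀ i < k, s'.arr .X i = 0) rfl rfl (by simp) ?_ ?_
  · rintro k hk s' hf hi hI
    simp [hi]
    refine ⟨by omega, fun i hik h => hI i (by omega)⟩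
  rintro s1 f1 hI1 t1
  rw [hN] at hI1 t1
  have a1 := ha.frame f1 rfl rfl
  have m1 := f1.reg hM rfl
  have n1 := f1.reg hN rfl
  refine wp_loop_time 30 (fun k s' => ∀ i < N, s'.arr .X i = hist k a M i) rfl rfl
    (by simpa [hist] using hI1) ?_ ?_
  · rintro k hk s' hf hi hI
    have a2 := St.Input.frame (s := s1.tick 2) a1 hf rfl rfl
    have m2 : s'.reg .md = M := hf.reg (by simpa using m1) rfl
    simp [a1.1] at hk
    have hin : s'.arr .input k = a k := a2.2 k hk
    have hmod : a k % M < N := (Nat.mod_lt _ h0).trans_le hMN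
    simp [hi, hin, m2]
    rw [hI _ hmod]
    have := hist_le k a M (a k % M)
    refine ⟨haY k hk, by omega, by omega, fun i hiN => ?_⟩
    rw [hist_succ]
    by_cases h : i = a k % M
    · simp [h]
    · simp [h, Ne.symm h, hI i hiN]
  rintro s2 f2 hI2 t2
  simp [a1.1] at hI2 t2
  have n2 : s2.reg .n2 = N := f2.reg (by simpa using n1) rfl
  have m2 : s2.reg .md = M := f2.reg (by simpa using m1) rfl
  have a2 := St.Input.frame (s := s1.tick 2) a1 f2 rfl rfl
  refine wp_loop_time 20 (fun k s' => ∀ i < k, s'.arr .B i = hist n a M i) rfl rfl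
    (by simp) ?_ ?_
  · rintro k hk s' hf hi hI
    have hX := hf.arr .X rfl
    simp [n2] at hk hX
    simp [hi, hX, hI2 k hk]
    have := hist_le n a M k
    refine ⟨by omega, fun i hik => ?_⟩
    split_ifs with h
    · rw [h]
    · exact hI i (by omega)
  rintro s3 f3 hI3 t3
  have n3 : s3.reg .n2 = N := f3.reg (by simpa using n2) rfl
  have m3 : s3.reg .md = M := f3.reg (by simpa using m2) rfl
  have a3 := St.Input.frame (s := s2.tick 2) a2 f3 rfl rfl
  have hX3 := f3.arr .X rfl
  simp [n2] at hI3 t3 hX3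
  simp [n3, a3.1, hI3 0 (by omega)]
  have := hist_le n a M 0
  refine ⟨by omega, by omega, by omega, ?_⟩
  refine wp_loop_time 30 (fun k s' => ∀ i < k, s'.arr .C i = hist n a M (i % M)) rfl rfl
    (by simp) ?_ ?_
  · rintro k hk s' hf hi hI
    have hX := hf.arr .X rfl
    have m4 : s'.reg .md = M := hf.reg (by simpa using m3) rfl
    simp at hk hX
    have hmod : k % M < N := (Nat.mod_lt _ h0).trans_le hMN
    simp [hi, hX, hX3, hI2 _ hmod, m4]
    have := hist_le n a M (k % M)
    refine ⟨by omega, by omega, fun i hik => ?_⟩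
    split_ifs with h
    · rw [h]
    · exact hI i (by omega)
  rintro s4 f4 hI4 t4
  simp at t4 hI4 ⊢
  have hX4 := f4.arr .X rfl
  have hB4 := f4.arr .B rfl
  refine ⟨fun i hi => ?_, fun i hi => ?_, fun i hi => hI4 i (by omega), by omega⟩
  · simp [hX4, hX3, hI2 i hi]
  · simp [hB4]
    by_cases h : i = 0
    · simp [h]
    · simp [h, hI3 i hi]

/-! ### Counting collisions: one level of Karatsuba's algorithm -/

/-- An entry of the next level for the arrays `X` and `B`. -/
def levelUp (R : ℕ) (f : ℕ → ℕ) (o l h i : ℕ) : ℕ :=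
  if i / h % 3 < 1 then f (o + i / h / 3 * l + i % h) % R
  else if i / h % 3 < 2 then
    (f (o + i / h / 3 * l + i % h) + f (o + i / h / 3 * l + i % h + h)) % R
  else f (o + i / h / 3 * l + i % h + h) % R

/-- An entry of the next level for the array `C`. -/
def levelUpC (R : ℕ) (f : ℕ → ℕ) (o l h i : ℕ) : ℕ :=
  if i / l % 3 < 1 then
    (f (2 * o + i / l / 3 * (2 * l) + i % l) + R -
      f (2 * o + i / l / 3 * (2 * l) + i % l + h) % R) % R
  else if i / l % 3 < 2 then f (2 * o + i / l / 3 * (2 * l) + i % l + h) % R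
  else (f (2 * o + i / l / 3 * (2 * l) + i % l + h + h) + R -
      f (2 * o + i / l / 3 * (2 * l) + i % l + h) % R) % R

/-- Compute the next level of the arrays `X`, `B`, `C`. -/
def levelCom : Com :=
  .h ::= v .len / num 2 ;; .o2 ::= v .o + v .nb * v .len ;; .d1 ::= v .nb * num 3 * v .h ;;
  .loop .i .d1 (
    .u ::= v .i / v .h ;; .s1 ::= v .o + v .u / num 3 * v .len + v .i % v .h ;;
    .s2 ::= v .s1 + v .h ;; .d ::= v .o2 + v .i ;;
    .ite (v .u % num 3) (num 1)
      (.store .X .d (get .X .s1 % v .rr) ;; .store .B .d (get .B .s1 % v .rr))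
      (.ite (v .u % num 3) (num 2)
        (.store .X .d ((get .X .s1 + get .X .s2) % v .rr) ;;
          .store .B .d ((get .B .s1 + get .B .s2) % v .rr))
        (.store .X .d (get .X .s2 % v .rr) ;; .store .B .d (get .B .s2 % v .rr)))) ;;
  .d2 ::= v .d1 * num 2 ;;
  .loop .i .d2 (
    .u ::= v .i / v .len ;;
    .s1 ::= num 2 * v .o + v .u / num 3 * (num 2 * v .len) + v .i % v .len ;;
    .s2 ::= v .s1 + v .h ;; .s3 ::= v .s2 + v .h ;; .d ::= num 2 * v .o2 + v .i ;;
    .ite (v .u % num 3) (num 1)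
      (.store .C .d ((get .C .s1 + v .rr - get .C .s2 % v .rr) % v .rr))
      (.ite (v .u % num 3) (num 2)
        (.store .C .d (get .C .s2 % v .rr))
        (.store .C .d ((get .C .s3 + v .rr - get .C .s2 % v .rr) % v .rr)))) ;;
  .o ::= v .o2 ;; .len ::= v .h ;; .nb ::= v .nb * num 3

/-- The entries that are read lie within the previous level, whose cells are not overwritten while
the next level is computed. -/
theorem level_index {N h l i : ℕ} (hl : l = h * 2) (hi : i < N * 3 * h) :
    i / h / 3 * l + i % h + h < N * l := by
  have h0 : 0 < h := Nat.pos_of_ne_zero (by rintro rfl; simp at hi)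
  have h1 : i / h / 3 < N := by
    rw [Nat.div_div_eq_div_mul, Nat.div_lt_iff_lt_mul (by positivity)]
    nlinarith
  have h2 := Nat.mod_lt i h0
  have h3 := Nat.mul_le_mul_right l h1
  rw [Nat.succ_mul] at h3
  omega

theorem level_index_two {N h l i : ℕ} (hl : l = h * 2) (hi : i < N * 3 * h * 2) :
    i / l / 3 * (2 * l) + i % l + h + h < N * (2 * l) := by
  have h0 : 0 < l := Nat.pos_of_ne_zero (by rintro rfl; simp [show h = 0 by omega] at hi)
  have h1 : i / l / 3 < N := by
    rw [Nat.div_div_eq_div_mul, Nat.div_lt_iff_lt_mul (by positivity)]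
    subst hl
    nlinarith
  have h2 := Nat.mod_lt i h0
  have h3 := Nat.mul_le_mul_right (2 * l) h1
  rw [Nat.succ_mul] at h3
  omega

/-- The levels are stored one behind the other: the `N` blocks of length `2 * h` at offset `o` are
followed by their `3 * N` blocks of length `h`. Blocks of `C` are twice as long, so its offsets are
doubled. -/
theorem levelCom_spec {R N h o : ℕ} {s : St} (hR : s.reg .rr = R) (hR0 : 0 < R) (hRY : R < X.Y)
    (hl : s.reg .len = h * 2) (ho : s.reg .o = o) (hN : s.reg .nb = N) (hh : 1 ≤ h) (hN1 : 1 ≤ N)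
    (hY : 2 * (o + N * (h * 2) + N * 3 * h) < X.Y) :
    wp X levelCom (fun s' => s'.reg .len = h ∧ s'.reg .nb = N * 3 ∧
      s'.reg .o = o + N * (h * 2) ∧
      (∀ i < N * 3 * h, s'.arr .X (o + N * (h * 2) + i) = levelUp R (s.arr .X) o (h * 2) h i) ∧
      (∀ i < N * 3 * h, s'.arr .B (o + N * (h * 2) + i) = levelUp R (s.arr .B) o (h * 2) h i) ∧
      (∀ i < N * 3 * h * 2, s'.arr .C (2 * (o + N * (h * 2)) + i) =
        levelUpC R (s.arr .C) o (h * 2) h i) ∧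
      s'.time ≤ s.time + (400 * (N * 3 * h) + 100)) s := by
  simp only [levelCom, wp_seq, wp_assign]
  have hdiv : h * 2 / 2 = h := by omega
  have hNh : h ≤ N * h := Nat.le_mul_of_pos_left h hN1
  have hNh' : N ≤ N * h := Nat.le_mul_of_pos_right N hh
  have e1 : N * (h * 2) = 2 * (N * h) := by ring
  have e2 : N * 3 * h = 3 * (N * h) := by ring
  simp [hl, ho, hN, hdiv]
  refine ⟨by omega, by omega, by omega, ?_⟩
  have hm : ∀ x, x % R < X.Y := fun x => (Nat.mod_lt _ hR0).trans hRY
  refine wp_loop_time 120 (fun k s' =>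
    (∀ i < k, s'.arr .X (o + N * (h * 2) + i) = levelUp R (s.arr .X) o (h * 2) h i) ∧
    (∀ i < k, s'.arr .B (o + N * (h * 2) + i) = levelUp R (s.arr .B) o (h * 2) h i) ∧
    (∀ i < o + N * (h * 2), s'.arr .X i = s.arr .X i) ∧
    (∀ i < o + N * (h * 2), s'.arr .B i = s.arr .B i)) rfl rfl (by simp) ?_ ?_
  · rintro k hk s' hf hi ⟨hX, hB, hX', hB'⟩
    have hR' : s'.reg .rr = R := hf.reg (by simpa using hR) rfl
    have hl' : s'.reg .len = h * 2 := hf.reg (by simpa using hl) rfl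
    have hh' : s'.reg .h = h := hf.reg (by simp) rfl
    have ho' : s'.reg .o = o := hf.reg (by simpa using ho) rfl
    have ho2' : s'.reg .o2 = o + N * (h * 2) := hf.reg (by simp) rfl
    simp at hk
    have hidx := level_index rfl hk
    have hkh := Nat.div_le_self k h
    have x1 := hX' (o + k / h / 3 * (h * 2) + k % h) (by omega)
    have x2 := hX' (o + k / h / 3 * (h * 2) + k % h + h) (by omega)
    have b1 := hB' (o + k / h / 3 * (h * 2) + k % h) (by omega)
    have b2 := hB' (o + k / h / 3 * (h * 2) + k % h + h) (by omega)
    simp [hi, hR', hl', hh', ho', ho2', x1, x2, b1, b2, hm]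
    refine ⟨by omega, by omega, by omega, by omega, fun hc => ?_, fun hc => ⟨fun hc' => ?_,
      fun hc' => ?_⟩⟩
    all_goals
      refine ⟨fun i hik => ?_, fun i hik => ?_, fun i hio => ?_, fun i hio => ?_⟩
      · split_ifs with hc1
        · subst hc1; simp [levelUp, hc]
          try intros
          try omega
        · exact hX i (by omega)
      · split_ifs with hc1
        · subst hc1; simp [levelUp, hc]
          try intros
          try omega
        · exact hB i (by omega)
      · rw [if_neg (by omega), hX' i hio]
      · rw [if_neg (by omega), hB' i hio]
  rintro s1 f1 ⟨hX1, hB1, -, -⟩ t1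
  have hR1 : s1.reg .rr = R := f1.reg (by simpa using hR) rfl
  have hl1 : s1.reg .len = h * 2 := f1.reg (by simpa using hl) rfl
  have hh1 : s1.reg .h = h := f1.reg (by simp) rfl
  have ho1 : s1.reg .o = o := f1.reg (by simpa using ho) rfl
  have ho21 : s1.reg .o2 = o + N * (h * 2) := f1.reg (by simp) rfl
  have hN1' : s1.reg .nb = N := f1.reg (by simpa using hN) rfl
  have hd1 : s1.reg .d1 = N * 3 * h := f1.reg (by simp) rfl
  have hC1 := f1.arr .C rfl
  simp at hX1 hB1 t1 hC1
  simp [hd1]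
  refine ⟨by omega, ?_⟩
  refine wp_loop_time 120 (fun k s' =>
    (∀ i < k, s'.arr .C (2 * (o + N * (h * 2)) + i) = levelUpC R (s.arr .C) o (h * 2) h i) ∧
    (∀ i < 2 * (o + N * (h * 2)), s'.arr .C i = s.arr .C i)) rfl rfl (by simp [hC1]) ?_ ?_
  · rintro k hk s' hf hi ⟨hC, hC'⟩
    have hR' : s'.reg .rr = R := hf.reg (by simpa using hR1) rfl
    have hl' : s'.reg .len = h * 2 := hf.reg (by simpa using hl1) rfl
    have hh' : s'.reg .h = h := hf.reg (by simp [hh1]) rfl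
    have ho' : s'.reg .o = o := hf.reg (by simpa using ho1) rfl
    have ho2' : s'.reg .o2 = o + N * (h * 2) := hf.reg (by simp [ho21]) rfl
    simp at hk
    have hidx := level_index_two rfl hk
    have hkh := Nat.div_le_self k (h * 2)
    have e3 : N * (2 * (h * 2)) = 4 * (N * h) := by ring
    have x1 := hC' (2 * o + k / (h * 2) / 3 * (2 * (h * 2)) + k % (h * 2)) (by omega)
    have x2 := hC' (2 * o + k / (h * 2) / 3 * (2 * (h * 2)) + k % (h * 2) + h) (by omega)
    have x3 := hC' (2 * o + k / (h * 2) / 3 * (2 * (h * 2)) + k % (h * 2) + h + h) (by omega)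
    simp [hi, hR', hl', hh', ho', ho2', x1, x2, x3, hm]
    refine ⟨by omega, by omega, by omega, by omega, by omega, fun hc => ?_,
      fun hc => ⟨fun hc' => ?_, fun hc' => ?_⟩⟩
    all_goals
      refine ⟨fun i hik => ?_, fun i hio => ?_⟩
      · split_ifs with hc1
        · subst hc1; simp [levelUpC, hc]
          try intros
          try omega
        · exact hC i (by omega)
      · rw [if_neg (by omega), hC' i hio]
  rintro s2 f2 ⟨hC2, -⟩ t2
  have hh2 : s2.reg .h = h := f2.reg (by simpa using hh1) rfl
  have ho22 : s2.reg .o2 = o + N * (h * 2) := f2.reg (by simpa using ho21) rfl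
  have hN2 : s2.reg .nb = N := f2.reg (by simpa using hN1') rfl
  have hX2 := f2.arr .X rfl
  have hB2 := f2.arr .B rfl
  simp at hC2 t2 hX2 hB2
  simp [hh2, ho22, hN2]
  refine ⟨by omega, by omega, by omega, ?_, ?_, hC2, by omega⟩
  · rw [hX2]; exact hX1
  · rw [hB2]; exact hB1

/-! ### Counting collisions: the whole transform -/

/-- The sum of the trilinear forms of all blocks of one level. -/
def levelSum (R N l o : ℕ) (x b c : ℕ → ℕ) : ZMod R :=
  ∑ q ∈ Finset.range N, triForm l (fun t => (x (o + q * l + t) : ZMod R))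
    (fun t => (b (o + q * l + t) : ZMod R)) (fun t => (c (2 * o + q * (2 * l) + t) : ZMod R))

theorem sum_range_mul_three {K : Type*} [AddCommMonoid K] (f : ℕ → K) (N : ℕ) :
    ∑ q ∈ Finset.range (N * 3), f q =
      ∑ q ∈ Finset.range N, (f (3 * q) + f (3 * q + 1) + f (3 * q + 2)) := by
  induction N with
  | zero => simp
  | succ N ih =>
    rw [show (N + 1) * 3 = N * 3 + 1 + 1 + 1 by ring, Finset.sum_range_succ, Finset.sum_range_succ,
      Finset.sum_range_succ, Finset.sum_range_succ, ih, Nat.mul_comm N 3]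
    simp only [add_assoc]

/-- Subtraction on the machine is truncated. Adding `R` and reducing `y` beforehand ensures that
nothing is cut off. -/
theorem cast_sub_mod {R : ℕ} (hR : 0 < R) (x y : ℕ) :
    (((x + R - y % R) % R : ℕ) : ZMod R) = x - y := by
  have : y % R ≤ x + R := (Nat.mod_lt y hR).le.trans (by omega)
  rw [ZMod.natCast_mod, Nat.cast_sub this, Nat.cast_add, ZMod.natCast_self, ZMod.natCast_mod]
  ring

/-- Block `q` has the children `3 * q`, `3 * q + 1` and `3 * q + 2`, which carry the three forms of
`triForm_two_mul`. The reductions modulo `R` disappear in `ZMod R`. -/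
theorem levelSum_step {R N h o : ℕ} (hR : 0 < R) (hh : 1 ≤ h) {x b c x' b' c' : ℕ → ℕ}
    (hx : ∀ i < N * 3 * h, x' (o + N * (h * 2) + i) = levelUp R x o (h * 2) h i)
    (hb : ∀ i < N * 3 * h, b' (o + N * (h * 2) + i) = levelUp R b o (h * 2) h i)
    (hc : ∀ i < N * 3 * h * 2, c' (2 * (o + N * (h * 2)) + i) = levelUpC R c o (h * 2) h i) :
    levelSum R (N * 3) h (o + N * (h * 2)) x' b' c' = levelSum R N (h * 2) o x b c := by
  have idx : ∀ {m p t M : ℕ}, t < m → p < M → p * m + t < M * m := by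
    intro m p t M ht hp
    have := Nat.mul_le_mul_right m (Nat.succ_le_of_lt hp)
    rw [Nat.succ_mul] at this
    omega
  have up : ∀ {f : ℕ → ℕ} {p t : ℕ}, t < h → levelUp R f o (h * 2) h (p * h + t) =
      if p % 3 < 1 then f (o + p / 3 * (h * 2) + t) % R
      else if p % 3 < 2 then (f (o + p / 3 * (h * 2) + t) + f (o + p / 3 * (h * 2) + t + h)) % R
      else f (o + p / 3 * (h * 2) + t + h) % R := by
    intro f p t ht
    have e1 : (p * h + t) / h = p := by
      rw [Nat.mul_comm, Nat.mul_add_div (by omega), Nat.div_eq_of_lt ht, Nat.add_zero]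
    have e2 : (p * h + t) % h = t := by
      rw [Nat.mul_comm, Nat.mul_add_mod, Nat.mod_eq_of_lt ht]
    rw [levelUp, e1, e2]
  have upC : ∀ {p t : ℕ}, t < 2 * h → levelUpC R c o (h * 2) h (p * (2 * h) + t) =
      if p % 3 < 1 then (c (2 * o + p / 3 * (2 * (h * 2)) + t) + R -
        c (2 * o + p / 3 * (2 * (h * 2)) + t + h) % R) % R
      else if p % 3 < 2 then c (2 * o + p / 3 * (2 * (h * 2)) + t + h) % R
      else (c (2 * o + p / 3 * (2 * (h * 2)) + t + h + h) + R -
        c (2 * o + p / 3 * (2 * (h * 2)) + t + h) % R) % R := by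
    intro p t ht
    have e1 : (p * (2 * h) + t) / (h * 2) = p := by
      rw [show p * (2 * h) = (h * 2) * p by ring, Nat.mul_add_div (by omega),
        Nat.div_eq_of_lt (by omega), Nat.add_zero]
    have e2 : (p * (2 * h) + t) % (h * 2) = t := by
      rw [show p * (2 * h) = (h * 2) * p by ring, Nat.mul_add_mod, Nat.mod_eq_of_lt (by omega)]
    rw [levelUpC, e1, e2]
  have key : ∀ {f f' : ℕ → ℕ}, (∀ i < N * 3 * h,
      f' (o + N * (h * 2) + i) = levelUp R f o (h * 2) h i) → ∀ p < N * 3, ∀ t < h,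
      f' (o + N * (h * 2) + p * h + t) = levelUp R f o (h * 2) h (p * h + t) := by
    intro f f' hf p hp t ht
    rw [Nat.add_assoc]
    exact hf _ (idx ht hp)
  have keyC : ∀ p < N * 3, ∀ t < 2 * h, c' (2 * (o + N * (h * 2)) + p * (2 * h) + t) =
      levelUpC R c o (h * 2) h (p * (2 * h) + t) := by
    intro p hp t ht
    rw [Nat.add_assoc]
    refine hc _ ?_
    rw [show N * 3 * h * 2 = N * 3 * (2 * h) by ring]
    exact idx ht hp
  rw [levelSum, levelSum, sum_range_mul_three]
  refine Finset.sum_congr rfl fun q hq => ?_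
  rw [Finset.mem_range] at hq
  rw [Nat.mul_two h, triForm_two_mul, ← Nat.mul_two h]
  have d0 : 3 * q / 3 = q := by omega
  have d1 : (3 * q + 1) / 3 = q := by omega
  have d2 : (3 * q + 2) / 3 = q := by omega
  have m0 : 3 * q % 3 = 0 := by omega
  have m1 : (3 * q + 1) % 3 = 1 := by omega
  have m2 : (3 * q + 2) % 3 = 2 := by omega
  have l0 : 3 * q < N * 3 := by omega
  have l1 : 3 * q + 1 < N * 3 := by omega
  have l2 : 3 * q + 2 < N * 3 := by omega
  congr 1
  · congr 1
    · refine triForm_congr (fun t ht => ?_) (fun t ht => ?_) (fun t ht => ?_)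
      · rw [key hx _ l0 t ht, up ht]; simp [m0, d0]
      · rw [key hb _ l0 t ht, up ht]; simp [m0, d0]
      · rw [keyC _ l0 t ht, upC ht]; simp only [m0, d0, zero_lt_one, if_true, cast_sub_mod hR, Nat.add_assoc]
    · refine triForm_congr (fun t ht => ?_) (fun t ht => ?_) (fun t ht => ?_)
      · rw [key hx _ l1 t ht, up ht]; simp [m1, d1, Nat.add_assoc]
      · rw [key hb _ l1 t ht, up ht]; simp [m1, d1, Nat.add_assoc]
      · rw [keyC _ l1 t ht, upC ht]; simp [m1, d1, Nat.add_assoc]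
  · refine triForm_congr (fun t ht => ?_) (fun t ht => ?_) (fun t ht => ?_)
    · rw [key hx _ l2 t ht, up ht]; simp [m2, d2, Nat.add_assoc]
    · rw [key hb _ l2 t ht, up ht]; simp [m2, d2, Nat.add_assoc]
    · rw [keyC _ l2 t ht, upC ht, if_neg (by omega), if_neg (by omega), cast_sub_mod hR, d2]
      simp only [Nat.add_assoc]

/-- Compute all levels, and sum up the products of the last one. -/
def transformCom : Com :=
  .len ::= v .n2 ;; .nb ::= num 1 ;; .o ::= num 0 ;;
  .loop .lev .lv levelCom ;;
  .phi ::= num 0 ;;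
  .loop .q .nb (.s1 ::= v .o + v .q ;; .s2 ::= num 2 * v .s1 ;;
    .phi ::= (v .phi + get .X .s1 * get .B .s1 * get .C .s2) % v .rr)

/-- Level `k` has `3 ^ k` blocks of length `2 ^ (L - k)`, hence at most `3 ^ L` cells; this explains
the factor `(L + 1) * 3 ^ L` for space and time. On the last level the blocks have length one, and
the forms are plain products. -/
theorem transformCom_spec {R L : ℕ} {s : St} (hR : s.reg .rr = R) (hR1 : 1 < R) (hRY : R < X.Y)
    (hn2 : s.reg .n2 = 2 ^ L) (hL : s.reg .lv = L) (hY : 4 * (L + 1) * 3 ^ L < X.Y) :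
    wp X transformCom (fun s' => s'.reg .phi < R ∧
      (s'.reg .phi : ZMod R) = triForm (2 ^ L) (fun t => (s.arr .X t : ZMod R))
        (fun t => (s.arr .B t : ZMod R)) (fun t => (s.arr .C t : ZMod R)) ∧
      s'.time ≤ s.time + (1000 * (L + 1) * 3 ^ L + 100)) s := by
  have h3 : 1 ≤ 3 ^ L := Nat.one_le_pow _ _ (by omega)
  have h23 : 2 ^ L ≤ 3 ^ L := Nat.pow_le_pow_left (by omega) L
  have hL3 : 4 * 3 ^ L ≤ 4 * (L + 1) * 3 ^ L := Nat.mul_le_mul_right _ (by omega)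
  simp only [transformCom, wp_seq, wp_assign]
  simp [hn2]
  refine ⟨by omega, by omega, by omega, ?_⟩
  refine wp_loop_time (600 * 3 ^ L + 110) (fun k s' => s'.reg .len = 2 ^ (L - k) ∧
    s'.reg .nb = 3 ^ k ∧ s'.reg .o ≤ k * 3 ^ L ∧
    levelSum R (3 ^ k) (2 ^ (L - k)) (s'.reg .o) (s'.arr .X) (s'.arr .B) (s'.arr .C) =
      triForm (2 ^ L) (fun t => (s.arr .X t : ZMod R))
        (fun t => (s.arr .B t : ZMod R)) (fun t => (s.arr .C t : ZMod R)))
    rfl rfl (by simp [levelSum]) ?_ ?_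
  · rintro k hk s' hf hi ⟨i1, i2, i3, i4⟩
    simp [hL] at hk
    have hR' : s'.reg .rr = R := hf.reg (by simpa using hR) rfl
    have hp : 2 ^ (L - k) = 2 ^ (L - (k + 1)) * 2 := by
      rw [← pow_succ]; congr 1; omega
    have hb : 3 ^ k * 3 * 2 ^ (L - (k + 1)) ≤ 3 ^ L := by
      calc 3 ^ k * 3 * 2 ^ (L - (k + 1)) ≤ 3 ^ k * 3 * 3 ^ (L - (k + 1)) :=
            Nat.mul_le_mul_left _ (Nat.pow_le_pow_left (by omega) _)
        _ = 3 ^ L := by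
            rw [← pow_succ, ← pow_add]; congr 1; omega
    have hb2 : 3 ^ k * (2 ^ (L - (k + 1)) * 2) ≤ 3 ^ L := by
      refine le_trans ?_ hb
      rw [show 3 ^ k * 3 * 2 ^ (L - (k + 1)) = 3 ^ k * (2 ^ (L - (k + 1)) * 3) by ring]
      exact Nat.mul_le_mul_left _ (by omega)
    have hkL : (k + 1) * 3 ^ L ≤ L * 3 ^ L := Nat.mul_le_mul_right _ hk
    have e4 : 4 * (L + 1) * 3 ^ L = 4 * (L * 3 ^ L) + 4 * 3 ^ L := by ring
    have e5 : (k + 1) * 3 ^ L = k * 3 ^ L + 3 ^ L := by ring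
    rw [hp] at i1 i4
    refine wp_mono ?_ (levelCom_spec hR' (by omega) hRY i1 rfl i2 (Nat.one_le_two_pow)
      (Nat.one_le_pow _ _ (by omega)) (by omega))
    rintro s'' ⟨j1, j2, j3, j4, j5, j6, j7⟩
    refine ⟨by omega, ?_⟩
    simp
    refine ⟨j1, by rw [j2, pow_succ], by omega, ?_⟩
    rw [pow_succ, j3, levelSum_step (by omega) (Nat.one_le_two_pow) j4 j5 j6, i4]
  rintro s1 f1 ⟨i1, i2, i3, i4⟩ t1
  have hR' : s1.reg .rr = R := f1.reg (by simpa using hR) rfl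
  simp [hL] at i1 i2 i3 i4 t1
  simp
  refine ⟨by omega, ?_⟩
  have e4 : 4 * (L + 1) * 3 ^ L = 4 * (L * 3 ^ L) + 4 * 3 ^ L := by ring
  refine wp_loop_time 60 (fun k s' => s'.reg .phi < R ∧ (s'.reg .phi : ZMod R) =
    levelSum R k 1 (s1.reg .o) (s1.arr .X) (s1.arr .B) (s1.arr .C)) rfl rfl
    (by simp [levelSum]; omega) ?_ ?_
  · rintro k hk s' hf hi ⟨j1, j2⟩
    simp [i2] at hk
    have hR'' : s'.reg .rr = R := hf.reg (by simpa using hR') rfl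
    have ho : s'.reg .o = s1.reg .o := hf.reg (by simp) rfl
    have hX := hf.arr .X rfl
    have hB := hf.arr .B rfl
    have hC := hf.arr .C rfl
    simp at hX hB hC
    have hm : ∀ x, x % R < R := fun x => Nat.mod_lt _ (by omega)
    simp [hi, hR'', ho, hX, hB, hC, hm, (hm _).trans hRY]
    refine ⟨by omega, by omega, ?_⟩
    rw [j2, levelSum, levelSum, Finset.sum_range_succ]
    congr 1
    simp [triForm, Nat.mul_add, Nat.mul_comm k 2]
  rintro s2 f2 ⟨j1, j2⟩ t2
  simp [i2] at j2 t2
  simp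
  refine ⟨j1, by rw [j2, i4], ?_⟩
  have e5 : L * (600 * 3 ^ L + 110) = 600 * (L * 3 ^ L) + 110 * L := by ring
  have e6 : 1000 * (L + 1) * 3 ^ L = 1000 * (L * 3 ^ L) + 1000 * 3 ^ L := by ring
  have e7 : L ≤ L * 3 ^ L := Nat.le_mul_of_pos_right _ h3
  omega

/-- The trilinear form of the histogram counts collisions. -/
theorem sum_hist_mul (n : ℕ) (a : ℕ → ℕ) {M N : ℕ} (hM : 1 ≤ M) (hMN : M ≤ N) (f : ℕ → ℕ) :
    ∑ i ∈ Finset.range N, hist n a M i * f i = ∑ k ∈ Finset.range n, f (a k % M) := by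
  induction n with
  | zero => simp [hist]
  | succ n ih =>
    rw [Finset.sum_range_succ, ← ih]
    simp only [hist_succ, Nat.add_mul, Finset.sum_add_distrib]
    congr 1
    rw [Finset.sum_eq_single (a n % M)]
    · simp
    · intro i _ hi; simp [Ne.symm hi]
    · intro h
      exact absurd (Finset.mem_range.2 ((Nat.mod_lt _ hM).trans_le hMN)) h

/-- By `sum_hist_mul`, weighting with the histogram amounts to summing over the sequence. This
replaces `i` and `j` by residues of elements, and the last histogram value counts the third elements
that fit. The extra `n` at `j = 0` becomes the weighted number of pairs. -/
theorem sum_hist_eq_coll (n : ℕ) (a : ℕ → ℕ) {M N : ℕ} (hM : 1 ≤ M) (hMN : M ≤ N) :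
    ∑ i ∈ Finset.range N, ∑ j ∈ Finset.range N, hist n a M i *
      (hist n a M j + if j = 0 then n else 0) * hist n a M ((i + j) % M) = coll n a M := by
  have h1 : ∀ i, ∑ j ∈ Finset.range N, hist n a M i *
      (hist n a M j + if j = 0 then n else 0) * hist n a M ((i + j) % M) =
      hist n a M i * (∑ j ∈ Finset.range n, hist n a M ((i + a j) % M) + n * hist n a M (i % M)) := by
    intro i
    simp only [mul_assoc, ← Finset.mul_sum, add_mul, Finset.sum_add_distrib]
    rw [sum_hist_mul n a hM hMN fun j => hist n a M ((i + j) % M)]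
    congr 2
    · simp
    · rw [Finset.sum_eq_single 0]
      · simp
      · intro j _ hj; simp [hj]
      · intro h; exact absurd (Finset.mem_range.2 (by omega)) h
  rw [Finset.sum_congr rfl fun i _ => h1 i, sum_hist_mul n a hM hMN, Finset.sum_add_distrib, coll]
  congr 1
  · rw [Finset.card_filter, triples, Finset.sum_product]
    refine Finset.sum_congr rfl fun i _ => ?_
    rw [Finset.sum_product]
    refine Finset.sum_congr rfl fun j _ => ?_
    rw [hist, Finset.card_filter]
    simp [eq_comm]
  · rw [← Finset.mul_sum, Finset.card_filter, pairs, Finset.sum_product]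
    congr 1
    refine Finset.sum_congr rfl fun i _ => ?_
    rw [hist, Finset.card_filter]
    simp [eq_comm]

/-- Count the collisions modulo `md`. -/
def countCom : Com := sizeCom ;; histCom ;; transformCom

theorem countCom_spec {n M L : ℕ} {a : ℕ → ℕ} {s : St} (ha : s.Input n a)
    (hM : s.reg .md = M) (h0 : 1 ≤ M) (hR : s.reg .rr = 2 * n ^ 3 + 1) (hn : 1 ≤ n)
    (hL : Nat.clog 2 M = L) (hRY : 2 * n ^ 3 + 2 * n + 1 < X.Y) (hY : 4 * (L + 1) * 3 ^ L < X.Y)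
    (hMY : 2 * M < X.Y) (haY : ∀ i < n, a i < X.Y) :
    wp X countCom (fun s' => s'.reg .phi = coll n a M ∧
      s'.time ≤ s.time + (1200 * (L + 1) * 3 ^ L + 40 * n + 300)) s := by
  have h3 : 1 ≤ 3 ^ L := Nat.one_le_pow _ _ (by omega)
  have h23 : 2 ^ L ≤ 3 ^ L := Nat.pow_le_pow_left (by omega) L
  have hL3 : 4 * 3 ^ L ≤ 4 * (L + 1) * 3 ^ L := Nat.mul_le_mul_right _ (by omega)
  have hML : M ≤ 2 ^ L := hL ▸ Nat.le_pow_clog one_lt_two M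
  have hn3 : 1 ≤ n ^ 3 := Nat.one_le_pow _ _ hn
  simp only [countCom, wp_seq]
  refine wp_use (sizeCom_spec hM h0 hMY) ?_
  rintro s1 ⟨p1, p2, t1⟩ f1
  rw [hL] at p1 p2
  rw [wp_seq]
  refine wp_use (histCom_spec (ha.frame f1 rfl rfl) (f1.reg hM rfl) h0 p1 hML (by omega)
    (by omega) haY) ?_
  rintro s2 ⟨q1, q2, q3, t2⟩ f2
  refine wp_mono ?_ (transformCom_spec (R := 2 * n ^ 3 + 1) (f2.reg (f1.reg hR rfl) rfl) (by omega)
    (by omega) (f2.reg p1 rfl) (f2.reg p2 rfl) hY)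
  rintro s3 ⟨r1, r2, t3⟩
  refine ⟨?_, ?_⟩
  · have e : triForm (2 ^ L) (fun t => (s2.arr .X t : ZMod (2 * n ^ 3 + 1)))
        (fun t => (s2.arr .B t : ZMod (2 * n ^ 3 + 1)))
        (fun t => (s2.arr .C t : ZMod (2 * n ^ 3 + 1))) =
        (coll n a M : ZMod (2 * n ^ 3 + 1)) := by
      rw [← sum_hist_eq_coll n a h0 hML, triForm]
      push_cast
      refine Finset.sum_congr rfl fun i hi => Finset.sum_congr rfl fun j hj => ?_
      rw [Finset.mem_range] at hi hj
      rw [q1 i hi, q2 j hj, q3 (i + j) (by omega)]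
      push_cast
      rfl
    -- Both numbers are below the modulus `2 * n ^ 3 + 1`, so their equality in `ZMod` is an
    -- equality of naturals.
    rw [e, ZMod.natCast_eq_natCast_iff', Nat.mod_eq_of_lt r1,
      Nat.mod_eq_of_lt (by have := coll_le n a M; omega)] at r2
    exact r2
  · have e6 : 1000 * (L + 1) * 3 ^ L = 1000 * (L * 3 ^ L) + 1000 * 3 ^ L := by ring
    have e7 : 1200 * (L + 1) * 3 ^ L = 1200 * (L * 3 ^ L) + 1200 * 3 ^ L := by ring
    omega

/-! ### Selecting the modulus -/

/-- Multiply `m` by the number `p ≤ b` for which the number of collisions is minimal. -/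
def selectStep : Com :=
  .best ::= v .rr ;; .bm ::= num 0 ;;
  .loop .p .b (.md ::= v .m * (v .p + num 1) ;; countCom ;;
    .ite (v .phi) (v .best) (.best ::= v .phi ;; .bm ::= v .md) .skip) ;;
  .m ::= v .bm

theorem selectStep_spec {n b m L : ℕ} {a : ℕ → ℕ} {s : St} (ha : s.Input n a)
    (hb : s.reg .b = b) (hm : s.reg .m = m) (h0 : 1 ≤ m) (hb0 : 1 ≤ b)
    (hR : s.reg .rr = 2 * n ^ 3 + 1) (hn : 1 ≤ n)
    (hL : Nat.clog 2 (m * b) ≤ L) (hRY : 2 * n ^ 3 + 2 * n + 1 < X.Y)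
    (hY : 4 * (L + 1) * 3 ^ L < X.Y) (hMY : 2 * (m * b) < X.Y) (haY : ∀ i < n, a i < X.Y) :
    wp X selectStep (fun s' => (∃ p, 1 ≤ p ∧ p ≤ b ∧ s'.reg .m = m * p) ∧
      (∀ p, 1 ≤ p → p ≤ b → coll n a (s'.reg .m) ≤ coll n a (m * p)) ∧
      s'.time ≤ s.time + (b * (1200 * (L + 1) * 3 ^ L + 40 * n + 350) + 20)) s := by
  simp only [selectStep, wp_seq, wp_assign]
  simp [hR]
  refine ⟨by omega, by omega, ?_⟩
  -- Initially `best` exceeds every possible count, so the first candidate is accepted; hence `bm`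
  -- is meaningful as soon as `1 ≤ k`.
  refine wp_loop_time (1200 * (L + 1) * 3 ^ L + 40 * n + 340) (fun k s' =>
    (k = 0 → s'.reg .best = 2 * n ^ 3 + 1) ∧
    (1 ≤ k → (∃ p, 1 ≤ p ∧ p ≤ b ∧ s'.reg .bm = m * p) ∧
      s'.reg .best = coll n a (s'.reg .bm)) ∧
    (∀ p, 1 ≤ p → p ≤ k → s'.reg .best ≤ coll n a (m * p))) rfl rfl
    (by simp; omega) ?_ ?_
  · rintro k hk s' hf hi ⟨i1, i2, i3⟩
    simp [hb] at hk
    have hR' : s'.reg .rr = 2 * n ^ 3 + 1 := hf.reg (by simpa using hR) rfl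
    have hm' : s'.reg .m = m := hf.reg (by simpa using hm) rfl
    have ha' : s'.Input n a := St.Input.frame (s := ((((s.set .best (2 * n ^ 3 + 1)).tick 2).set
      .bm 0).tick 2)) ha hf rfl rfl
    have hle : m * (k + 1) ≤ m * b := Nat.mul_le_mul_left _ hk
    have hpos : 1 ≤ m * (k + 1) := Nat.mul_pos h0 (by omega)
    have hcl : Nat.clog 2 (m * (k + 1)) ≤ L := (Nat.clog_mono_right 2 hle).trans hL
    have hT : (Nat.clog 2 (m * (k + 1)) + 1) * 3 ^ Nat.clog 2 (m * (k + 1)) ≤ (L + 1) * 3 ^ L :=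
      Nat.mul_le_mul (by omega) (Nat.pow_le_pow_right (by omega) hcl)
    simp only [wp_seq, wp_assign]
    simp only [Exp.eval_mul, Exp.eval_var, Exp.eval_add, Exp.eval_num, hi, hm']
    refine ⟨by omega, ?_⟩
    refine wp_use (countCom_spec (n := n) (a := a) (M := m * (k + 1)) ⟨ha'.1, ha'.2⟩ (by simp) hpos
      (by simpa using hR') hn rfl hRY (by nlinarith) (by omega) haY) ?_
    rintro s1 ⟨hphi, ht⟩ hf1
    have hbest : s1.reg .best = s'.reg .best := hf1.reg (by simp) rfl
    have hbm : s1.reg .bm = s'.reg .bm := hf1.reg (by simp) rfl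
    have hmd : s1.reg .md = m * (k + 1) := hf1.reg (by simp) rfl
    have hc := coll_le n a (m * (k + 1))
    have hT' : 1200 * (Nat.clog 2 (m * (k + 1)) + 1) * 3 ^ Nat.clog 2 (m * (k + 1)) ≤
      1200 * (L + 1) * 3 ^ L := by rw [Nat.mul_assoc, Nat.mul_assoc]; exact Nat.mul_le_mul_left _ hT
    simp at ht
    simp [hphi, hbest, hbm, hmd]
    refine ⟨fun hlt => ⟨by omega, by omega, by omega, ⟨k + 1, by omega, by omega, Or.inl rfl⟩,
      fun p hp hpk => ?_⟩, fun hle => ⟨by omega, ?_, ?_⟩⟩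
    · rcases Nat.lt_or_ge k p with h | h
      · rw [show p = k + 1 by omega]
      · exact hlt.le.trans (i3 p hp h)
    · have hk1 : 1 ≤ k := by
        by_contra h
        have := i1 (by omega)
        omega
      exact i2 hk1
    · intro p hp hpk
      rcases Nat.lt_or_ge k p with h | h
      · rw [show p = k + 1 by omega]; exact hle
      · exact i3 p hp h
  rintro s1 f1 ⟨i1, i2, i3⟩ t1
  simp [hb] at i1 i2 i3 t1
  obtain ⟨⟨p, hp1, hp2, hp3⟩, hbest⟩ := i2 hb0
  have hle : m * p ≤ m * b := Nat.mul_le_mul_left _ hp2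
  simp [hp3]
  refine ⟨by omega, ⟨p, hp1, hp2, Or.inl rfl⟩, fun q hq hqb => ?_, ?_⟩
  · rw [← hp3, ← hbest]; exact i3 q hq hqb
  · have e : b * (1200 * (L + 1) * 3 ^ L + 40 * n + 350) =
      b * (1200 * (L + 1) * 3 ^ L + 40 * n + 340) + 10 * b := by ring
    omega

/-- Iterating `falseColl_step` shrinks the number of false collisions by `(l / π) ^ k`, stated
without division. The divisibility is used later to split the final modulus as `m₁ * m₂`; the bound
variable `kv` is a parameter because the loop occurs twice. -/
theorem selectLoop_spec {kv : Var} (hkv : kv = .k1 ∨ kv = .k2) {n b m k l L : ℕ} {a : ℕ → ℕ}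
    {s : St} (ha : s.Input n a) (hb : s.reg .b = b) (hm : s.reg .m = m) (h0 : 1 ≤ m) (hb0 : 1 ≤ b)
    (hk : s.reg kv = k) (hR : s.reg .rr = 2 * n ^ 3 + 1) (hn : 1 ≤ n)
    (hL : Nat.clog 2 (m * b ^ k) ≤ L) (hRY : 2 * n ^ 3 + 2 * n + 1 < X.Y)
    (hY : 4 * (L + 1) * 3 ^ L < X.Y) (hMY : 2 * (m * b ^ k) < X.Y) (haY : ∀ i < n, a i < X.Y)
    (hl : ∀ i < n, 2 * a i < 2 ^ (l + 1)) :
    wp X (.loop .st kv selectStep) (fun s' => m ∣ s'.reg .m ∧ 1 ≤ s'.reg .m ∧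
      s'.reg .m ≤ m * b ^ k ∧
      falseColl n a (s'.reg .m) * ((Finset.range (b + 1)).filter Nat.Prime).card ^ k ≤
        l ^ k * falseColl n a m ∧
      s'.time ≤ s.time + (k * (b * (1200 * (L + 1) * 3 ^ L + 40 * n + 350) + 30) + 3)) s := by
  set π := ((Finset.range (b + 1)).filter Nat.Prime).card with hπ
  have hn1 : (Com.loop .st kv selectStep).wr kv = false := by
    rcases hkv with rfl | rfl <;> rfl
  refine wp_loop_time (b * (1200 * (L + 1) * 3 ^ L + 40 * n + 350) + 30) (fun j s' =>
    m ∣ s'.reg .m ∧ 1 ≤ s'.reg .m ∧ s'.reg .m ≤ m * b ^ j ∧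
      falseColl n a (s'.reg .m) * π ^ j ≤ l ^ j * falseColl n a m) rfl hn1
    (by simp [hm, h0]) ?_ ?_
  · rintro j hj s' hf hi ⟨i0, i1, i2, i3⟩
    have hR' : s'.reg .rr = 2 * n ^ 3 + 1 := hf.reg hR rfl
    have hb' : s'.reg .b = b := hf.reg hb rfl
    have ha' : s'.Input n a := ha.frame hf rfl rfl
    have hle : s'.reg .m * b ≤ m * b ^ k := by
      calc s'.reg .m * b ≤ m * b ^ j * b := Nat.mul_le_mul_right _ i2
        _ = m * b ^ (j + 1) := by ring
        _ ≤ m * b ^ k := Nat.mul_le_mul_left _ (Nat.pow_le_pow_right hb0 (by omega))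
    refine wp_mono ?_ (selectStep_spec ha' hb' rfl i1 hb0 hR' hn
      ((Nat.clog_mono_right 2 hle).trans hL) hRY hY (by omega) haY)
    rintro s1 ⟨⟨p, hp1, hp2, hp3⟩, hmin, ht⟩
    refine ⟨by omega, ?_⟩
    simp
    refine ⟨by rw [hp3]; exact i0.mul_right p, by rw [hp3]; exact Nat.mul_pos i1 hp1, ?_, ?_⟩
    · calc s1.reg .m = s'.reg .m * p := hp3
        _ ≤ m * b ^ j * b := Nat.mul_le_mul i2 hp2
        _ = m * b ^ (j + 1) := by ring
    · have h1 := falseColl_step n a (b := b) (m := s'.reg .m) hl hmin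
      calc falseColl n a (s1.reg .m) * π ^ (j + 1)
          = falseColl n a (s1.reg .m) * π * π ^ j := by ring
        _ ≤ l * falseColl n a (s'.reg .m) * π ^ j := Nat.mul_le_mul_right _ h1
        _ = l * (falseColl n a (s'.reg .m) * π ^ j) := by ring
        _ ≤ l * (l ^ j * falseColl n a m) := Nat.mul_le_mul_left _ i3
        _ = l ^ (j + 1) * falseColl n a m := by ring
  rintro s1 f1 ⟨i0, i1, i2, i3⟩ t1
  rw [hk] at i2 i3 t1
  simp
  exact ⟨i0, i1, i2, i3, by omega⟩

/-! ### The bound for all numbers -/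

/-- Compute `y = g ^ κ`, where `g` is the length of the input plus the maximum plus two. -/
def boundCom (κ : ℕ) : Com :=
  .mx ::= num 0 ;;
  .loop .i .n (.t ::= get .input .i ;; .ite (v .mx) (v .t) (.mx ::= v .t) .skip) ;;
  .g ::= v .n + v .mx + num 2 ;; .setc .cst κ ;; .y ::= num 1 ;;
  .loop .i .cst (.y ::= v .y * v .g)

/-- `U` is not part of the input, so the size of the memory regions is derived from the maximum of
the elements. Variables must stay below the region size, so only `g ^ κ` is computed here; the last
factor is supplied in machine register 2 by `twoPhase`. -/
theorem boundCom_spec {n κ B : ℕ} {a : ℕ → ℕ} {s : St} (ha : s.Input n a) (hB : ∀ i < n, a i ≤ B)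
    (hκ : κ < X.Y) (hY : (n + B + 2) ^ (κ + 1) ≤ X.Y) (hBY : n + B + 2 < X.Y) :
    wp X (boundCom κ) (fun s' => (∃ mx ≤ B, (∀ i < n, a i ≤ mx) ∧ s'.reg .g = n + mx + 2 ∧
      s'.reg .y = (n + mx + 2) ^ κ) ∧
      s'.time ≤ s.time + (30 * n + 20 * κ + 50)) s := by
  simp only [boundCom, wp_seq, wp_assign]
  simp
  refine ⟨by omega, ?_⟩
  refine wp_loop_time 30 (fun k s' => s'.reg .mx ≤ B ∧ ∀ i < k, a i ≤ s'.reg .mx) rfl rfl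
    (by simp) ?_ ?_
  · rintro k hk s' hf hi ⟨i1, i2⟩
    have ha' := St.Input.frame (s := (s.set .mx 0).tick 2) ha hf rfl rfl
    simp [ha.1] at hk
    have hak := ha'.2 k hk
    have hkB := hB k hk
    simp [hi, hak]
    refine ⟨by omega, fun hlt => ⟨by omega, hkB, fun i hik => ?_⟩, fun hle => ⟨i1, fun i hik => ?_⟩⟩
    · rcases Nat.lt_or_ge i k with h | h
      · exact (i2 i h).trans hlt.le
      · rw [show i = k by omega]
    · rcases Nat.lt_or_ge i k with h | h
      · exact i2 i h
      · rw [show i = k by omega]; exact hle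
  rintro s1 f1 ⟨i1, i2⟩ t1
  have hn1 : s1.reg .n = n := f1.reg (by simpa using ha.1) rfl
  simp [ha.1] at i2 t1
  simp [hn1]
  refine ⟨by omega, hκ, by omega, ?_⟩
  set mx := s1.reg .mx with hmx
  refine wp_loop_time 20 (fun k s' => s'.reg .y = (n + mx + 2) ^ k) rfl rfl (by simp) ?_ ?_
  · rintro k hk s' hf hi hy
    have hg : s'.reg .g = n + mx + 2 := hf.reg (by simp [hmx]) rfl
    simp at hk
    simp [hg, hy]
    refine ⟨?_, by rw [pow_succ]⟩
    rw [← pow_succ]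
    have h2 : 2 ≤ n + B + 2 := by omega
    calc (n + mx + 2) ^ (k + 1) ≤ (n + B + 2) ^ (k + 1) := Nat.pow_le_pow_left (by omega) _
      _ < (n + B + 2) ^ (κ + 1) := Nat.pow_lt_pow_right (by omega) (by omega)
      _ ≤ X.Y := hY
  rintro s2 f2 hy t2
  have hg : s2.reg .g = n + mx + 2 := f2.reg (by simp [hmx]) rfl
  simp at hy t2
  simp
  exact ⟨⟨mx, i1, i2, hg, hy⟩, by omega⟩

/-! ### The lookup table -/

/-- The table represents the set of the numbers `a i`, `i < n`. -/
def St.Table (s : St) (n : ℕ) (a : ℕ → ℕ) : Prop :=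
  ∀ x, (s.arr .table x ≤ 1) ∧ (0 < s.arr .table x ↔ ∃ i < n, a i = x)

theorem St.Table.frame {s s' : St} {n : ℕ} {a : ℕ → ℕ} (h : s.Table n a) {c : Com}
    (hf : c.Frame s s') (ha : c.wa .table = false) : s'.Table n a := by
  unfold St.Table
  rw [hf.arr _ ha]
  exact h

def tableCom : Com :=
  .loop .i .n (.t ::= get .input .i ;; .store .table .t (num 1))

theorem tableCom_spec {n : ℕ} {a : ℕ → ℕ} {s : St} (ha : s.Input n a) (h1 : 1 < X.Y)
    (h0 : ∀ x, s.arr .table x = 0) (haY : ∀ i < n, a i < X.Y) :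
    wp X tableCom (fun s' => s'.Table n a ∧ s'.time ≤ s.time + (20 * n + 3)) s := by
  refine wp_loop_time 20 (fun k s' => s'.Table k a) rfl rfl (by simp [St.Table, h0]) ?_ ?_
  · rintro k hk s' hf hi hT
    have ha' := ha.frame hf rfl rfl
    rw [ha.1] at hk
    simp [hi, ha'.2 k hk, haY k hk, h1]
    intro x
    obtain ⟨j1, j2⟩ := hT x
    simp
    by_cases hx : x = a k
    · subst hx
      simp
      exact ⟨k, by omega, rfl⟩
    · simp only [hx, if_false]
      refine ⟨j1, j2.trans ⟨fun ⟨i, hi, he⟩ => ⟨i, by omega, he⟩, fun ⟨i, hi, he⟩ => ⟨i, ?_, he⟩⟩⟩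
      rcases Nat.lt_or_ge i k with h | h
      · exact h
      · rw [show i = k by omega] at he; exact absurd he.symm hx
  · rintro s' hf hT ht
    rw [ha.1] at hT ht
    exact ⟨hT, by simp; omega⟩

/-! ### Integer roots -/

/-- Compute `b = ⌊n ^ (1 / D)⌋`. -/
def rootCom (D : ℕ) : Com :=
  .setc .dd D ;; .b ::= num 0 ;;
  .loop .i .n (.pw ::= num 1 ;; .loop .j .dd (.pw ::= v .pw * (v .i + num 1)) ;;
    .ite (v .pw) (v .n + num 1) (.b ::= v .i + num 1) .skip)

theorem rootCom_spec {n D : ℕ} {s : St} (hn : s.reg .n = n) (hD : 1 ≤ D) (hDY : D < X.Y)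
    (hY : n ^ D + n + 1 < X.Y) :
    wp X (rootCom D) (fun s' => s'.reg .b ^ D ≤ n ∧ n < (s'.reg .b + 1) ^ D ∧
      s'.time ≤ s.time + (n * (20 * D + 40) + 10)) s := by
  simp only [rootCom, wp_seq, wp_assign, wp_setc]
  simp
  refine ⟨hDY, by omega, ?_⟩
  -- The last conjunct says that `b + 1` has failed, unless `b` still equals the counter. If it does
  -- so at the end, then `b = n`, and `n < (n + 1) ^ D` is trivial.
  refine wp_loop_time (20 * D + 40) (fun k s' => s'.reg .b ^ D ≤ n ∧ s'.reg .b ≤ k ∧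
    (s'.reg .b < k → n < (s'.reg .b + 1) ^ D)) rfl rfl (by simp [show D ≠ 0 by omega]) ?_ ?_
  · rintro k hk s' hf hi ⟨i1, i2, i3⟩
    simp [hn] at hk
    have hn' : s'.reg .n = n := hf.reg (by simpa using hn) rfl
    have hD' : s'.reg .dd = D := hf.reg (by simp) rfl
    simp
    refine ⟨by omega, ?_⟩
    refine wp_loop_time 20 (fun j s' => s'.reg .pw = (k + 1) ^ j) rfl rfl (by simp) ?_ ?_
    · rintro j hj s1 hf1 hj' hpw
      have hi1 : s1.reg .i = k := hf1.reg (by simpa using hi) rfl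
      simp [hD'] at hj
      simp [hpw, hi1]
      rw [← pow_succ]
      refine ⟨?_, rfl⟩
      have h1 : (k + 1) ^ (j + 1) ≤ (k + 1) ^ D := Nat.pow_le_pow_right (by omega) (by omega)
      have h2 : (k + 1) ^ D ≤ n ^ D := Nat.pow_le_pow_left (by omega) D
      omega
    · rintro s1 hf1 hpw t1
      have hi1 : s1.reg .i = k := hf1.reg (by simpa using hi) rfl
      have hn1 : s1.reg .n = n := hf1.reg (by simpa using hn') rfl
      have hb1 : s1.reg .b = s'.reg .b := hf1.reg (by simp) rfl
      simp [hD'] at hpw t1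
      simp [hpw, hi1, hn1, hb1]
      refine ⟨fun hlt => ⟨by omega, by omega, by omega⟩, fun hlt => ⟨by omega, i1, by omega,
        fun hbk => ?_⟩⟩
      rcases Nat.lt_or_ge (s'.reg .b) k with h | h
      · exact i3 h
      · rw [show s'.reg .b = k by omega]; omega
  · rintro s1 f1 ⟨i1, i2, i3⟩ t1
    simp [hn] at i2 i3 t1
    simp
    refine ⟨i1, ?_, by omega⟩
    rcases Nat.lt_or_ge (s1.reg .b) n with h | h
    · exact i3 h
    · rw [show s1.reg .b = n by omega]
      exact (Nat.lt_succ_self n).trans_le (Nat.le_self_pow (by omega) _)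

/-! ### Brute force -/

/-- A solution of 3SUM for the sequence `a` of length `n`. -/
def Sum3 (n : ℕ) (a : ℕ → ℕ) : Prop := ∃ i < n, ∃ j < n, ∃ k < n, a i + a j = a k

def bruteCom : Com :=
  .loop .i .n (.loop .j .n (.t ::= get .input .i + get .input .j ;; .u ::= get .table .t ;;
    .ite (num 0) (v .u) (.ans ::= num 1) .skip))

theorem bruteCom_spec {n : ℕ} {a : ℕ → ℕ} {s : St} (ha : s.Input n a) (hT : s.Table n a)
    (h1 : 1 < X.Y) (h0 : s.reg .ans = 0) (haY : ∀ i < n, 2 * a i < X.Y) :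
    wp X bruteCom (fun s' => s'.reg .ans ≤ 1 ∧ (s'.reg .ans = 1 ↔ Sum3 n a) ∧
      s'.time ≤ s.time + (n * (40 * n + 20) + 10)) s := by
  refine wp_loop_time (40 * n + 20) (fun k s' => s'.reg .ans ≤ 1 ∧ (s'.reg .ans = 1 →
    Sum3 n a) ∧ ∀ i < k, ∀ j < n, ∀ l < n, a i + a j = a l → s'.reg .ans = 1) rfl rfl
    (by simp [h0]) ?_ ?_
  · rintro k hk s1 f1 hi ⟨i1, i2, i3⟩
    have a1 := ha.frame f1 rfl rfl
    have T1 := hT.frame f1 rfl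
    rw [ha.1] at hk
    refine wp_loop_time 40 (fun m s' => s'.reg .ans ≤ 1 ∧ (s'.reg .ans = 1 → Sum3 n a) ∧
      (s1.reg .ans = 1 → s'.reg .ans = 1) ∧
      ∀ j < m, ∀ l < n, a k + a j = a l → s'.reg .ans = 1) rfl rfl (by simp [i1]; exact i2) ?_ ?_
    · rintro m hm s2 f2 hj ⟨j1, j2, j3, j4⟩
      have a2 := a1.frame f2 rfl rfl
      have T2 := T1.frame f2 rfl
      have hi2 : s2.reg .i = k := f2.reg hi rfl
      rw [a1.1] at hm
      have hak := haY k hk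
      have ham := haY m hm
      obtain ⟨T3, T4⟩ := T2 (a k + a m)
      simp [hi2, hj, a2.2 k hk, a2.2 m hm]
      refine ⟨by omega, by omega, fun hpos => ⟨h1, ?_⟩, fun hz => ⟨j1, j2, j3, fun j hjm l hl he => ?_⟩⟩
      · obtain ⟨l, hl, he⟩ := T4.1 hpos
        exact ⟨k, hk, m, hm, l, hl, he.symm⟩
      · rcases Nat.lt_or_ge j m with h | h
        · exact j4 j h l hl he
        · rw [show j = m by omega] at he
          have := T4.2 ⟨l, hl, he.symm⟩
          omega
    · rintro s2 f2 ⟨j1, j2, j3, j4⟩ t2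
      rw [a1.1] at j4 t2
      simp
      refine ⟨by omega, j1, j2, fun i hik j hjn l hl he => ?_⟩
      rcases Nat.lt_or_ge i k with h | h
      · exact j3 (i3 i h j hjn l hl he)
      · rw [show i = k by omega] at he
        exact j4 j hjn l hl he
  · rintro s1 f1 ⟨i1, i2, i3⟩ t1
    rw [ha.1] at i3 t1
    simp
    exact ⟨i1, ⟨i2, fun ⟨i, hi, j, hj, l, hl, he⟩ => i3 i hi j hj l hl he⟩, by omega⟩

/-! ### Buckets -/

/-- The answer is Boolean, and if it is positive, then there is a solution. -/
def St.Ans (s : St) (n : ℕ) (a : ℕ → ℕ) : Prop :=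
  s.reg .ans ≤ 1 ∧ (s.reg .ans = 1 → Sum3 n a)

/-- Look for solutions that contain `x` as a summand or as the sum. -/
def detectCom : Com :=
  .loop .j .n (.t ::= v .x + get .input .j ;; .u ::= get .table .t ;;
    .ite (num 0) (v .u) (.ans ::= num 1) .skip ;;
    .t ::= v .x - get .input .j ;; .u ::= get .table .t ;;
    .ite (num 0) (v .u) (.ans ::= num 1) .skip)

theorem detectCom_spec {n k : ℕ} {a : ℕ → ℕ} {s : St} (ha : s.Input n a) (hT : s.Table n a)
    (h1 : 1 < X.Y) (hk : k < n) (hx : s.reg .x = a k) (hans : s.Ans n a)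
    (haY : ∀ i < n, 2 * a i < X.Y) (ha0 : ∀ i < n, 1 ≤ a i) :
    wp X detectCom (fun s' => s'.Ans n a ∧ (s.reg .ans = 1 → s'.reg .ans = 1) ∧
      (∀ j < n, ∀ l < n, (a k + a j = a l ∨ a j + a l = a k) → s'.reg .ans = 1) ∧
      s'.time ≤ s.time + (60 * n + 3)) s := by
  refine wp_loop_time 60 (fun m s' => s'.Ans n a ∧ (s.reg .ans = 1 → s'.reg .ans = 1) ∧
      (∀ j < m, ∀ l < n, (a k + a j = a l ∨ a j + a l = a k) → s'.reg .ans = 1)) rfl rfl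
      (by simpa [St.Ans] using hans) ?_ ?_
  · rintro m hm s1 f1 hj ⟨⟨i1, i2⟩, i3, i4⟩
    have a1 := ha.frame f1 rfl rfl
    have T1 := hT.frame f1 rfl
    rw [ha.1] at hm
    have hx1 : s1.reg .x = a k := f1.reg hx rfl
    have hak := haY k hk
    have ham := haY m hm
    have ham0 := ha0 m hm
    obtain ⟨T3, T4⟩ := T1 (a k + a m)
    obtain ⟨T5, T6⟩ := T1 (a k - a m)
    have key : ∀ j < m + 1, ∀ l < n, (a k + a j = a l ∨ a j + a l = a k) →
        s1.reg .ans = 1 ∨ 0 < s1.arr .table (a k + a m) ∨ 0 < s1.arr .table (a k - a m) := by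
      intro j hjm l hl he
      rcases Nat.lt_or_ge j m with h | h
      · exact Or.inl (i4 j h l hl he)
      · obtain rfl : j = m := by omega
        rcases he with he | he
        · exact Or.inr (Or.inl (T4.2 ⟨l, hl, he.symm⟩))
        · exact Or.inr (Or.inr (T6.2 ⟨l, hl, by omega⟩))
    have hs1 : 0 < s1.arr .table (a k + a m) → Sum3 n a := fun hpos => by
      obtain ⟨l, hl, he⟩ := T4.1 hpos
      exact ⟨k, hk, m, hm, l, hl, he.symm⟩
    have hs2 : 0 < s1.arr .table (a k - a m) → Sum3 n a := fun hpos => by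
      obtain ⟨l, hl, he⟩ := T6.1 hpos
      -- The difference `a k - a m` is truncated. Elements are positive, so a table entry at this
      -- place excludes the value 0 and certifies a genuine sum.
      have := ha0 l hl
      exact ⟨m, hm, l, hl, k, hk, by omega⟩
    simp [hj, hx1, a1.2 m hm, St.Ans]
    refine ⟨by omega, by omega, fun p1 => ⟨h1, by omega, by omega, fun p2 => ⟨h1, hs1 p1⟩,
      fun p2 => hs1 p1⟩, fun p1 => ⟨by omega, by omega, fun p2 => ⟨h1, hs2 p2⟩, fun p2 =>
      ⟨⟨i1, i2⟩, i3, fun j hjm l hl he => ?_⟩⟩⟩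
    have := key j (by omega) l hl he
    omega
  · rintro s1 f1 ⟨i1, i2, i3⟩ t1
    rw [ha.1] at i3 t1
    simp
    exact ⟨i1, i2, i3, by omega⟩

/-- An element is good if its bucket modulo `m₁` is small and its residue modulo `m` is unique. -/
def Good (n : ℕ) (a : ℕ → ℕ) (m₁ m sz i : ℕ) : Prop :=
  hist n a m₁ (a i % m₁) ≤ sz ∧ hist n a m (a i % m) ≤ 1

instance (n : ℕ) (a : ℕ → ℕ) (m₁ m sz : ℕ) : DecidablePred (Good n a m₁ m sz) :=
  fun _ => inferInstanceAs (Decidable (_ ∧ _))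

/-- The buckets contain the elements `a i` for the indices `i < k` with `G i`. -/
structure St.Buckets (s : St) (G : ℕ → Prop) (k : ℕ) (a : ℕ → ℕ) (m₁ sz : ℕ) : Prop where
  fill_le : ∀ x, s.arr .fill x ≤ sz
  mem : ∀ x, ∀ t < s.arr .fill x, ∃ i < k, G i ∧ a i % m₁ = x ∧ s.arr .bucket (x * sz + t) = a i
  exists_index : ∀ i < k, G i → ∃ t < s.arr .fill (a i % m₁),
    s.arr .bucket (a i % m₁ * sz + t) = a i
  inj : ∀ x, ∀ t < s.arr .fill x, ∀ t' < s.arr .fill x,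
    s.arr .bucket (x * sz + t) = s.arr .bucket (x * sz + t') → t = t'

theorem St.Buckets.congr {s s' : St} {G : ℕ → Prop} {k : ℕ} {a : ℕ → ℕ} {m₁ sz : ℕ}
    (h : s.Buckets G k a m₁ sz) (h1 : s'.arr .fill = s.arr .fill)
    (h2 : s'.arr .bucket = s.arr .bucket) : s'.Buckets G k a m₁ sz :=
  ⟨by rw [h1]; exact h.1, by rw [h1, h2]; exact h.2, by rw [h1, h2]; exact h.3,
    by rw [h1, h2]; exact h.4⟩

theorem St.Buckets.skip {s : St} {G : ℕ → Prop} {k : ℕ} {a : ℕ → ℕ} {m₁ sz : ℕ}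
    (h : s.Buckets G k a m₁ sz) (hk : ¬ G k) : s.Buckets G (k + 1) a m₁ sz := by
  refine ⟨h.1, fun x t ht => ?_, fun i hi hG => ?_, h.4⟩
  · obtain ⟨i, hi, h'⟩ := h.2 x t ht
    exact ⟨i, by omega, h'⟩
  · refine h.3 i ?_ hG
    rcases Nat.lt_succ_iff_lt_or_eq.1 hi with h | h
    · exact h
    · exact absurd (h ▸ hG) hk

theorem mul_add_inj {x t x' t' sz : ℕ} (ht : t < sz) (ht' : t' < sz)
    (h : x * sz + t = x' * sz + t') : x = x' ∧ t = t' := by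
  have h1 : (x * sz + t) / sz = x := by
    rw [Nat.mul_comm, Nat.mul_add_div (by omega), Nat.div_eq_of_lt ht, Nat.add_zero]
  have h2 : (x' * sz + t') / sz = x' := by
    rw [Nat.mul_comm, Nat.mul_add_div (by omega), Nat.div_eq_of_lt ht', Nat.add_zero]
  have h3 : x = x' := by rw [← h1, h, h2]
  subst h3
  exact ⟨rfl, by omega⟩

theorem St.Buckets.insert {s s' : St} {G : ℕ → Prop} {k : ℕ} {a : ℕ → ℕ} {m₁ sz : ℕ}
    (h : s.Buckets G k a m₁ sz) (hk : G k) (hlt : s.arr .fill (a k % m₁) < sz)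
    (hinj : ∀ i < k, a i ≠ a k)
    (h1 : ∀ i, s'.arr .fill i = if i = a k % m₁ then s.arr .fill i + 1 else s.arr .fill i)
    (h2 : ∀ i, s'.arr .bucket i =
      if i = a k % m₁ * sz + s.arr .fill (a k % m₁) then a k else s.arr .bucket i) :
    s'.Buckets G (k + 1) a m₁ sz := by
  have old : ∀ x t, t < s.arr .fill x → s'.arr .bucket (x * sz + t) = s.arr .bucket (x * sz + t) := by
    intro x t ht
    rw [h2, if_neg]
    intro he
    obtain ⟨rfl, h'⟩ := mul_add_inj (ht.trans_le (h.1 x)) hlt he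
    omega
  have new : s'.arr .bucket (a k % m₁ * sz + s.arr .fill (a k % m₁)) = a k := by rw [h2, if_pos rfl]
  have cases : ∀ x t, t < s'.arr .fill x → t < s.arr .fill x ∨
      (x = a k % m₁ ∧ t = s.arr .fill (a k % m₁)) := by
    intro x t ht
    rw [h1] at ht
    split_ifs at ht with hx
    · subst hx; omega
    · exact Or.inl ht
  have mono : ∀ x, s.arr .fill x ≤ s'.arr .fill x := by
    intro x; rw [h1]; split_ifs <;> omega
  have ne : ∀ x t, t < s.arr .fill x → s.arr .bucket (x * sz + t) ≠ a k := by
    intro x t ht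
    obtain ⟨i, hi, _, _, he⟩ := h.2 x t ht
    rw [he]; exact hinj i hi
  refine ⟨fun x => ?_, fun x t ht => ?_, fun i hi hG => ?_, fun x t ht t' ht' he => ?_⟩
  · rw [h1]
    split_ifs with hx
    · subst hx; omega
    · exact h.1 x
  · rcases cases x t ht with ht | ⟨rfl, rfl⟩
    · rw [old x t ht]
      obtain ⟨i, hi, h'⟩ := h.2 x t ht
      exact ⟨i, by omega, h'⟩
    · exact ⟨k, by omega, hk, rfl, new⟩
  · rcases Nat.lt_succ_iff_lt_or_eq.1 hi with h' | rfl
    · obtain ⟨t, ht, he⟩ := h.3 i h' hG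
      exact ⟨t, ht.trans_le (mono _), by rw [old _ _ ht, he]⟩
    · exact ⟨_, by rw [h1, if_pos rfl]; omega, new⟩
  · rcases cases x t ht with ht1 | ⟨h0, rfl⟩ <;> rcases cases x t' ht' with ht2 | ⟨h3, rfl⟩
    · rw [old _ _ ht1, old _ _ ht2] at he
      exact h.4 x t ht1 t' ht2 he
    · subst h3
      rw [old _ _ ht1, new] at he
      exact absurd he (ne _ _ ht1)
    · subst h0
      rw [old _ _ ht2, new] at he
      exact absurd he.symm (ne _ _ ht2)
    · rfl

/-- Fill the buckets with the good elements, and look for solutions that contain a bad one. -/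
def bucketCom : Com :=
  .loop .i .n (.x ::= get .input .i ;; .c1 ::= v .x % v .m1 ;;
    .store .cntB .c1 (get .cntB .c1 + num 1) ;; .c2 ::= v .x % v .m ;;
    .store .cntR .c2 (get .cntR .c2 + num 1)) ;;
  .loop .i .n (.x ::= get .input .i ;; .c1 ::= v .x % v .m1 ;; .c2 ::= v .x % v .m ;;
    .ite (v .s) (get .cntB .c1) detectCom
      (.ite (num 1) (get .cntR .c2) detectCom
        (.u ::= v .c1 * v .s + get .fill .c1 ;; .store .bucket .u (v .x) ;;
          .store .fill .c1 (get .fill .c1 + num 1))))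

theorem hist_mono {n n' : ℕ} (h : n ≤ n') (a : ℕ → ℕ) (M i : ℕ) : hist n a M i ≤ hist n' a M i :=
  Finset.card_le_card (Finset.filter_subset_filter _ (Finset.range_mono h))

theorem card_filter_range_succ (p : ℕ → Prop) [DecidablePred p] (k : ℕ) :
    ((Finset.range (k + 1)).filter p).card =
      ((Finset.range k).filter p).card + if p k then 1 else 0 := by
  rw [Finset.range_add_one, Finset.filter_insert]
  split_ifs
  · rw [Finset.card_insert_of_notMem (by simp)]
  · rfl

/-- A solution with a bad element is found when that element is treated, as a summand (the two
summands being symmetric) or as the sum. Only bad elements cost linear time, which is why their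
number enters the time bound. -/
theorem bucketCom_spec {n m₁ m sz : ℕ} {a : ℕ → ℕ} {s : St} (ha : s.Input n a) (hT : s.Table n a)
    (hm1 : s.reg .m1 = m₁) (hm : s.reg .m = m) (hs : s.reg .s = sz) (hans : s.reg .ans = 0)
    (hB : ∀ x, s.arr .cntB x = 0) (hR : ∀ x, s.arr .cntR x = 0) (hF : ∀ x, s.arr .fill x = 0)
    (h1 : 1 ≤ m₁) (hn : n + 1 < X.Y) (hY : m₁ * sz + sz < X.Y)
    (haY : ∀ i < n, 2 * a i < X.Y) (ha0 : ∀ i < n, 1 ≤ a i)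
    (hinj : ∀ i < n, ∀ j < n, a i = a j → i = j) :
    wp X bucketCom (fun s' => s'.Ans n a ∧ s'.Buckets (Good n a m₁ m sz) n a m₁ sz ∧
      (∀ i < n, ∀ j < n, ∀ l < n, a i + a j = a l → ¬ (Good n a m₁ m sz i ∧ Good n a m₁ m sz j ∧
        Good n a m₁ m sz l) → s'.reg .ans = 1) ∧
      s'.time ≤ s.time + (110 * n + 20 +
        ((Finset.range n).filter fun i => ¬ Good n a m₁ m sz i).card * (60 * n + 50))) s := by
  simp only [bucketCom, wp_seq]
  refine wp_loop_time 40 (fun k s' => ∀ x, s'.arr .cntB x = hist k a m₁ x ∧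
    s'.arr .cntR x = hist k a m x) rfl rfl (by simp [hist, hB, hR]) ?_ ?_
  · rintro k hk s1 f1 hi i1
    have a1 := ha.frame f1 rfl rfl
    rw [ha.1] at hk
    have e1 : s1.reg .m1 = m₁ := f1.reg hm1 rfl
    have e2 : s1.reg .m = m := f1.reg hm rfl
    have b1 := hist_le k a m₁ (a k % m₁)
    have b2 := hist_le k a m (a k % m)
    have := haY k hk
    have c1 := Nat.mod_le (a k) m₁
    have c2 := Nat.mod_le (a k) m
    simp [hi, a1.2 k hk, e1, e2, (i1 _).1, (i1 _).2]
    refine ⟨by omega, by omega, by omega, by omega, by omega, fun x => ⟨?_, ?_⟩⟩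
    · rw [hist_succ]
      by_cases h : x = a k % m₁
      · simp [h]
      · simp [h, Ne.symm h]
    · rw [hist_succ]
      by_cases h : x = a k % m
      · simp [h]
      · simp [h, Ne.symm h]
  rintro s1 f1 i1 t1
  rw [ha.1] at i1 t1
  have a1 := ha.frame f1 rfl rfl
  have T1 := hT.frame f1 rfl
  have e1 : s1.reg .m1 = m₁ := f1.reg hm1 rfl
  have e2 : s1.reg .m = m := f1.reg hm rfl
  have e3 : s1.reg .s = sz := f1.reg hs rfl
  have e4 : s1.reg .ans = 0 := f1.reg hans rfl
  have e5 := f1.arr .fill rfl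
  -- The iterations differ in cost, so the clock belongs to the invariant. Bounding `fill` by the
  -- histogram of the first `k` elements guarantees a free place for every good element.
  refine wp_loop (fun k s' => s'.Ans n a ∧ s'.Buckets (Good n a m₁ m sz) k a m₁ sz ∧
    (∀ i, s'.arr .fill i ≤ hist k a m₁ i) ∧
    (∀ i < k, ¬ Good n a m₁ m sz i → ∀ j < n, ∀ l < n, (a i + a j = a l ∨ a j + a l = a i) →
      s'.reg .ans = 1) ∧ s'.time ≤ s1.time + (70 * k + 3 +
        ((Finset.range k).filter fun i => ¬ Good n a m₁ m sz i).card * (60 * n + 50))) rfl rfl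
    ?_ ?_ ?_
  · refine ⟨by simp [St.Ans, e4], ⟨?_, ?_, ?_, ?_⟩, ?_, ?_, ?_⟩ <;> simp [e5, hF]
  · rintro k hk s2 f2 hi ⟨i2, i3, i4, i5, i6⟩
    have a2 := St.Input.frame (s := s1.tick 2) a1 f2 rfl rfl
    have T2 := St.Table.frame (s := s1.tick 2) T1 f2 rfl
    simp [a1.1] at hk
    have e1 : s2.reg .m1 = m₁ := f2.reg (by simpa using e1) rfl
    have e2 : s2.reg .m = m := f2.reg (by simpa using e2) rfl
    have e3 : s2.reg .s = sz := f2.reg (by simpa using e3) rfl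
    have g1 : s2.arr .cntB = s1.arr .cntB := f2.arr .cntB rfl
    have g2 : s2.arr .cntR = s1.arr .cntR := f2.arr .cntR rfl
    have := haY k hk
    have c1 := Nat.mod_le (a k) m₁
    have c2 := Nat.mod_le (a k) m
    have hcard := card_filter_range_succ (fun i => ¬ Good n a m₁ m sz i) k
    have hbad : ∀ s3 : St, s3.reg .x = a k → s3.Input n a → s3.Table n a → s3.Ans n a →
        s3.arr .fill = s2.arr .fill → s3.arr .bucket = s2.arr .bucket →
        s3.reg .ans = s2.reg .ans → ¬ Good n a m₁ m sz k → s3.time ≤ s2.time + 40 →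
        wp X detectCom (fun s4 => ((s4.set .i (k + 1)).tick 4).Ans n a ∧
          ((s4.set .i (k + 1)).tick 4).Buckets (Good n a m₁ m sz) (k + 1) a m₁ sz ∧
          (∀ i, s4.arr .fill i ≤ hist (k + 1) a m₁ i) ∧
          (∀ i ≤ k, ¬ Good n a m₁ m sz i → ∀ j < n, ∀ l < n,
            (a i + a j = a l ∨ a j + a l = a i) → s4.reg .ans = 1) ∧
          s4.time + 4 ≤ s1.time + (70 * (k + 1) + 3 +
            ((Finset.range (k + 1)).filter fun i => ¬ Good n a m₁ m sz i).card *
              (60 * n + 50))) s3 := by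
      intro s3 q1 q2 q3 q4 q5 q6 q7 q8 q9
      refine wp_use (detectCom_spec q2 q3 (by omega) hk q1 q4 haY ha0) ?_
      rintro s4 ⟨r1, r2, r3, r4⟩ f4
      have r5 := f4.arr .fill rfl
      have r6 := f4.arr .bucket rfl
      refine ⟨r1, (i3.congr ?_ ?_).skip q8, fun i => ?_, fun i hi hG j hj l hl he => ?_, ?_⟩
      · simp [r5, q5]
      · simp [r6, q6]
      · rw [r5, q5]
        exact (i4 i).trans (hist_mono (by omega) a m₁ i)
      · rcases hi.lt_or_eq with h | rfl
        · exact r2 (q7.trans (i5 i h hG j hj l hl he))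
        · exact r3 j hj l hl he
      · rw [if_pos q8] at hcard
        rw [hcard, Nat.add_mul]
        omega
    simp [hi, a2.2 k hk, e1, e2, e3, g1, g2, (i1 _).1, (i1 _).2]
    refine ⟨by omega, by omega, by omega, fun hlt => ?_, fun hlt => ⟨fun hlt2 => ?_, fun hlt2 => ?_⟩⟩
    · refine hbad _ ?_ ⟨a2.1, a2.2⟩ T2 i2 ?_ ?_ ?_ (fun hG => absurd hG.1 (by omega)) ?_ <;> simp
    · refine hbad _ ?_ ⟨a2.1, a2.2⟩ T2 i2 ?_ ?_ ?_ (fun hG => absurd hG.2 (by omega)) ?_ <;> simp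
    · have hG : Good n a m₁ m sz k := ⟨by omega, by omega⟩
      have h5 := hist_succ k a m₁ (a k % m₁)
      have h6 := hist_mono (show k + 1 ≤ n by omega) a m₁ (a k % m₁)
      have h7 := i4 (a k % m₁)
      rw [if_pos rfl] at h5
      have hlt' : s2.arr .fill (a k % m₁) < sz := by omega
      have h8 : a k % m₁ * sz + sz ≤ m₁ * sz := by
        rw [← Nat.succ_mul]; exact Nat.mul_le_mul_right _ (Nat.mod_lt _ h1)
      simp only [hG, not_true_eq_false, if_false, Nat.add_zero] at hcard
      refine ⟨by omega, by omega, by omega, ⟨by simpa using i2.1, by simpa using i2.2⟩,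
        i3.insert hG hlt' (fun i hik he => ?_) (fun i => ?_) (fun i => ?_), fun i => ?_,
        fun i hi hb j hj l hl he => ?_, ?_⟩
      · exact hik.ne (hinj i (by omega) k hk he)
      · by_cases h : i = a k % m₁ <;> simp [h]
      · simp
      · rw [hist_succ]
        by_cases h : i = a k % m₁
        · subst h; simp; omega
        · simp [h]; have := i4 i; omega
      · rcases Nat.lt_or_ge i k with h | h
        · exact i5 i h hb j hj l hl he
        · rw [show i = k by omega] at hb; exact absurd hG hb
      · rw [hcard]
        omega
  · rintro s2 f2 ⟨i2, i3, i4, i5, i6⟩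
    simp only [St.tick_reg, a1.1] at i3 i4 i5 i6
    simp
    refine ⟨i2, i3.congr rfl rfl, fun i hi j hj l hl he hG => ?_, ?_⟩
    · by_cases g1 : Good n a m₁ m sz i
      · by_cases g2 : Good n a m₁ m sz j
        · exact i5 l hl (fun g3 => hG g1 g2 g3) i hi j hj (Or.inr he)
        · exact i5 j hj g2 i hi l hl (Or.inl (by omega))
      · exact i5 i hi g1 j hj l hl (Or.inl he)
    · omega

/-! ### The instances for the oracle -/

/-- The number at position `t` of the instance that asks for `qa i + e + qb j = qc k` modulo `M`,
where `i < cx`, `j < cy`, `k < cz`. -/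
def instVal (L M e cx cy cz : ℕ) (qa qb qc : ℕ → ℕ) (t : ℕ) : ℕ :=
  if t < cx then L + qa t + e
  else if t - cx < cy then 3 * L + qb (t - cx)
  else if t - cx - cy < 2 * cz then
    4 * L + qc ((t - cx - cy) / 2) + M * ((t - cx - cy) % 2)
  else 16 * L + t

section inst

variable {L M e cx cy cz : ℕ} {qa qb qc : ℕ → ℕ}

theorem instVal_cases (ha : ∀ t < cx, qa t < M) (hb : ∀ t < cy, qb t < M)
    (hc : ∀ t < cz, qc t < M) (t : ℕ) :
    (t < cx ∧ instVal L M e cx cy cz qa qb qc t = L + qa t + e ∧ qa t < M) ∨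
    (cx ≤ t ∧ t - cx < cy ∧ instVal L M e cx cy cz qa qb qc t = 3 * L + qb (t - cx) ∧
      qb (t - cx) < M) ∨
    (∃ k < cz, ∃ r < 2, t = cx + cy + 2 * k + r ∧
      instVal L M e cx cy cz qa qb qc t = 4 * L + qc k + M * r ∧ qc k < M) ∨
    (cx + cy + 2 * cz ≤ t ∧ instVal L M e cx cy cz qa qb qc t = 16 * L + t) := by
  unfold instVal
  split_ifs with h1 h2 h3
  · exact Or.inl ⟨h1, rfl, ha t h1⟩
  · exact Or.inr (Or.inl ⟨by omega, h2, rfl, hb _ h2⟩)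
  · refine Or.inr (Or.inr (Or.inl ⟨(t - cx - cy) / 2, by omega, (t - cx - cy) % 2, by omega,
      by omega, rfl, hc _ (by omega)⟩))
  · exact Or.inr (Or.inr (Or.inr ⟨by omega, rfl⟩))

theorem instVal_range (hM : 1 ≤ M) (he : e ≤ 1) (ha : ∀ t < cx, qa t < M) (hb : ∀ t < cy, qb t < M)
    (hc : ∀ t < cz, qc t < M) {N : ℕ} (hL : N + 4 * M + 4 ≤ L) {t : ℕ} (ht : t < N) :
    1 ≤ instVal L M e cx cy cz qa qb qc t ∧ instVal L M e cx cy cz qa qb qc t ≤ 17 * L := by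
  rcases instVal_cases (L := L) ha hb hc t with
    ⟨_, h, _⟩ | ⟨_, _, h, _⟩ | ⟨k, _, r, hr, _, h, _⟩ | ⟨_, h⟩ <;> rw [h]
  · omega
  · omega
  · obtain rfl | rfl : r = 0 ∨ r = 1 := by omega
    · omega
    · omega
  · omega

/-- The four groups of values lie in disjoint intervals that start at `L`, `3 * L`, `4 * L` and `16
* L`. The oracle takes a set, so values must also differ within a group; the two copies in the third
group are disjoint because `qc k < M`. -/
theorem instVal_inj (hM : 1 ≤ M) (he : e ≤ 1) (ha : ∀ t < cx, qa t < M) (hb : ∀ t < cy, qb t < M)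
    (hc : ∀ t < cz, qc t < M) {N : ℕ} (hL : N + 4 * M + 4 ≤ L)
    (ia : ∀ t < cx, ∀ t' < cx, qa t = qa t' → t = t')
    (ib : ∀ t < cy, ∀ t' < cy, qb t = qb t' → t = t')
    (ic : ∀ t < cz, ∀ t' < cz, qc t = qc t' → t = t') {t t' : ℕ} (ht : t < N) (ht' : t' < N)
    (h : instVal L M e cx cy cz qa qb qc t = instVal L M e cx cy cz qa qb qc t') : t = t' := by
  rcases instVal_cases (L := L) ha hb hc t with
    ⟨g, h1, _⟩ | ⟨g, g', h1, _⟩ | ⟨k, hk, r, hr, g, h1, _⟩ | ⟨_, h1⟩ <;>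
  rcases instVal_cases (L := L) ha hb hc t' with
    ⟨f, h2, _⟩ | ⟨f, f', h2, _⟩ | ⟨k', hk', r', hr', f, h2, _⟩ | ⟨_, h2⟩ <;> rw [h1, h2] at h
  · exact ia t g t' f (by omega)
  · omega
  · omega
  · omega
  · omega
  · have := ib _ g' _ f' (by omega); omega
  · omega
  · omega
  · have : M * r ≤ M * 1 := Nat.mul_le_mul_left _ (by omega)
    omega
  · have : M * r ≤ M * 1 := Nat.mul_le_mul_left _ (by omega)
    omega
  · obtain rfl | rfl : r = 0 ∨ r = 1 := by omega
    · obtain rfl | rfl : r' = 0 ∨ r' = 1 := by omega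
      · have := ic k hk k' hk' (by omega); omega
      · omega
    · obtain rfl | rfl : r' = 0 ∨ r' = 1 := by omega
      · omega
      · have := ic k hk k' hk' (by omega); omega
  · have : M * r ≤ M * 1 := Nat.mul_le_mul_left _ (by omega)
    omega
  · omega
  · omega
  · have : M * r' ≤ M * 1 := Nat.mul_le_mul_left _ (by omega)
    omega
  · omega

/-- Among the multiples 1, 3, 4, 16 of `L`, the only sum of two that is again among them is 1 + 3 =
4, and the gaps exceed the perturbations. So the filler entries, which bring the size to exactly
`N`, occur in no solution. Both copies `qc k` and `qc k + M` are needed, because `qa i + e + qb j`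
can exceed `M` once. -/
theorem instVal_sum (hM : 1 ≤ M) (he : e ≤ 1) (ha : ∀ t < cx, qa t < M) (hb : ∀ t < cy, qb t < M)
    (hc : ∀ t < cz, qc t < M) {N : ℕ} (hL : N + 4 * M + 4 ≤ L) (hN : cx + cy + 2 * cz ≤ N) :
    (∃ i < N, ∃ j < N, ∃ k < N, instVal L M e cx cy cz qa qb qc i +
      instVal L M e cx cy cz qa qb qc j = instVal L M e cx cy cz qa qb qc k) ↔
    ∃ i < cx, ∃ j < cy, ∃ k < cz, qa i + e + qb j = qc k ∨ qa i + e + qb j = qc k + M := by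
  constructor
  · rintro ⟨i, hi, j, hj, k, hk, h⟩
    have hr : ∀ r < 2, M * r = 0 ∧ r = 0 ∨ M * r = M ∧ r = 1 := by
      intro r hr
      obtain rfl | rfl : r = 0 ∨ r = 1 := by omega
      · simp
      · simp
    rcases instVal_cases (L := L) ha hb hc i with
      ⟨g1, h1, _⟩ | ⟨_, g1, h1, _⟩ | ⟨k1, g1, r1, hr1, _, h1, _⟩ | ⟨_, h1⟩ <;>
    rcases instVal_cases (L := L) ha hb hc j with
      ⟨g2, h2, _⟩ | ⟨_, g2, h2, _⟩ | ⟨k2, g2, r2, hr2, _, h2, _⟩ | ⟨_, h2⟩ <;>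
    rcases instVal_cases (L := L) ha hb hc k with
      ⟨g3, h3, _⟩ | ⟨_, g3, h3, _⟩ | ⟨k3, g3, r3, hr3, _, h3, _⟩ | ⟨_, h3⟩ <;>
    rw [h1, h2, h3] at h <;>
    first
      | omega
      | (have := hr r3 hr3; first
          | omega
          | exact ⟨i, g1, _, g2, k3, g3, by omega⟩
          | exact ⟨j, g2, _, g1, k3, g3, by omega⟩)
      | (have := hr r1 hr1; omega)
      | (have := hr r2 hr2; omega)
      | (have := hr r1 hr1; have := hr r2 hr2; omega)
  · rintro ⟨i, hi, j, hj, k, hk, h⟩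
    have hv : ∀ r < 2, instVal L M e cx cy cz qa qb qc (cx + cy + 2 * k + r) =
        4 * L + qc k + M * r := by
      intro r hr
      unfold instVal
      rw [if_neg (by omega), if_neg (by omega), if_pos (by omega),
        show (cx + cy + 2 * k + r - cx - cy) / 2 = k by omega,
        show (cx + cy + 2 * k + r - cx - cy) % 2 = r by omega]
    have hi' : instVal L M e cx cy cz qa qb qc i = L + qa i + e := by
      unfold instVal
      rw [if_pos hi]
    have hj' : instVal L M e cx cy cz qa qb qc (cx + j) = 3 * L + qb j := by
      unfold instVal
      rw [if_neg (by omega), if_pos (by omega), show cx + j - cx = j by omega]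
    rcases h with h | h
    · refine ⟨i, by omega, cx + j, by omega, cx + cy + 2 * k + 0, by omega, ?_⟩
      rw [hi', hj', hv 0 (by omega)]
      omega
    · refine ⟨i, by omega, cx + j, by omega, cx + cy + 2 * k + 1, by omega, ?_⟩
      rw [hi', hj', hv 1 (by omega)]
      omega

end inst

/-! ### Solving the instances for all pairs of buckets -/

theorem Good.eq {n : ℕ} {a : ℕ → ℕ} {m₁ m sz i j : ℕ} (hi : Good n a m₁ m sz i) (hin : i < n)
    (hjn : j < n) (h : a i % m = a j % m) : i = j := by
  by_contra hij
  have h1 : ({i, j} : Finset ℕ) ⊆ (Finset.range n).filter fun k => a k % m = a i % m := by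
    intro k hk
    simp only [Finset.mem_insert, Finset.mem_singleton] at hk
    rw [Finset.mem_filter, Finset.mem_range]
    rcases hk with rfl | rfl
    · exact ⟨hin, rfl⟩
    · exact ⟨hjn, h.symm⟩
  have h2 := Finset.card_le_card h1
  rw [Finset.card_pair hij] at h2
  have h3 := hi.2
  unfold hist at h3
  omega

/-- What stays unchanged while the pairs of buckets are treated. -/
structure St.Env (s : St) (n : ℕ) (a : ℕ → ℕ) (m₁ m₂ sz N L : ℕ) : Prop where
  input : s.Input n a
  table : s.Table n a
  buckets : s.Buckets (Good n a m₁ (m₁ * m₂) sz) n a m₁ sz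
  m1 : s.reg .m1 = m₁
  m2 : s.reg .m2 = m₂
  m : s.reg .m = m₁ * m₂
  sz : s.reg .s = sz
  nn : s.reg .nn = N
  el : s.reg .el = L

def Com.keepsEnv (c : Com) : Bool :=
  !([.n, .m1, .m2, .m, .s, .nn, .el].any c.wr || [.input, .table, .fill, .bucket].any c.wa)

section env

variable {n : ℕ} {a : ℕ → ℕ} {m₁ m₂ sz N L : ℕ} {s s' : St}

theorem St.Env.congr (h : s.Env n a m₁ m₂ sz N L)
    (hr : ∀ x ∈ [.n, .m1, .m2, .m, .s, .nn, .el], s'.reg x = s.reg x)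
    (ha : ∀ x ∈ [.input, .table, .fill, .bucket], s'.arr x = s.arr x) :
    s'.Env n a m₁ m₂ sz N L := by
  simp only [List.mem_cons, List.not_mem_nil, or_false, forall_eq_or_imp, forall_eq] at hr ha
  obtain ⟨r1, r2, r3, r4, r5, r6, r7⟩ := hr
  obtain ⟨a1, a2, a3, a4⟩ := ha
  refine ⟨⟨by rw [r1, h.input.1], by rw [a1]; exact h.input.2⟩, ?_, h.buckets.congr a3 a4,
    by rw [r2, h.m1], by rw [r3, h.m2], by rw [r4, h.m], by rw [r5, h.sz], by rw [r6, h.nn],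
    by rw [r7, h.el]⟩
  unfold St.Table
  rw [a2]
  exact h.table

theorem St.Env.frame (h : s.Env n a m₁ m₂ sz N L) {c : Com} (hf : c.Frame s s')
    (hc : c.keepsEnv = true) : s'.Env n a m₁ m₂ sz N L := by
  simp only [Com.keepsEnv, Bool.not_eq_true', Bool.or_eq_false_iff, List.any_eq_false,
    Bool.not_eq_true] at hc
  exact h.congr (fun x hx => hf.1 x (hc.1 x hx)) fun x hx => hf.arr x (hc.2 x hx)

/-- The higher part of the residue of the element at position `t` of the bucket `x`. -/
def St.quot (s : St) (m₁ m sz x t : ℕ) : ℕ :=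
  s.arr .bucket (x * sz + t) % m / m₁

theorem St.Env.bucket_lt (h : s.Env n a m₁ m₂ sz N L) {Y : ℕ} (haY : ∀ i < n, a i < Y) {x t : ℕ}
    (ht : t < s.arr .fill x) : s.arr .bucket (x * sz + t) < Y := by
  obtain ⟨i, hi, _, _, he⟩ := h.buckets.mem x t ht
  rw [he]; exact haY i hi

theorem St.Env.quot_lt (hm : 1 ≤ m₁ * m₂) (x t : ℕ) : s.quot m₁ (m₁ * m₂) sz x t < m₂ :=
  Nat.div_lt_of_lt_mul (Nat.mod_lt _ hm)

theorem mod_mul_eq {u v m₁ m₂ : ℕ} (h1 : u % m₁ = v % m₁)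
    (h2 : u % (m₁ * m₂) / m₁ = v % (m₁ * m₂) / m₁) : u % (m₁ * m₂) = v % (m₁ * m₂) := by
  rw [← Nat.div_add_mod (u % (m₁ * m₂)) m₁, ← Nat.div_add_mod (v % (m₁ * m₂)) m₁, h2,
    Nat.mod_mul_right_mod, Nat.mod_mul_right_mod, h1]

/-- Elements of one bucket agree modulo `m₁`. If their quotients agree too, then they agree modulo
`m₁ * m₂`, and residues of good elements are unique. This makes the instance for the oracle a set.
-/
theorem St.Env.quot_inj (h : s.Env n a m₁ m₂ sz N L) {x t t' : ℕ} (ht : t < s.arr .fill x)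
    (ht' : t' < s.arr .fill x)
    (he : s.quot m₁ (m₁ * m₂) sz x t = s.quot m₁ (m₁ * m₂) sz x t') : t = t' := by
  obtain ⟨i, hi, g1, h1, e1⟩ := h.buckets.mem x t ht
  obtain ⟨j, hj, g2, h2, e2⟩ := h.buckets.mem x t' ht'
  unfold St.quot at he
  rw [e1, e2] at he
  have := g1.eq hi hj (mod_mul_eq (h1.trans h2.symm) he)
  subst this
  exact h.buckets.inj x t ht t' ht' (e1.trans e2.symm)

/-- The equation that the oracle is asked about is a congruence. -/
theorem sum_mod_iff {u v w m₁ m₂ : ℕ} (h1 : 1 ≤ m₁) (h2 : 1 ≤ m₂)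
    (hw : w % m₁ = (u % m₁ + v % m₁) % m₁) :
    (u % (m₁ * m₂) / m₁ + (u % m₁ + v % m₁) / m₁ + v % (m₁ * m₂) / m₁ = w % (m₁ * m₂) / m₁ ∨
      u % (m₁ * m₂) / m₁ + (u % m₁ + v % m₁) / m₁ + v % (m₁ * m₂) / m₁ =
        w % (m₁ * m₂) / m₁ + m₂) ↔ (u + v) % (m₁ * m₂) = w % (m₁ * m₂) := by
  have eu := Nat.div_add_mod (u % (m₁ * m₂)) m₁
  have ev := Nat.div_add_mod (v % (m₁ * m₂)) m₁
  have ew := Nat.div_add_mod (w % (m₁ * m₂)) m₁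
  rw [Nat.mod_mul_right_mod] at eu ev ew
  have lu : u % (m₁ * m₂) / m₁ < m₂ := Nat.div_lt_of_lt_mul (Nat.mod_lt _ (Nat.mul_pos h1 h2))
  have lv : v % (m₁ * m₂) / m₁ < m₂ := Nat.div_lt_of_lt_mul (Nat.mod_lt _ (Nat.mul_pos h1 h2))
  have lw : w % (m₁ * m₂) / m₁ < m₂ := Nat.div_lt_of_lt_mul (Nat.mod_lt _ (Nat.mul_pos h1 h2))
  have ee := Nat.div_add_mod (u % m₁ + v % m₁) m₁
  rw [← hw] at ee
  have le : (u % m₁ + v % m₁) / m₁ < 2 := Nat.div_lt_of_lt_mul (by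
    have := Nat.mod_lt u h1; have := Nat.mod_lt v h1; omega)
  rw [Nat.add_mod]
  generalize u % (m₁ * m₂) / m₁ = qu at *
  generalize v % (m₁ * m₂) / m₁ = qv at *
  generalize w % (m₁ * m₂) / m₁ = qw at *
  generalize (u % m₁ + v % m₁) / m₁ = e at *
  rw [← eu, ← ev, ← ew]
  -- Addition in mixed radix: the lower digits add up to the digit `w % m₁` with the carry `e`,
  -- which joins the higher digits.
  have e1 : m₁ * qu + u % m₁ + (m₁ * qv + v % m₁) = w % m₁ + m₁ * (qu + e + qv) := by
    rw [Nat.mul_add, Nat.mul_add]; omega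
  have e2 : ∀ q, (w % m₁ + m₁ * q) / m₁ = q := fun q => by
    rw [Nat.add_mul_div_left _ _ h1, Nat.div_eq_of_lt (Nat.mod_lt _ h1), Nat.zero_add]
  have e3 : ∀ q, (w % m₁ + m₁ * q) % m₁ = w % m₁ := fun q => by simp
  have e4 : ∀ q, (w % m₁ + m₁ * q) % (m₁ * m₂) = w % m₁ + m₁ * (q % m₂) := fun q => by
    rw [Nat.mod_mul, e2, e3]
  rw [e1, Nat.add_comm (m₁ * qw), e4]
  rw [Nat.add_left_cancel_iff, Nat.mul_right_inj (by omega)]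
  rcases Nat.lt_or_ge (qu + e + qv) m₂ with h | h
  · rw [Nat.mod_eq_of_lt h]; omega
  · rw [Nat.mod_eq_sub_mod h, Nat.mod_eq_of_lt (by omega)]; omega

end env

/-- Write the instance for the buckets `x` and `yy` to the array `id`. -/
def instCom : Com :=
  .loop .t .nn (
    .ite (v .t) (v .cx) (.u ::= v .x * v .s + v .t ;; .u ::= get .bucket .u ;;
      .val ::= v .el + (v .u % v .m) / v .m1 + v .e)
    (.t2 ::= v .t - v .cx ;;
    .ite (v .t2) (v .cy) (.u ::= v .yy * v .s + v .t2 ;; .u ::= get .bucket .u ;;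
      .val ::= num 3 * v .el + (v .u % v .m) / v .m1)
    (.t2 ::= v .t2 - v .cy ;;
    .ite (v .t2) (num 2 * v .cz) (.u ::= v .t2 / num 2 ;; .u ::= v .z * v .s + v .u ;;
      .u ::= get .bucket .u ;;
      .val ::= num 4 * v .el + (v .u % v .m) / v .m1 + v .m2 * (v .t2 % num 2))
    (.val ::= num 16 * v .el + v .t))) ;;
    .storeDyn .id .t (v .val))

/-- The array number `d` will be the number of the pair of buckets, so each instance gets a region
that has never been used. By `h0` the cells beyond the instance are zero without being cleared. -/
theorem instCom_spec {n m₁ m₂ sz N L x y z d : ℕ} {a : ℕ → ℕ} {s : St}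
    (hs : s.Env n a m₁ m₂ sz N L) (hx : s.reg .x = x) (hy : s.reg .yy = y) (hz : s.reg .z = z)
    (hd : s.reg .id = d) (he : s.reg .e ≤ 1) (hcx : s.reg .cx = s.arr .fill x)
    (hcy : s.reg .cy = s.arr .fill y) (hcz : s.reg .cz = s.arr .fill z)
    (hxm : x < m₁) (hym : y < m₁) (hzm : z < m₁) (hm2 : 1 ≤ m₂)
    (h0 : ∀ d' ≥ d, ∀ i, s.dyn d' i = 0) (hY : m₁ * sz + sz < X.Y) (haY : ∀ i < n, a i < X.Y)
    (hL : N + 4 * m₂ + 4 ≤ L) (hLY : 17 * L < X.Y) :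
    wp X instCom (fun s' => (∀ i, s'.dyn d i = if i < N then instVal L m₂ (s.reg .e)
        (s.arr .fill x) (s.arr .fill y) (s.arr .fill z) (s.quot m₁ (m₁ * m₂) sz x)
        (s.quot m₁ (m₁ * m₂) sz y) (s.quot m₁ (m₁ * m₂) sz z) i else 0) ∧
      (∀ d' > d, ∀ i, s'.dyn d' i = 0) ∧ s'.time ≤ s.time + (80 * N + 3)) s := by
  refine wp_loop_time 80 (fun k s' => (∀ i, s'.dyn d i = if i < k then instVal L m₂ (s.reg .e)
        (s.arr .fill x) (s.arr .fill y) (s.arr .fill z) (s.quot m₁ (m₁ * m₂) sz x)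
        (s.quot m₁ (m₁ * m₂) sz y) (s.quot m₁ (m₁ * m₂) sz z) i else 0) ∧
      (∀ d' > d, ∀ i, s'.dyn d' i = 0)) rfl rfl ?_ ?_ ?_
  · simp
    exact ⟨h0 d le_rfl, fun d' hd' => h0 d' hd'.le⟩
  · rintro k hk s1 f1 ht ⟨i1, i2⟩
    rw [hs.nn] at hk
    have E1 := hs.frame f1 rfl
    have x1 : s1.reg .x = x := f1.reg hx rfl
    have y1 : s1.reg .yy = y := f1.reg hy rfl
    have z1 : s1.reg .z = z := f1.reg hz rfl
    have d1 : s1.reg .id = d := f1.reg hd rfl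
    have e1 : s1.reg .e = s.reg .e := f1.reg rfl rfl
    have cx1 : s1.reg .cx = s.arr .fill x := f1.reg hcx rfl
    have cy1 : s1.reg .cy = s.arr .fill y := f1.reg hcy rfl
    have cz1 : s1.reg .cz = s.arr .fill z := f1.reg hcz rfl
    have b1 := f1.arr .bucket rfl
    have hb : ∀ w < m₁, ∀ t < s.arr .fill w, w * sz + t < X.Y := by
      intro w hw t ht
      have := hs.buckets.fill_le w
      have := Nat.mul_le_mul_right sz hw.le
      omega
    have hq : ∀ w t, s.arr .bucket (w * sz + t) % (m₁ * m₂) / m₁ < m₂ := fun w t =>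
      St.Env.quot_lt (s := s) (sz := sz) (Nat.mul_pos (by omega) hm2) w t
    have hkey : ∀ s2 : St, s2.dyn = s1.dyn → s2.reg .t = k → s2.reg .id = d →
        s2.time ≤ s1.time + 60 →
        s2.reg .val = instVal L m₂ (s.reg .e) (s.arr .fill x) (s.arr .fill y) (s.arr .fill z)
          (s.quot m₁ (m₁ * m₂) sz x) (s.quot m₁ (m₁ * m₂) sz y) (s.quot m₁ (m₁ * m₂) sz z) k →
        s2.reg .val < X.Y → wp X (.storeDyn .id .t (v .val)) (fun s'' => s''.time + 4 ≤
          s1.time + 80 ∧ (∀ i, ((s''.set .t (k + 1)).tick 4).dyn d i = if i < k + 1 then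
          instVal L m₂ (s.reg .e)
          (s.arr .fill x) (s.arr .fill y) (s.arr .fill z) (s.quot m₁ (m₁ * m₂) sz x)
          (s.quot m₁ (m₁ * m₂) sz y) (s.quot m₁ (m₁ * m₂) sz z) i else 0) ∧
          (∀ d' > d, ∀ i, ((s''.set .t (k + 1)).tick 4).dyn d' i = 0)) s2 := by
      intro s2 q1 q2 q3 q4 q5 q6
      simp only [wp_storeDyn, Exp.eval_var, q2, q3]
      refine ⟨q6, by simp; omega, fun i => ?_, fun d' hd' i => ?_⟩
      · simp only [St.tick_dyn, St.set_dyn, St.setDyn_dyn, if_true, q1, i1, q5]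
        by_cases h : i = k
        · simp [h]
        · simp only [h, if_false]
          by_cases h2 : i < k
          · rw [if_pos h2, if_pos (by omega)]
          · rw [if_neg h2, if_neg (by omega)]
      · simp only [St.tick_dyn, St.set_dyn, St.setDyn_dyn, q1, i2 d' hd']
        rw [if_neg (by omega)]
    have hN := hs.nn
    simp only [wp_seq, wp_ite, wp_assign]
    simp only [Exp.eval_var, Exp.eval_add, Exp.eval_sub, Exp.eval_mul, Exp.eval_div, Exp.eval_mod,
      Exp.eval_get, Exp.eval_num, St.tick_reg, St.set_reg, St.tick_arr, St.set_arr, ht, cx1, cy1,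
      cz1, x1, y1, z1, e1, E1.sz, E1.m, E1.m1, E1.m2, E1.el, b1, if_true, if_false,
      reduceCtorEq]
    refine ⟨fun g1 => ?_, fun g1 => ⟨?_, fun g2 => ?_, fun g2 => ⟨?_, fun g3 => ?_, fun g3 => ?_⟩⟩⟩
    · have := hq x k
      refine ⟨hb x hxm k g1, hs.bucket_lt haY g1, by omega, hkey _ rfl ?_ ?_ ?_ ?_ ?_⟩
      · simpa using ht
      · simpa using d1
      · simp
      · simp [instVal, g1, St.quot]
      · simp; omega
    · omega
    · have := hq y (k - s.arr .fill x)
      refine ⟨hb y hym _ g2, hs.bucket_lt haY g2, by omega, hkey _ rfl ?_ ?_ ?_ ?_ ?_⟩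
      · simpa using ht
      · simpa using d1
      · simp
      · simp [instVal, g1, g2, St.quot]
      · simp; omega
    · omega
    · have := hq z ((k - s.arr .fill x - s.arr .fill y) / 2)
      have h5 : m₂ * ((k - s.arr .fill x - s.arr .fill y) % 2) ≤ m₂ * 1 :=
        Nat.mul_le_mul_left _ (by omega)
      refine ⟨by omega, hb z hzm _ (by omega), hs.bucket_lt haY (by omega), by omega,
        hkey _ rfl ?_ ?_ ?_ ?_ ?_⟩
      · simpa using ht
      · simpa using d1
      · simp
      · simp only [instVal, g1, g2, g3, if_false, if_true, St.quot]
        simp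
      · simp; omega
    · refine ⟨by omega, hkey _ rfl ?_ ?_ ?_ ?_ ?_⟩
      · simpa using ht
      · simpa using d1
      · simp
      · simp only [instVal, g1, g2, g3, if_false]
        simp
      · simp; omega
  · rintro s1 f1 ⟨i1, i2⟩ t1
    rw [hs.nn] at i1 t1
    simp
    exact ⟨i1, i2, by omega⟩

/-- Look for solutions whose summands are in the buckets `x` and `yy`. -/
def pairBruteCom : Com :=
  .loop .i .cx (.u ::= v .x * v .s + v .i ;; .c1 ::= get .bucket .u ;;
    .loop .j .cy (.u ::= v .yy * v .s + v .j ;; .u ::= get .bucket .u ;; .t ::= v .c1 + v .u ;;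
      .u ::= get .table .t ;; .ite (num 0) (v .u) (.ans ::= num 1) .skip))

theorem pairBruteCom_spec {n m₁ m₂ sz N L x y : ℕ} {a : ℕ → ℕ} {s : St}
    (hs : s.Env n a m₁ m₂ sz N L) (hx : s.reg .x = x) (hy : s.reg .yy = y)
    (hcx : s.reg .cx = s.arr .fill x) (hcy : s.reg .cy = s.arr .fill y) (hans : s.Ans n a)
    (hxm : x < m₁) (hym : y < m₁) (h1 : 1 < X.Y)
    (hY : m₁ * sz + sz < X.Y) (haY : ∀ i < n, 2 * a i < X.Y) :
    wp X pairBruteCom (fun s' => s'.Ans n a ∧ (s.reg .ans = 1 → s'.reg .ans = 1) ∧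
      (∀ i < s.arr .fill x, ∀ j < s.arr .fill y, ∀ l < n,
        s.arr .bucket (x * sz + i) + s.arr .bucket (y * sz + j) = a l → s'.reg .ans = 1) ∧
      s'.time ≤ s.time + (sz * (40 * sz + 30) + 3)) s := by
  have hb : ∀ w < m₁, ∀ t < s.arr .fill w, w * sz + t < X.Y := by
    intro w hw t ht
    have := hs.buckets.fill_le w
    have := Nat.mul_le_mul_right sz hw.le
    omega
  have fx := hs.buckets.fill_le x
  have fy := hs.buckets.fill_le y
  have haY' : ∀ i < n, a i < X.Y := fun i hi => by have := haY i hi; omega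
  refine wp_loop_time (40 * sz + 30) (fun k s' => s'.Ans n a ∧ (s.reg .ans = 1 → s'.reg .ans = 1) ∧
      (∀ i < k, ∀ j < s.arr .fill y, ∀ l < n,
        s.arr .bucket (x * sz + i) + s.arr .bucket (y * sz + j) = a l → s'.reg .ans = 1)) rfl rfl
      (by simpa [St.Ans] using hans) ?_ ?_
  · rintro k hk s1 f1 hi ⟨i1, i2, i3⟩
    rw [hcx] at hk
    have E1 := hs.frame f1 rfl
    have x1 : s1.reg .x = x := f1.reg hx rfl
    have y1 : s1.reg .yy = y := f1.reg hy rfl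
    have cy1 : s1.reg .cy = s.arr .fill y := f1.reg hcy rfl
    have b1 := f1.arr .bucket rfl
    obtain ⟨ix, hix, _, _, hex⟩ := hs.buckets.mem x k hk
    simp [x1, hi, E1.sz, b1]
    refine ⟨hb x hxm k hk, by rw [hex]; exact haY' ix hix, ?_⟩
    refine wp_loop_time 40 (fun m s' => s'.Ans n a ∧ (s1.reg .ans = 1 → s'.reg .ans = 1) ∧
      (∀ j < m, ∀ l < n,
        s.arr .bucket (x * sz + k) + s.arr .bucket (y * sz + j) = a l → s'.reg .ans = 1)) rfl rfl
      (by simpa [St.Ans] using i1) ?_ ?_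
    · rintro m hm s2 f2 hj ⟨⟨j0, j1⟩, j2, j3⟩
      simp [cy1] at hm
      have E2 := St.Env.frame (s := ((((s1.set .u (x * sz + k)).tick 6).set .c1
        (s.arr .bucket (x * sz + k))).tick 5)) (E1.congr (by simp) (by simp)) f2 rfl
      have y2 : s2.reg .yy = y := f2.reg (by simpa using y1) rfl
      have c2 : s2.reg .c1 = s.arr .bucket (x * sz + k) := f2.reg (by simp) rfl
      have b2 : s2.arr .bucket = s.arr .bucket := (f2.arr .bucket rfl).trans b1
      obtain ⟨iy, hiy, _, _, hey⟩ := hs.buckets.mem y m hm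
      have := haY ix hix
      have := haY iy hiy
      obtain ⟨T3, T4⟩ := E2.table (a ix + a iy)
      simp [y2, hj, E2.sz, b2, c2, hex, hey]
      refine ⟨hb y hym m hm, by omega, by omega, by omega, fun hpos => ⟨by omega, by simp, ?_⟩,
        fun hz => ⟨⟨j0, j1⟩, j2, fun j hjm l hl he => ?_⟩⟩
      · obtain ⟨l, hl, he⟩ := T4.1 hpos
        exact fun _ => ⟨ix, hix, iy, hiy, l, hl, he.symm⟩
      · rcases Nat.lt_or_ge j m with h | h
        · exact j3 j h l hl (by rw [hex]; exact he)
        · rw [show j = m by omega, hey] at he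
          have := T4.2 ⟨l, hl, he.symm⟩
          omega
    · rintro s2 f2 ⟨j1, j2, j3⟩ t2
      simp [cy1] at j3 t2
      simp
      refine ⟨by omega, j1, fun h => j2 (i2 h), fun i hik j hj l hl he => ?_⟩
      rcases Nat.lt_or_ge i k with h | h
      · exact j2 (i3 i h j hj l hl he)
      · rw [show i = k by omega] at he
        exact j3 j hj l hl he
  · rintro s1 f1 ⟨i1, i2, i3⟩ t1
    rw [hcx] at i3 t1
    have := Nat.mul_le_mul_right (40 * sz + 30) fx
    simp
    exact ⟨i1, i2, i3, by omega⟩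

/-- Ask the oracle about all pairs of buckets, and check its positive answers. -/
def pairCom : Com :=
  .r2 ::= v .m1 * v .m1 ;;
  .loop .id .r2 (.x ::= v .id / v .m1 ;; .yy ::= v .id % v .m1 ;;
    .z ::= (v .x + v .yy) % v .m1 ;; .e ::= (v .x + v .yy) / v .m1 ;;
    .cx ::= get .fill .x ;; .cy ::= get .fill .yy ;; .cz ::= get .fill .z ;;
    instCom ;; .oracle .res .id .nn ;;
    .ite (num 0) (v .res) (.ite (v .ans) (num 1) pairBruteCom .skip) .skip)

/-- The pairs of buckets that contain a solution modulo `m` that is not a solution. -/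
def falseIds (n : ℕ) (a : ℕ → ℕ) (m₁ m : ℕ) : Finset ℕ :=
  (falseTriples n a m).image fun t => a t.1 % m₁ * m₁ + a t.2.1 % m₁

/-- The residues `x` and `y` of the summands modulo `m₁` determine both the carry and the bucket `(x
+ y) % m₁` of the sum. `sum_mod_iff` then turns the equation of quotients into a congruence modulo
`m₁ * m₂`. Goodness enters because the buckets contain exactly the good elements. -/
theorem oracle_answer_iff {n m₁ m₂ sz N L x y : ℕ} {a : ℕ → ℕ} {s : St}
    (hs : s.Env n a m₁ m₂ sz N L) (h1 : 1 ≤ m₁) (h2 : 1 ≤ m₂) :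
    (∃ i < s.arr .fill x, ∃ j < s.arr .fill y, ∃ k < s.arr .fill ((x + y) % m₁),
      s.quot m₁ (m₁ * m₂) sz x i + (x + y) / m₁ + s.quot m₁ (m₁ * m₂) sz y j =
        s.quot m₁ (m₁ * m₂) sz ((x + y) % m₁) k ∨
      s.quot m₁ (m₁ * m₂) sz x i + (x + y) / m₁ + s.quot m₁ (m₁ * m₂) sz y j =
        s.quot m₁ (m₁ * m₂) sz ((x + y) % m₁) k + m₂) ↔
    ∃ i < n, ∃ j < n, ∃ k < n, (Good n a m₁ (m₁ * m₂) sz i ∧ Good n a m₁ (m₁ * m₂) sz j ∧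
      Good n a m₁ (m₁ * m₂) sz k) ∧ a i % m₁ = x ∧ a j % m₁ = y ∧
      (a i + a j) % (m₁ * m₂) = a k % (m₁ * m₂) := by
  constructor
  · rintro ⟨i, hi, j, hj, k, hk, h⟩
    obtain ⟨i', hi', gi, ri, ei⟩ := hs.buckets.mem x i hi
    obtain ⟨j', hj', gj, rj, ej⟩ := hs.buckets.mem y j hj
    obtain ⟨k', hk', gk, rk, ek⟩ := hs.buckets.mem _ k hk
    refine ⟨i', hi', j', hj', k', hk', ⟨gi, gj, gk⟩, ri, rj, ?_⟩
    unfold St.quot at h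
    rw [ei, ej, ek] at h
    subst ri rj
    exact (sum_mod_iff h1 h2 rk).1 h
  · rintro ⟨i', hi', j', hj', k', hk', ⟨gi, gj, gk⟩, rfl, rfl, h⟩
    have rk : a k' % m₁ = (a i' % m₁ + a j' % m₁) % m₁ := by
      rw [← Nat.mod_mul_right_mod (a k') m₁ m₂, ← h, Nat.mod_mul_right_mod, Nat.add_mod]
    obtain ⟨i, hi, ei⟩ := hs.buckets.exists_index i' hi' gi
    obtain ⟨j, hj, ej⟩ := hs.buckets.exists_index j' hj' gj
    obtain ⟨k, hk, ek⟩ := hs.buckets.exists_index k' hk' gk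
    rw [rk] at hk ek
    refine ⟨i, hi, j, hj, k, hk, ?_⟩
    unfold St.quot
    rw [ei, ej, ek]
    exact (sum_mod_iff h1 h2 rk).2 h

/-- Solutions with a bad element are already known by `hbad`. Every other solution also holds modulo
`m₁ * m₂`, so the oracle accepts its pair of buckets. A check that fails exhibits a false triple in
its pair of buckets, and one that succeeds sets `ans`, after which no more checks are made; this is
the `+ 1` in the time bound. -/
theorem pairCom_spec {n m₁ m₂ sz N L : ℕ} {a : ℕ → ℕ} {s : St}
    (hs : s.Env n a m₁ m₂ sz N L) (hans : s.Ans n a) (h0 : ∀ d i, s.dyn d i = 0)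
    (hbad : ∀ i < n, ∀ j < n, ∀ l < n, a i + a j = a l → ¬ (Good n a m₁ (m₁ * m₂) sz i ∧
      Good n a m₁ (m₁ * m₂) sz j ∧ Good n a m₁ (m₁ * m₂) sz l) → s.reg .ans = 1)
    (h1 : 1 ≤ m₁) (h2 : 1 ≤ m₂) (hN : 2 ≤ N) (hNs : 4 * sz ≤ N) (hL : N + 4 * m₂ + 4 ≤ L)
    (hLN : 17 * L ≤ N ^ 3) (hLY : 17 * L < X.Y) (hw : 2 ^ wordLength X.κ N (N ^ 3) ≤ X.Y)
    (hmY : m₁ * m₁ + 2 * m₁ < X.Y) (hY : m₁ * sz + sz < X.Y) (haY : ∀ i < n, 2 * a i < X.Y) :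
    wp X pairCom (fun s' => s'.reg .ans ≤ 1 ∧ (s'.reg .ans = 1 ↔ Sum3 n a) ∧
      s'.time ≤ s.time + (m₁ * m₁ * (80 * N + oracleCost X.O (X.T N) + 100) +
        ((falseTriples n a (m₁ * m₂)).card + 1) * (sz * (40 * sz + 30) + 3) + 20)) s := by
  have haY' : ∀ i < n, a i < X.Y := fun i hi => by have := haY i hi; omega
  set F := falseIds n a m₁ (m₁ * m₂) with hF
  set Kp := 80 * N + oracleCost X.O (X.T N) + 100 with hKp
  set Kb := sz * (40 * sz + 30) + 3 with hKb
  simp only [pairCom, wp_seq, wp_assign]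
  simp only [Exp.eval_mul, Exp.eval_var, hs.m1]
  refine ⟨by omega, ?_⟩
  -- In the time bound, the filtered cardinality pays for the failed checks and `ans * Kb` for the
  -- successful one. The regions from `k` on are still zero.
  refine wp_loop (fun k s' => s'.Ans n a ∧ (s.reg .ans = 1 → s'.reg .ans = 1) ∧
    (∀ d ≥ k, ∀ i, s'.dyn d i = 0) ∧
    (∀ i < n, ∀ j < n, ∀ l < n, a i + a j = a l → a i % m₁ * m₁ + a j % m₁ < k →
      s'.reg .ans = 1) ∧
    s'.time ≤ s.time + (k * Kp + 10 + ((Finset.range k).filter (· ∈ F)).card * Kb +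
      s'.reg .ans * Kb)) rfl rfl ?_ ?_ ?_
  · simp only [St.tick_reg, St.set_reg, St.tick_dyn, St.set_dyn, St.tick_time, St.set_time]
    refine ⟨by simpa [St.Ans] using hans, by simp, fun d _ => h0 d, by simp, ?_⟩
    simp
    omega
  · rintro k hk s1 f1 hid ⟨i1, i2, i3, i4, i5⟩
    simp at hk
    have E1 := St.Env.frame (s := ((s.set .r2 (m₁ * m₁)).tick _))
      (hs.congr (by simp) (by simp)) f1 rfl
    have hxm : k / m₁ < m₁ := Nat.div_lt_of_lt_mul hk
    have hym : k % m₁ < m₁ := Nat.mod_lt _ h1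
    have hzm : (k / m₁ + k % m₁) % m₁ < m₁ := Nat.mod_lt _ h1
    have he : (k / m₁ + k % m₁) / m₁ ≤ 1 :=
      Nat.lt_succ_iff.1 (Nat.div_lt_of_lt_mul (by omega))
    have hfY : ∀ x, s1.arr .fill x < X.Y := fun x => by
      have := E1.buckets.fill_le x
      have := Nat.mul_le_mul_right sz h1
      omega
    have hk' : k / m₁ * m₁ + k % m₁ = k := Nat.div_add_mod' k m₁
    have hkF : ((Finset.range (k + 1)).filter (· ∈ F)).card * Kb =
        ((Finset.range k).filter (· ∈ F)).card * Kb + if k ∈ F then Kb else 0 := by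
      rw [card_filter_range_succ, Nat.add_mul]
      split_ifs <;> simp
    simp only [wp_seq, wp_assign]
    simp only [Exp.eval_var, Exp.eval_add, Exp.eval_div, Exp.eval_mod, Exp.eval_get, St.tick_reg,
      St.set_reg, St.tick_arr, St.set_arr, hid, E1.m1, if_true, if_false, reduceCtorEq]
    refine ⟨by omega, by omega, by omega, by omega, hfY _, hfY _, hfY _, ?_⟩
    generalize hx : k / m₁ = x at *
    generalize hy : k % m₁ = y at *
    refine wp_use (instCom_spec (x := x) (y := y) (z := (x + y) % m₁) (d := k)
      (E1.congr (by simp) (by simp)) (by simp) (by simp) (by simp) (by simpa using hid)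
      (by simpa using he) (by simp) (by simp) (by simp) hxm hym hzm h2 (by simpa using i3) hY haY'
      hL hLY) ?_
    rintro s2 ⟨j1, j2, j3⟩ f2
    have id2 : s2.reg .id = k := f2.reg (by simpa using hid) rfl
    have nn2 : s2.reg .nn = N := f2.reg (by simpa using E1.nn) rfl
    have ans2 : s2.reg .ans = s1.reg .ans := f2.reg (by simp) rfl
    have x2 : s2.reg .x = x := f2.reg (by simp) rfl
    have y2 : s2.reg .yy = y := f2.reg (by simp) rfl
    have fill2 : s2.arr .fill = s1.arr .fill := f2.arr .fill rfl
    have bucket2 : s2.arr .bucket = s1.arr .bucket := f2.arr .bucket rfl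
    have cx2 : s2.reg .cx = s1.arr .fill x := f2.reg (by simp) rfl
    have cy2 : s2.reg .cy = s1.arr .fill y := f2.reg (by simp) rfl
    have E2 : s2.Env n a m₁ m₂ sz N L :=
      St.Env.frame (E1.congr (by simp) (by simp)) f2 rfl
    simp only [St.tick_reg, St.set_reg, St.tick_arr, St.set_arr, if_true, if_false, reduceCtorEq] at j1
    set f := instVal L m₂ ((x + y) / m₁) (s1.arr .fill x) (s1.arr .fill y)
      (s1.arr .fill ((x + y) % m₁)) (s1.quot m₁ (m₁ * m₂) sz x)
      (s1.quot m₁ (m₁ * m₂) sz y) (s1.quot m₁ (m₁ * m₂) sz ((x + y) % m₁)) with hf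
    have j1' : ∀ i, s2.dyn k i = if i < N then f i else 0 := j1
    have q1 : ∀ x t, t < s1.arr .fill x → s1.quot m₁ (m₁ * m₂) sz x t < m₂ := fun x t _ =>
      St.Env.quot_lt (Nat.mul_pos h1 h2) x t
    have b1 := E1.buckets.fill_le x
    have b2 := E1.buckets.fill_le y
    have b3 := E1.buckets.fill_le ((x + y) % m₁)
    have hsum := (instVal_sum (cx := s1.arr .fill x) h2 he (q1 x) (q1 y) (q1 ((x + y) % m₁)) hL
      (by omega)).trans (oracle_answer_iff E1 h1 h2)
    rw [← hf] at hsum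
    refine ⟨by omega, by rw [nn2]; exact hw, ?_, ?_, ?_, ?_⟩
    · rw [nn2, id2]
      intro i hi j hj h
      rw [j1', j1', if_pos hi, if_pos hj] at h
      exact instVal_inj h2 he (q1 x) (q1 y) (q1 _) hL (fun _ h _ h' => E1.quot_inj h h')
        (fun _ h _ h' => E1.quot_inj h h') (fun _ h _ h' => E1.quot_inj h h') hi hj h
    · rw [nn2, id2]
      intro i hi
      rw [j1', if_pos hi]
      have := instVal_range (cx := s1.arr .fill x) h2 he (q1 x) (q1 y) (q1 ((x + y) % m₁)) hL hi
      exact ⟨this.1, this.2.trans hLN⟩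
    · rw [nn2, id2]
      intro i hi
      rw [j1', if_neg (by omega)]
    intro g r hr hriff t ht
    rw [nn2, id2] at hriff
    rw [nn2] at ht
    have hriff' : r = 1 ↔ ∃ i < N, ∃ j < N, ∃ l < N, f i + f j = f l := by
      rw [hriff]
      constructor
      · rintro ⟨i, hi, j, hj, l, hl, h⟩
        rw [j1', j1', j1', if_pos hi, if_pos hj, if_pos hl] at h
        exact ⟨i, hi, j, hj, l, hl, h⟩
      · rintro ⟨i, hi, j, hj, l, hl, h⟩
        refine ⟨i, hi, j, hj, l, hl, ?_⟩
        rw [j1', j1', j1', if_pos hi, if_pos hj, if_pos hl]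
        exact h
    rw [hsum] at hriff'
    clear hriff hsum
    have hyes : ∀ i < n, ∀ j < n, ∀ l < n, a i + a j = a l → a i % m₁ * m₁ + a j % m₁ < k + 1 →
        s1.reg .ans = 1 ∨ (r = 1 ∧ a i % m₁ = x ∧ a j % m₁ = y ∧
          Good n a m₁ (m₁ * m₂) sz i ∧ Good n a m₁ (m₁ * m₂) sz j) := by
      intro i hi j hj l hl h hlt
      by_cases hG : Good n a m₁ (m₁ * m₂) sz i ∧ Good n a m₁ (m₁ * m₂) sz j ∧
        Good n a m₁ (m₁ * m₂) sz l
      · rcases Nat.lt_succ_iff_lt_or_eq.1 hlt with h' | h'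
        · exact Or.inl (i4 i hi j hj l hl h h')
        · obtain ⟨e1, e2⟩ := mul_add_inj (Nat.mod_lt _ h1) hym (h'.trans hk'.symm)
          exact Or.inr ⟨hriff'.2 ⟨i, hi, j, hj, l, hl, hG, e1, e2, by rw [h]⟩, e1, e2, hG.1,
            hG.2.1⟩
      · exact Or.inl (i2 (hbad i hi j hj l hl h hG))
    have hdyn : ∀ d ≥ k + 1, ∀ i, (s2.setRegion k g).dyn d i = 0 := by
      intro d hd i
      simp only [St.setRegion_dyn]
      rw [if_neg (by omega)]
      exact j2 d (by omega) i
    simp at j3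
    have hr01 : r = 0 ∨ r = 1 := by omega
    rcases hr01 with rfl | rfl
    · simp only [wp_ite, wp_skip]
      simp [id2, ans2]
      refine ⟨by simpa [St.Ans, ans2] using i1, i2, fun d hd i => by simpa using hdyn d hd i,
        fun i hi j hj l hl h hlt => ?_, ?_⟩
      · rcases hyes i hi j hj l hl h (by omega) with h | h
        · exact h
        · exact absurd h.1 (by omega)
      · rw [hkF, Nat.add_mul]
        split_ifs <;> omega
    simp only [wp_ite, wp_skip]
    simp [id2, ans2]
    refine ⟨fun hz => ?_, fun hnz => ⟨by simpa [St.Ans, ans2] using i1, i2,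
      fun d hd i => by simpa using hdyn d hd i, fun _ _ _ _ _ _ _ _ => ?_, ?_⟩⟩
    · refine wp_use (pairBruteCom_spec (x := x) (y := y) (E2.congr (by simp) (by simp))
        (by simpa using x2) (by simpa using y2) (by simp [cx2, fill2]) (by simp [cy2, fill2])
        (by simpa [St.Ans, ans2] using i1) hxm hym (by omega) hY haY) ?_
      rintro s3 ⟨k1, k2, k3, k4⟩ f3
      have d3 := f3.2.2 rfl
      simp [fill2, bucket2] at k3 k4 d3
      have hz' : s1.reg .ans = 0 := by omega
      have hk1 := k1.1
      refine ⟨by simpa [St.Ans] using k1, fun h => absurd (i2 h) (by omega),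
        fun d hd i => by rw [d3]; exact hdyn d hd i, fun i hi j hj l hl h hlt => ?_, ?_⟩
      · rcases hyes i hi j hj l hl h (by omega) with h' | ⟨_, rx, ry, gi, gj⟩
        · omega
        · obtain ⟨ti, hti, ei⟩ := E1.buckets.exists_index i hi gi
          obtain ⟨tj, htj, ej⟩ := E1.buckets.exists_index j hj gj
          rw [rx] at hti ei
          rw [ry] at htj ej
          exact k3 ti hti tj htj l hl (by rw [ei, ej, h])
      -- The check has looked at all pairs of the two buckets. If it found nothing, the solution
      -- behind the positive answer is not genuine.
      · have hFk : s3.reg .ans = 0 → k ∈ F := by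
          intro h3
          obtain ⟨i, hi, j, hj, l, hl, ⟨gi, gj, _⟩, rx, ry, hmod⟩ := hriff'.1 rfl
          rw [hF, falseIds, Finset.mem_image]
          refine ⟨(i, j, l), ?_, by simp only [rx, ry, hk']⟩
          simp only [falseTriples, triples, Finset.mem_filter, Finset.mem_product,
            Finset.mem_range]
          refine ⟨⟨hi, hj, hl⟩, hmod, fun h => ?_⟩
          obtain ⟨ti, hti, ei⟩ := E1.buckets.exists_index i hi gi
          obtain ⟨tj, htj, ej⟩ := E1.buckets.exists_index j hj gj
          rw [rx] at hti ei
          rw [ry] at htj ej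
          have := k3 ti hti tj htj l hl (by rw [ei, ej, h])
          omega
        rw [hkF, Nat.add_mul]
        rw [hz'] at i5
        rcases (show s3.reg .ans = 0 ∨ s3.reg .ans = 1 by omega) with h3 | h3
        · rw [if_pos (hFk h3)]
          omega
        · rw [h3]
          split_ifs <;> omega
    · have := i1.1
      omega
    · rw [hkF, Nat.add_mul]
      split_ifs <;> omega
  · rintro s1 f1 ⟨i1, i2, i3, i4, i5⟩
    simp only [St.tick_reg, St.set_reg, if_true] at i1 i2 i3 i4 i5
    have hc : ((Finset.range (m₁ * m₁)).filter (· ∈ F)).card ≤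
        (falseTriples n a (m₁ * m₂)).card := by
      refine (Finset.card_le_card (t := F) fun x hx => (Finset.mem_filter.1 hx).2).trans ?_
      exact Finset.card_image_le
    have hc' := Nat.mul_le_mul_right Kb hc
    have ha' := Nat.mul_le_mul_right Kb i1.1
    simp
    refine ⟨i1.1, ⟨i1.2, fun ⟨i, hi, j, hj, l, hl, he⟩ => i4 i hi j hj l hl he ?_⟩, ?_⟩
    · have g1 := Nat.mul_le_mul_right m₁ (show a i % m₁ + 1 ≤ m₁ from Nat.mod_lt _ h1)
      have g2 := Nat.mod_lt (a j) h1
      rw [Nat.add_mul] at g1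
      omega
    · rw [Nat.add_mul]
      omega

/-! ### Programs with two phases -/

/-- The first phase computes the size `y * g` of the memory regions, the second phase computes the
answer. -/
def twoPhase (O : Program) (c₁ c₂ : Com) : Program :=
  c₁.code O 0 ++ ([.op .mul 2 (Var.mreg .y) (Var.mreg .g)] ++
    (c₂.code O ((c₁.code O 0).length + 1) ++
      [.const (tmp 0) 0,
        .jumpLt (tmp 0) (Var.mreg .ans)
          ((c₁.code O 0).length + 1 + (c₂.code O ((c₁.code O 0).length + 1)).length + 3),
        .halt false, .halt true]))

theorem Exp.store_notMem_code (e : Exp) (a x : ℕ) : ∀ t, Instr.store a x ∉ e.code t := by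
  induction e with
  | var y => intro t; simp [Exp.code]
  | num c => intro t; simp [Exp.code]
  | get b y => intro t; simp [Exp.code]
  | bin o e₁ e₂ ih₁ ih₂ => intro t; simp [Exp.code, ih₁, ih₂]

/-- Ensures that the first phase leaves the whole memory untouched, also outside the cells described
by `Rel`. Therefore the regions of the second phase are zero apart from the input. -/
theorem Com.store_notMem_code {O : Program} {c : Com} (a x : ℕ) (hc : c.inputOnly = true) :
    ∀ p, Instr.store a x ∉ c.code O p := by
  induction c with
  | skip => intro p; simp [Com.code]
  | setc y v => intro p; simp [Com.code]
  | assign y e => intro p; simp [Com.code, Exp.store_notMem_code]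
  | store b y e => simp [Com.inputOnly] at hc
  | storeDyn d y e => simp [Com.inputOnly] at hc
  | oracle y d n => simp [Com.inputOnly] at hc
  | seq c₁ c₂ ih₁ ih₂ =>
    simp only [Com.inputOnly, Bool.and_eq_true] at hc
    intro p; simp [Com.code, ih₁ hc.1, ih₂ hc.2]
  | ite e₁ e₂ c₁ c₂ ih₁ ih₂ =>
    simp only [Com.inputOnly, Bool.and_eq_true] at hc
    intro p; simp [Com.code, ih₁ hc.1.2, ih₂ hc.2, Exp.store_notMem_code]
  | loop i n c ih =>
    simp only [Com.inputOnly] at hc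
    intro p; simp [Com.code, ih hc]

theorem Com.wa_of_inputOnly {c : Com} (hc : c.inputOnly = true) (a : Arr) : c.wa a = false := by
  induction c with
  | seq c₁ c₂ ih₁ ih₂ =>
    simp only [Com.inputOnly, Bool.and_eq_true] at hc
    simp [Com.wa, ih₁ hc.1, ih₂ hc.2]
  | ite e₁ e₂ c₁ c₂ ih₁ ih₂ =>
    simp only [Com.inputOnly, Bool.and_eq_true] at hc
    simp [Com.wa, ih₁ hc.1.2, ih₂ hc.2]
  | loop i n c ih => exact ih hc
  | store b y e => simp [Com.inputOnly] at hc
  | _ => rfl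

theorem Com.wd_of_inputOnly {c : Com} (hc : c.inputOnly = true) : c.wd = false := by
  induction c with
  | seq c₁ c₂ ih₁ ih₂ =>
    simp only [Com.inputOnly, Bool.and_eq_true] at hc
    simp [Com.wd, ih₁ hc.1, ih₂ hc.2]
  | ite e₁ e₂ c₁ c₂ ih₁ ih₂ =>
    simp only [Com.inputOnly, Bool.and_eq_true] at hc
    simp [Com.wd, ih₁ hc.1.2, ih₂ hc.2]
  | loop i n c ih => exact ih hc
  | storeDyn d y e => simp [Com.inputOnly] at hc
  | oracle y d n => simp [Com.inputOnly] at hc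
  | _ => rfl

theorem step_eq_running {w : ℕ} {P : Program} {S : State} {c : Config}
    (h : step w P S = .running c) :
    ∃ c₀ i, S = .running c₀ ∧ P[c₀.pc]? = some i ∧ i.exec w c₀ = .running c := by
  cases S with
  | running c₀ =>
    cases hi : P[c₀.pc]? with
    | none => simp [step, hi] at h
    | some i => exact ⟨c₀, i, rfl, hi, by simpa [step, hi] using h⟩
  | halted b => simp [step] at h
  | crashed => simp [step] at h

theorem Reach.append {w : ℕ} {P : Program} (P' : Program) {t : ℕ} {c : Config} :
    ∀ {c' : Config}, Reach w P t c c' → Reach w (P ++ P') t c c' := by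
  unfold Reach
  induction t with
  | zero => exact fun h => h
  | succ t ih =>
    intro c' h
    rw [Function.iterate_succ_apply'] at h ⊢
    obtain ⟨c₀, i, h1, h2, h3⟩ := step_eq_running h
    have h4 : (P ++ P')[c₀.pc]? = some i := by
      rw [List.getElem?_append_left (List.getElem?_eq_some_iff.1 h2).1, h2]
    rw [ih h1]
    simp [step, h4, h3]

theorem Instr.exec_mem {w : ℕ} {i : Instr} {c c' : Config} (hi : ∀ a x, i ≠ .store a x)
    (h : i.exec w c = .running c') : c'.mem = c.mem := by
  cases i with
  | store a x => exact absurd rfl (hi a x)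
  | const d v =>
    simp only [Instr.exec, Config.write] at h
    split_ifs at h
    cases h; rfl
  | op o d a b =>
    simp only [Instr.exec, Config.write] at h
    split_ifs at h
    cases h; rfl
  | load d a =>
    simp only [Instr.exec, Config.write] at h
    split_ifs at h
    cases h; rfl
  | jump l => cases h; rfl
  | jumpLt a b l => cases h; rfl
  | halt b => cases h

theorem Reach.mem {w : ℕ} {P : Program} (hP : ∀ a x, Instr.store a x ∉ P) {t : ℕ} {c : Config} :
    ∀ {c' : Config}, Reach w P t c c' → c'.mem = c.mem := by
  unfold Reach
  induction t with
  | zero => intro c' h; cases h; rfl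
  | succ t ih =>
    intro c' h
    rw [Function.iterate_succ_apply'] at h
    obtain ⟨c₀, i, h1, h2, h3⟩ := step_eq_running h
    rw [Instr.exec_mem (fun a x hi => hP a x (hi ▸ List.mem_of_getElem? h2)) h3, ih h1]

/-- The initial state of the structured language. -/
def St.start (xs : List ℕ) : St where
  reg x := if x = .n then xs.length else 0
  arr a i := if a = .input then xs.getD i 0 else 0
  dyn _ _ := 0
  time := 0

/-- The input begins at address 0 in every layout, and register 2 is initially 0, so the first phase
runs with region size `ρ = 0`. Once register 2 holds `Y`, the same memory represents the same state
in the layout `ρ = Y`. -/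
theorem twoPhase_run {X : Ctx} {w : ℕ} {c₁ c₂ : Com} {Q : St → Prop} {xs : List ℕ}
    (hY : 2 ≤ X.Y) (hw : X.Y ^ 40 ≤ 2 ^ w) (hO : X.OracleOK) (hc₁ : c₁.inputOnly = true)
    (hwf₁ : c₁.wf = true) (hwf₂ : c₂.wf = true) (hn : xs.length < X.Y) (hx : ∀ x ∈ xs, x < X.Y)
    (hwp : wp X c₁ (fun s => s.reg .y * s.reg .g = X.Y ∧ wp X c₂ Q s) (St.start xs)) :
    ∃ s t b, Q s ∧ run w (twoPhase X.O c₁ c₂) xs t = .halted b ∧ (b = true ↔ 0 < s.reg .ans) ∧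
      t ≤ s.time + 4 := by
  have hYw : X.Y < 2 ^ w := lt_of_lt_of_le (by
    calc X.Y = X.Y ^ 1 := (pow_one _).symm
      _ < X.Y ^ 40 := Nat.pow_lt_pow_right (by omega) (by omega)) hw
  set P₁ := c₁.code X.O 0 with hP₁
  set P₂ := c₂.code X.O (P₁.length + 1) with hP₂
  set P := twoPhase X.O c₁ c₂ with hP
  have hget : ∀ i, xs.getD i 0 < X.Y := by
    intro i
    rw [List.getD_eq_getElem?_getD]
    cases h : xs[i]? with
    | none => simp; omega
    | some x => simpa using hx x (List.mem_of_getElem? h)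
  let cf₀ : Config := ⟨0, Function.update (fun _ => 0) 0 xs.length, fun i => xs.getD i 0⟩
  have hrel : Rel X 0 (St.start xs) cf₀ := by
    refine ⟨fun x => ?_, fun x => ?_, ?_, fun a i hi ha => ?_, fun a i hi => ?_, fun h => by omega,
      fun d i hi => by simp [St.start]; omega⟩
    · have : x.mreg = 0 ↔ x = .n := by
        rw [show (0 : ℕ) = Var.mreg .n from rfl, Var.mreg_inj]
      by_cases h : x = .n
      · subst h; rfl
      · simp [cf₀, St.start, h, Function.update_of_ne (fun h' => h (this.1 h'))]
    · simp only [St.start]; split_ifs <;> omega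
    · simp [cf₀]
    · rcases ha with h | rfl
      · omega
      · simp [cf₀, St.start, Arr.ctorIdx]
    · simp only [St.start]; split_ifs
      · exact hget i
      · omega
  -- The first phase is treated as a program of its own: `Reach.mem` needs a program without stores,
  -- and `Reach.append` transfers the run to the whole program.
  obtain ⟨s₁, cf₁, t₁, r₁, pc₁, rel₁, ⟨⟨hY₁, hwp₁⟩, fr₁⟩, ht₁⟩ := Com.sound hY hw hO c₁ 0 cf₀
    (St.start xs) _ (P := P₁) (fun i _ => by rw [Nat.zero_add]) rfl hwf₁ (Or.inr ⟨rfl, hc₁⟩) hrel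
    (wp_frame hwp)
  have hmem₁ : cf₁.mem = fun i => xs.getD i 0 :=
    Reach.mem (fun a x => Com.store_notMem_code a x hc₁ 0) r₁
  set p₂ := P₁.length + 1 with hp₂
  have hat : At P 0 (P₁ ++ ([.op .mul 2 (Var.mreg .y) (Var.mreg .g)] ++ (P₂ ++
      [.const (tmp 0) 0, .jumpLt (tmp 0) (Var.mreg .ans) (p₂ + P₂.length + 3),
        .halt false, .halt true]))) := fun i _ => by rw [Nat.zero_add]; rfl
  simp only [At.append, At.cons, Nat.zero_add, List.length_singleton] at hat
  obtain ⟨-, ⟨hi₁, -⟩, hat₂, hi₂, hi₃, hi₄, hi₅, -⟩ := hat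
  have r₁' : Reach w P t₁ cf₀ cf₁ := Reach.append _ r₁
  have r₂ := r₁'.op (v := X.Y) hi₁ (by rw [pc₁, Nat.zero_add])
    (by rw [rel₁.reg, rel₁.reg]; exact hY₁) hYw
  have ha : ∀ a, a ≠ .input → s₁.arr a = fun _ => 0 := fun a ha => by
    rw [fr₁.arr a (Com.wa_of_inputOnly hc₁ a)]
    simp [St.start, ha]
  have hd : s₁.dyn = fun _ _ => 0 := fr₁.2.2 (Com.wd_of_inputOnly hc₁)
  have hzero : ∀ i, X.Y ≤ i → xs.getD i 0 = 0 := fun i hi =>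
    List.getD_eq_default _ _ (by omega)
  have hrel₂ : Rel X X.Y s₁ ⟨P₁.length + 1, Function.update cf₁.reg 2 X.Y, cf₁.mem⟩ := by
    refine ⟨fun x => ?_, rel₁.bdd, by simp, fun a i hi _ => ?_, rel₁.arrBdd, fun _ d i hi => ?_,
      rel₁.dynBdd⟩
    · simp [Function.update_of_ne x.mreg_ne_two, rel₁.reg]
    · by_cases h : a = .input
      · subst h
        have := rel₁.arr .input i hi (Or.inr rfl)
        simpa [Arr.ctorIdx] using this
      · have h1 : 1 ≤ a.ctorIdx := by
          rw [Nat.one_le_iff_ne_zero]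
          exact fun h' => h (Arr.ctorIdx_inj h')
        have h2 := Nat.mul_le_mul_right X.Y h1
        rw [ha a h]
        simp only [hmem₁]
        exact hzero _ (by omega)
    · have h2 := Nat.mul_le_mul_right X.Y (show 1 ≤ 16 + d by omega)
      rw [hd]
      simp only [hmem₁]
      exact hzero _ (by omega)
  obtain ⟨s₂, cf₂, t₂, r₃, pc₂, rel₂, hQ, ht₂⟩ := Com.sound hY hw hO c₂ p₂ _ s₁ Q hat₂ rfl hwf₂
    (Or.inl rfl) hrel₂ hwp₁
  have r₄ := (r₂.trans r₃).const hi₂ pc₂ (by omega)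
  have hans : Function.update cf₂.reg (tmp 0) 0 (Var.mreg .ans) = s₂.reg .ans := by
    rw [Function.update_of_ne (Var.mreg_ne_tmp _ _), rel₂.reg]
  have hfin : ∀ {t c b}, Reach w P t cf₀ c → P[c.pc]? = some (.halt b) →
      run w P xs (t + 1) = .halted b := by
    intro t c b hr hc
    unfold run init
    rw [Function.iterate_succ_apply', show (step w P)^[t] (.running cf₀) = .running c from hr]
    simp [step, hc, Instr.exec]
  have htime : (St.start xs).time = 0 := rfl
  by_cases hlt : 0 < s₂.reg .ans
  · have r₅ := r₄.jumpLt_of_lt hi₃ rfl (by simp only [hans]; simpa using hlt)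
    exact ⟨s₂, _, true, hQ, hfin r₅ hi₅, by simp [hlt], by omega⟩
  · have r₅ := r₄.jumpLt_of_not_lt hi₃ rfl (by simp only [hans]; simpa using hlt)
    exact ⟨s₂, _, false, hQ, hfin r₅ hi₄, by simp [hlt], by omega⟩

/-! ### The whole algorithm -/

/-- An index whose residue class has more than `k` members is the first component of at least `k`
false pairs: by injectivity, the other members carry different numbers. -/
theorem card_lt_hist_mul_le {n : ℕ} {a : ℕ → ℕ} (hinj : ∀ i < n, ∀ j < n, a i = a j → i = j)
    (M k : ℕ) : ((Finset.range n).filter fun i => k < hist n a M (a i % M)).card * k ≤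
      (falsePairs n a M).card := by
  rw [Finset.card_eq_sum_card_fiberwise (f := Prod.fst) (t := Finset.range n)
    (s := falsePairs n a M) (fun t ht => by
      simp only [falsePairs, pairs, Finset.coe_filter, Finset.mem_product, Set.mem_ofPred_eq] at ht
      exact ht.1.1), ← smul_eq_mul]
  refine (Finset.card_nsmul_le_sum _ _ _ fun i hi => ?_).trans
    (Finset.sum_le_sum_of_subset (Finset.filter_subset _ _))
  rw [Finset.mem_filter, Finset.mem_range] at hi
  have h1 : (((Finset.range n).filter fun j => a j % M = a i % M).erase i).image (fun j => (i, j)) ⊆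
      (falsePairs n a M).filter fun t => t.1 = i := by
    intro t ht
    simp only [Finset.mem_image, Finset.mem_erase, Finset.mem_filter, Finset.mem_range] at ht
    obtain ⟨j, ⟨hji, hj, h⟩, rfl⟩ := ht
    simp only [falsePairs, pairs, Finset.mem_filter, Finset.mem_product, Finset.mem_range]
    exact ⟨⟨⟨hi.1, hj⟩, h.symm, fun he => hji (hinj i hi.1 j hj he).symm⟩, trivial⟩
  have h2 := Finset.card_le_card h1
  rw [Finset.card_image_of_injective _ (fun x y h => (Prod.mk.inj h).2),
    Finset.card_erase_of_mem (by simp [hi.1])] at h2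
  have h3 := hi.2
  unfold hist at h3
  omega

theorem card_not_good_le {n : ℕ} {a : ℕ → ℕ} (hinj : ∀ i < n, ∀ j < n, a i = a j → i = j)
    (m₁ m sz : ℕ) : ((Finset.range n).filter fun i => ¬ Good n a m₁ m sz i).card * sz ≤
      (falsePairs n a m₁).card + (falsePairs n a m).card * sz := by
  have h1 := card_lt_hist_mul_le hinj m₁ sz
  have h2 := card_lt_hist_mul_le hinj m 1
  have h3 : ((Finset.range n).filter fun i => ¬ Good n a m₁ m sz i).card ≤
      ((Finset.range n).filter fun i => sz < hist n a m₁ (a i % m₁)).card +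
      ((Finset.range n).filter fun i => 1 < hist n a m (a i % m)).card := by
    refine le_trans (Finset.card_le_card fun i hi => ?_) (Finset.card_union_le _ _)
    rw [Finset.mem_filter] at hi
    rw [Finset.mem_union, Finset.mem_filter, Finset.mem_filter]
    rcases Nat.lt_or_ge sz (hist n a m₁ (a i % m₁)) with h | h
    · exact Or.inl ⟨hi.1, h⟩
    · exact Or.inr ⟨hi.1, by by_contra h'; exact hi.2 ⟨h, by omega⟩⟩
  have h4 := Nat.mul_le_mul_right sz h3
  rw [Nat.add_mul] at h4
  have h5 := Nat.mul_le_mul_right sz h2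
  rw [Nat.mul_one] at h5
  omega

/-- Choose the moduli and the sizes. -/
def setupCom (H : ℕ) : Com :=
  .rr ::= num 2 * (v .n * v .n * v .n) + num 1 ;; .m ::= num 1 ;;
  .setc .k1 (9 * H + 6) ;; .loop .st .k1 selectStep ;; .m1 ::= v .m ;;
  .setc .k2 (3 * H - 6) ;; .loop .st .k2 selectStep ;; .m2 ::= v .m / v .m1 ;;
  .s ::= num 1 ;; .setc .cst (H - 2) ;; .loop .i .cst (.s ::= v .s * v .b) ;;
  .nn ::= v .s * v .b ;; .el ::= v .nn + num 4 * v .m2 + num 4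

/-- The exponent `3 * H - 6` keeps `m₂` below the cube of `N = b ^ (H - 1)` by a factor `b ^ 3`,
which absorbs the constants of the encoding. The capacity `b ^ (H - 2)` is smaller than `N` by a
factor `b`, which leaves room for the three buckets, the last one taken twice. -/
theorem setupCom_spec {n b H l L : ℕ} {a : ℕ → ℕ} {s : St} (ha : s.Input n a)
    (hb : s.reg .b = b) (hb0 : 1 ≤ b) (hH : 2 ≤ H) (hn : 1 ≤ n)
    (hL : Nat.clog 2 (b ^ (12 * H)) ≤ L) (hHY : 9 * H + 6 < X.Y)
    (hRY : 2 * n ^ 3 + 2 * n + 1 < X.Y) (hY : 4 * (L + 1) * 3 ^ L < X.Y)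
    (hMY : 9 * b ^ (12 * H) < X.Y) (haY : ∀ i < n, a i < X.Y)
    (hl : ∀ i < n, 2 * a i < 2 ^ (l + 1)) :
    wp X (setupCom H) (fun s' => ∃ m₁ m₂, 1 ≤ m₁ ∧ 1 ≤ m₂ ∧ m₁ ≤ b ^ (9 * H + 6) ∧
      m₂ ≤ b ^ (3 * H - 6) ∧ m₁ * m₂ ≤ b ^ (12 * H) ∧ s'.reg .m1 = m₁ ∧ s'.reg .m2 = m₂ ∧
      s'.reg .m = m₁ * m₂ ∧ s'.reg .s = b ^ (H - 2) ∧ s'.reg .nn = b ^ (H - 1) ∧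
      s'.reg .el = b ^ (H - 1) + 4 * m₂ + 4 ∧
      falseColl n a m₁ * ((Finset.range (b + 1)).filter Nat.Prime).card ^ (9 * H + 6) ≤
        l ^ (9 * H + 6) * (2 * n ^ 3) ∧
      falseColl n a (m₁ * m₂) * ((Finset.range (b + 1)).filter Nat.Prime).card ^ (12 * H) ≤
        l ^ (12 * H) * (2 * n ^ 3) ∧
      s'.time ≤ s.time + (12 * H * (b * (1200 * (L + 1) * 3 ^ L + 40 * n + 350) + 30) +
        20 * H + 100)) s := by
  set π := ((Finset.range (b + 1)).filter Nat.Prime).card with hπ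
  set K := b * (1200 * (L + 1) * 3 ^ L + 40 * n + 350) + 30 with hK
  have hpow : ∀ {i}, i ≤ 12 * H → b ^ i ≤ b ^ (12 * H) := fun h => Nat.pow_le_pow_right hb0 h
  have e3 : n * n * n = n ^ 3 := by ring
  simp only [setupCom, wp_seq, wp_assign, wp_setc]
  simp only [Exp.eval_var, Exp.eval_add, Exp.eval_mul, Exp.eval_num, ha.1, e3]
  have := hpow (i := 0) (by omega)
  rw [pow_zero] at this
  refine ⟨by omega, by omega, by omega, ?_⟩
  refine wp_use (selectLoop_spec (Or.inl rfl) (m := 1) (b := b) (k := 9 * H + 6) (l := l) (L := L)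
    (a := a) (n := n) ⟨by simpa using ha.1, by simpa using ha.2⟩ (by simpa using hb) (by simp)
    le_rfl hb0 (by simp) (by simp) hn ?_ hRY hY ?_ haY hl) ?_
  · rw [Nat.one_mul]
    exact (Nat.clog_mono_right 2 (hpow (by omega))).trans hL
  · have := hpow (i := 9 * H + 6) (by omega)
    omega
  rintro s1 ⟨-, p1, p2, p3, p4⟩ f1
  have a1 : s1.Input n a := St.Input.frame ⟨by simpa using ha.1, by simpa using ha.2⟩ f1 rfl rfl
  have b1 : s1.reg .b = b := f1.reg (by simpa using hb) rfl
  have r1 : s1.reg .rr = 2 * n ^ 3 + 1 := f1.reg (by simp) rfl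
  rw [Nat.one_mul] at p2
  have hle : s1.reg .m * b ^ (3 * H - 6) ≤ b ^ (12 * H) :=
    (Nat.mul_le_mul_right _ p2).trans (by rw [← pow_add]; exact hpow (by omega))
  have hm1 := p2.trans (hpow (by omega))
  simp only [wp_seq, wp_assign, wp_setc, Exp.eval_var]
  refine ⟨by omega, by omega, ?_⟩
  refine wp_use (selectLoop_spec (Or.inr rfl) (m := s1.reg .m) (b := b) (k := 3 * H - 6) (l := l)
    (L := L) (a := a) (n := n) ⟨by simpa using a1.1, by simpa using a1.2⟩ (by simpa using b1)
    (by simp) p1 hb0 (by simp) (by simpa using r1) hn ((Nat.clog_mono_right 2 hle).trans hL) hRY hY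
    (by omega) haY hl) ?_
  rintro s2 ⟨⟨m₂, q0⟩, q1, q2, q3, q4⟩ f2
  have b2 : s2.reg .b = b := f2.reg (by simpa using b1) rfl
  have m2 : s2.reg .m1 = s1.reg .m := f2.reg (by simp) rfl
  rw [q0] at q1 q2 q3
  have hm₂ : 1 ≤ m₂ := Nat.pos_of_mul_pos_left q1
  have hm₂' : m₂ ≤ b ^ (3 * H - 6) := Nat.le_of_mul_le_mul_left q2 p1
  have hdiv : s1.reg .m * m₂ / s1.reg .m = m₂ := Nat.mul_div_cancel_left _ p1
  have e1 := hpow (i := 3 * H - 6) (by omega)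
  have e2 := hpow (i := H - 1) (by omega)
  simp only [wp_seq, wp_assign, wp_setc, Exp.eval_div, Exp.eval_var, Exp.eval_num, q0, m2, hdiv]
  refine ⟨by omega, by omega, by omega, ?_⟩
  refine wp_loop_time 20 (fun k s' => s'.reg .s = b ^ k) rfl rfl (by simp) ?_ ?_
  · rintro k hk s3 f3 hi h3
    simp at hk
    have b3 : s3.reg .b = b := f3.reg (by simpa using b2) rfl
    have := hpow (i := k + 1) (by omega)
    simp [h3, b3, ← pow_succ]
    omega
  rintro s3 f3 h3 t3
  have b3 : s3.reg .b = b := f3.reg (by simpa using b2) rfl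
  have m3 : s3.reg .m1 = s1.reg .m := f3.reg (by simpa using m2) rfl
  have m3' : s3.reg .m = s1.reg .m * m₂ := f3.reg (by simpa using q0) rfl
  have m3'' : s3.reg .m2 = m₂ := f3.reg (by simp) rfl
  simp at h3 t3 p4 q4
  have e4 : b ^ (H - 2) * b = b ^ (H - 1) := by rw [← pow_succ]; congr 1; omega
  simp [h3, b3, e4, m3'', m3, m3']
  refine ⟨by omega, by omega, p1, hm₂, p2, hm₂', q2.trans hle,
    p3.trans (Nat.mul_le_mul_left _ (falseColl_le n a 1)), ?_, ?_⟩
  · have e5 : 12 * H = (3 * H - 6) + (9 * H + 6) := by omega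
    rw [e5, pow_add π (3 * H - 6), pow_add l (3 * H - 6)]
    calc falseColl n a (s1.reg .m * m₂) * (π ^ (3 * H - 6) * π ^ (9 * H + 6))
        = falseColl n a (s1.reg .m * m₂) * π ^ (3 * H - 6) * π ^ (9 * H + 6) := by ring
      _ ≤ l ^ (3 * H - 6) * falseColl n a (s1.reg .m) * π ^ (9 * H + 6) :=
        Nat.mul_le_mul_right _ q3
      _ = l ^ (3 * H - 6) * (falseColl n a (s1.reg .m) * π ^ (9 * H + 6)) := by ring
      _ ≤ l ^ (3 * H - 6) * (l ^ (9 * H + 6) * (2 * n ^ 3)) :=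
        Nat.mul_le_mul_left _ (p3.trans (Nat.mul_le_mul_left _ (falseColl_le n a 1)))
      _ = l ^ (3 * H - 6) * l ^ (9 * H + 6) * (2 * n ^ 3) := by ring
  · rw [← hK] at p4 q4
    have : (9 * H + 6) * K + (3 * H - 6) * K = 12 * H * K := by
      rw [← Nat.add_mul]; congr 1; omega
    omega

/-! ### The running time -/

/-- Since `3 ^ 5 < 2 ^ 8`, the exponent of `b` is at most `12 * H * 8 / 5 = 19.2 * H`, and `3 ≤ H`
makes this at most `20 * H - 2`. -/
theorem three_pow_clog_le {b H : ℕ} (hb : 2 ≤ b) (hH : 3 ≤ H) :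
    3 ^ Nat.clog 2 (b ^ (12 * H)) ≤ 4 * b ^ (20 * H - 2) := by
  set L := Nat.clog 2 (b ^ (12 * H)) with hL
  have h2 : 2 ^ L ≤ 2 * b ^ (12 * H) := by
    have hL1 : 1 ≤ L := Nat.clog_pos one_lt_two (hb.trans (Nat.le_self_pow (by omega) b))
    have h3 : 2 ^ (L - 1) < b ^ (12 * H) := Nat.pow_pred_clog_lt_self one_lt_two
      (hb.trans (Nat.le_self_pow (by omega) b))
    rw [show L = L - 1 + 1 by omega, pow_succ]
    omega
  refine (Nat.pow_le_pow_iff_left (n := 5) (by omega)).1 ?_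
  calc (3 ^ L) ^ 5 = (3 ^ 5) ^ L := by rw [← pow_mul, ← pow_mul, Nat.mul_comm]
    _ ≤ (2 ^ 8) ^ L := Nat.pow_le_pow_left (by norm_num) L
    _ = (2 ^ L) ^ 8 := by rw [← pow_mul, ← pow_mul, Nat.mul_comm]
    _ ≤ (2 * b ^ (12 * H)) ^ 8 := Nat.pow_le_pow_left h2 8
    _ = 2 ^ 8 * b ^ (12 * H * 8) := by rw [mul_pow, ← pow_mul]
    _ ≤ 4 ^ 5 * b ^ ((20 * H - 2) * 5) :=
      Nat.mul_le_mul (by norm_num) (Nat.pow_le_pow_right (by omega) (by omega))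
    _ = (4 * b ^ (20 * H - 2)) ^ 5 := by rw [mul_pow, ← pow_mul]

theorem clog_pow_le (b k : ℕ) : Nat.clog 2 (b ^ k) ≤ k * Nat.clog 2 b := by
  rw [Nat.clog_le_iff_le_pow one_lt_two, Nat.mul_comm, pow_mul]
  exact Nat.pow_le_pow_left (Nat.le_pow_clog one_lt_two b) k

/-- A bound for the number of collisions after the selection of the modulus. -/
theorem mul_pow_le_of_mul_pow_le {F π b l k c : ℕ} (h : F * π ^ k ≤ l ^ k * c) (hb : b ≤ 2 * l * π) :
    F * b ^ k ≤ (2 * l ^ 2) ^ k * c := by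
  calc F * b ^ k ≤ F * (2 * l * π) ^ k := Nat.mul_le_mul_left _ (Nat.pow_le_pow_left hb k)
    _ = (2 * l) ^ k * (F * π ^ k) := by rw [mul_pow]; ring
    _ ≤ (2 * l) ^ k * (l ^ k * c) := Nat.mul_le_mul_left _ h
    _ = (2 * l ^ 2) ^ k * c := by rw [show 2 * l ^ 2 = 2 * l * l by ring, mul_pow (2 * l)]; ring

theorem le_of_mul_pow_le {F b i j c : ℕ} (hb : 1 ≤ b) (h : F * b ^ i ≤ c * b ^ (i + j)) :
    F ≤ c * b ^ j := by
  refine le_of_mul_le_mul_right (a := b ^ i) ?_ (Nat.pow_pos hb)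
  rwa [Nat.mul_assoc, ← pow_add, Nat.add_comm j]

/-- Up to the factor `a`, each multiplier removes a factor `b` from the `n ^ 3`, about `b ^ (30 *
H)`, possible collisions; `12 * H` of them leave `b ^ (18 * H)` false triples. Pairs are counted
with weight `n`, so their bounds gain another `b ^ (10 * H)`: there are `b ^ (8 * H)` false pairs
modulo `m` and `b ^ (11 * H - 6)` modulo `m₁`. Dividing the latter by the capacity `b ^ (H - 2)`
bounds the number of bad elements. -/
theorem false_solutions_le {n a H b l π FP₁ FPm FT bad : ℕ} (hH : 12 ≤ H) (hb : 2 ≤ b)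
    (hn1 : 1 ≤ n) (hn : n < (b + 1) ^ (10 * H)) (hl : 1 ≤ l)
    (hπ : b ≤ 2 * l * π) (hA : a = 2 * 2 ^ (30 * H) * (2 * l ^ 2) ^ (12 * H))
    (h₁ : n * FP₁ * π ^ (9 * H + 6) ≤ l ^ (9 * H + 6) * (2 * n ^ 3))
    (h₂ : (FT + n * FPm) * π ^ (12 * H) ≤ l ^ (12 * H) * (2 * n ^ 3))
    (hbad : bad * b ^ (H - 2) ≤ FP₁ + FPm * b ^ (H - 2)) :
    n ≤ a * b ^ (10 * H) ∧ FT ≤ a * b ^ (18 * H) ∧ bad ≤ 2 * a * b ^ (10 * H - 4) := by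
  have hpow : ∀ {i j}, i ≤ j → b ^ i ≤ b ^ j := fun h => Nat.pow_le_pow_right (by omega) h
  have hn' : n ≤ 2 ^ (10 * H) * b ^ (10 * H) := by
    rw [← mul_pow]
    exact hn.le.trans (Nat.pow_le_pow_left (by omega) _)
  have hn2 : n ^ 2 ≤ 2 ^ (20 * H) * b ^ (20 * H) := by
    calc n ^ 2 ≤ (2 ^ (10 * H) * b ^ (10 * H)) ^ 2 := Nat.pow_le_pow_left hn' 2
      _ = _ := by rw [mul_pow, ← pow_mul, ← pow_mul]; congr 2 <;> ring
  have hn3 : n ^ 3 ≤ 2 ^ (30 * H) * b ^ (30 * H) := by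
    calc n ^ 3 ≤ (2 ^ (10 * H) * b ^ (10 * H)) ^ 3 := Nat.pow_le_pow_left hn' 3
      _ = _ := by rw [mul_pow, ← pow_mul, ← pow_mul]; congr 2 <;> ring
  have hq : ∀ {k}, k ≤ 12 * H → (2 * l ^ 2) ^ k ≤ (2 * l ^ 2) ^ (12 * H) := fun h =>
    Nat.pow_le_pow_right (by positivity) h
  have h2 : ∀ {k}, k ≤ 30 * H → 2 ^ k ≤ 2 ^ (30 * H) := fun h => Nat.pow_le_pow_right (by omega) h
  have hna : n ≤ a * b ^ (10 * H) := by
    refine hn'.trans (Nat.mul_le_mul_right _ ?_)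
    rw [hA]
    have := h2 (k := 10 * H) (by omega)
    have : 1 ≤ (2 * l ^ 2) ^ (12 * H) := Nat.pow_pos (by positivity)
    nlinarith
  have hsq : ∀ {k}, k ≤ 12 * H → (2 * l ^ 2) ^ k * (2 * n ^ 2) ≤ a * b ^ (20 * H) := by
    intro k hk
    calc (2 * l ^ 2) ^ k * (2 * n ^ 2)
        ≤ (2 * l ^ 2) ^ (12 * H) * (2 * (2 ^ (30 * H) * b ^ (20 * H))) :=
          Nat.mul_le_mul (hq hk) (Nat.mul_le_mul_left _ (hn2.trans (Nat.mul_le_mul_right _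
            (h2 (by omega)))))
      _ = a * b ^ (20 * H) := by rw [hA]; ring
  have hFT : FT ≤ a * b ^ (18 * H) := by
    refine le_of_mul_pow_le (i := 12 * H) (by omega) ?_
    have := mul_pow_le_of_mul_pow_le h₂ hπ
    calc FT * b ^ (12 * H) ≤ (FT + n * FPm) * b ^ (12 * H) := Nat.mul_le_mul_right _ (by omega)
      _ ≤ (2 * l ^ 2) ^ (12 * H) * (2 * n ^ 3) := this
      _ ≤ (2 * l ^ 2) ^ (12 * H) * (2 * (2 ^ (30 * H) * b ^ (30 * H))) :=
        Nat.mul_le_mul_left _ (Nat.mul_le_mul_left _ hn3)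
      _ = a * b ^ (12 * H + 18 * H) := by
        rw [hA, show 12 * H + 18 * H = 30 * H by ring]; ring
  have hFPm : FPm ≤ a * b ^ (8 * H) := by
    refine le_of_mul_pow_le (i := 12 * H) (by omega) ?_
    refine le_of_mul_le_mul_left (a := n) ?_ hn1
    have := mul_pow_le_of_mul_pow_le h₂ hπ
    calc n * (FPm * b ^ (12 * H)) ≤ (FT + n * FPm) * b ^ (12 * H) := by
          rw [← Nat.mul_assoc]; exact Nat.mul_le_mul_right _ (by omega)
      _ ≤ (2 * l ^ 2) ^ (12 * H) * (2 * n ^ 3) := this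
      _ = n * ((2 * l ^ 2) ^ (12 * H) * (2 * n ^ 2)) := by ring
      _ ≤ n * (a * b ^ (12 * H + 8 * H)) := by
        rw [show 12 * H + 8 * H = 20 * H by ring]
        exact Nat.mul_le_mul_left _ (hsq le_rfl)
  have hFP₁ : FP₁ ≤ a * b ^ (11 * H - 6) := by
    refine le_of_mul_pow_le (i := 9 * H + 6) (by omega) ?_
    refine le_of_mul_le_mul_left (a := n) ?_ hn1
    have := mul_pow_le_of_mul_pow_le h₁ hπ
    calc n * (FP₁ * b ^ (9 * H + 6)) = n * FP₁ * b ^ (9 * H + 6) := by ring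
      _ ≤ (2 * l ^ 2) ^ (9 * H + 6) * (2 * n ^ 3) := this
      _ = n * ((2 * l ^ 2) ^ (9 * H + 6) * (2 * n ^ 2)) := by ring
      _ ≤ n * (a * b ^ (9 * H + 6 + (11 * H - 6))) := by
        rw [show 9 * H + 6 + (11 * H - 6) = 20 * H by omega]
        exact Nat.mul_le_mul_left _ (hsq (by omega))
  refine ⟨hna, hFT, ?_⟩
  · refine le_of_mul_pow_le (i := H - 2) (by omega) ?_
    calc bad * b ^ (H - 2) ≤ FP₁ + FPm * b ^ (H - 2) := hbad
      _ ≤ a * b ^ (11 * H - 6) + a * b ^ (8 * H) * b ^ (H - 2) :=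
        Nat.add_le_add hFP₁ (Nat.mul_le_mul_right _ hFPm)
      _ = a * b ^ (11 * H - 6) + a * b ^ (8 * H + (H - 2)) := by rw [Nat.mul_assoc, ← pow_add]
      _ ≤ a * b ^ (11 * H - 6) + a * b ^ (11 * H - 6) :=
        Nat.add_le_add_left (Nat.mul_le_mul_left _ (hpow (by omega))) _
      _ = 2 * a * b ^ (H - 2 + (10 * H - 4)) := by
        rw [show H - 2 + (10 * H - 4) = 11 * H - 6 by omega]; ring

set_option maxHeartbeats 1000000 in
/-- The running time of the algorithm, up to factors that depend only on `H`, on the program for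
the oracle, and on `l`. -/
theorem heavy_time_le {n a H b l m₁ FT bad T C R : ℕ} (hH : 12 ≤ H) (hb : 2 ≤ b)
    (hn1 : 1 ≤ n) (ha1 : 1 ≤ a) (hl : 1 ≤ l) (hbl : Nat.clog 2 (b + 1) ≤ l)
    (hm₁ : m₁ ≤ b ^ (9 * H + 6)) (hna : n ≤ a * b ^ (10 * H)) (hFT : FT ≤ a * b ^ (18 * H))
    (hbad : bad ≤ 2 * a * b ^ (10 * H - 4)) (hT : T ≤ C * b ^ (2 * H - 13)) :
    12 * H * (b * (1200 * (Nat.clog 2 (b ^ (12 * H)) + 1) * 3 ^ Nat.clog 2 (b ^ (12 * H)) +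
        40 * n + 350) + 30) + 20 * H + 100 + (110 * n + 20 + bad * (60 * n + 50)) +
      (m₁ * m₁ * (80 * b ^ (H - 1) + (2 * T + R + 4) + 100) +
        (FT + 1) * (b ^ (H - 2) * (40 * b ^ (H - 2) + 30) + 3) + 20) ≤
      (800000 * H ^ 2 + 2 * C + R + 2000) * a ^ 2 * l * b ^ (20 * H - 1) := by
  have hpow : ∀ {i j}, i ≤ j → b ^ i ≤ b ^ j := fun h => Nat.pow_le_pow_right (by omega) h
  set E := b ^ (20 * H - 1) with hE
  have hE1 : 1 ≤ E := Nat.pow_pos (by omega)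
  set Z := a ^ 2 * l * E with hZ
  have hZE : E ≤ Z := Nat.le_mul_of_pos_left _ (by positivity)
  have haZ : a * E ≤ Z := by
    rw [hZ]; exact Nat.mul_le_mul_right _ (by nlinarith [Nat.mul_le_mul_left a ha1])
  have ha2Z : a ^ 2 * E ≤ Z := by
    rw [hZ]; exact Nat.mul_le_mul_right _ (Nat.le_mul_of_pos_right _ hl)
  have hlZ : l * E ≤ Z := by
    rw [hZ]; exact Nat.mul_le_mul_right _ (Nat.le_mul_of_pos_left _ (by positivity))
  have hnE : b * n ≤ Z := by
    refine le_trans ?_ haZ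
    calc b * n ≤ b * (a * b ^ (10 * H)) := Nat.mul_le_mul_left _ hna
      _ = a * b ^ (10 * H + 1) := by ring
      _ ≤ a * E := Nat.mul_le_mul_left _ (hpow (by omega))
  have hnZ : n ≤ Z := le_trans (Nat.le_mul_of_pos_left _ (by omega)) hnE
  have hbZ : b ≤ Z := le_trans (by simpa using hpow (i := 1) (j := 20 * H - 1) (by omega)) hZE
  -- The transforms for the `b` candidates of one selection step.
  have t1 : b * ((Nat.clog 2 (b ^ (12 * H)) + 1) * 3 ^ Nat.clog 2 (b ^ (12 * H))) ≤
      52 * H * Z := by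
    have e1 : Nat.clog 2 (b ^ (12 * H)) + 1 ≤ 13 * H * l := by
      have e2 := clog_pow_le b (12 * H)
      have e3 : Nat.clog 2 b ≤ l := (Nat.clog_mono_right 2 (by omega)).trans hbl
      have e4 := Nat.mul_le_mul_left (12 * H) e3
      nlinarith
    calc b * ((Nat.clog 2 (b ^ (12 * H)) + 1) * 3 ^ Nat.clog 2 (b ^ (12 * H)))
        ≤ b * (13 * H * l * (4 * b ^ (20 * H - 2))) :=
          Nat.mul_le_mul_left _ (Nat.mul_le_mul e1 (three_pow_clog_le hb (by omega)))
      _ = 52 * H * (l * (b ^ (20 * H - 2) * b)) := by ring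
      _ = 52 * H * (l * E) := by rw [← pow_succ, show 20 * H - 2 + 1 = 20 * H - 1 by omega]
      _ ≤ 52 * H * Z := Nat.mul_le_mul_left _ hlZ
  -- The bad elements: the exponents `10 * H - 4` and `10 * H` leave some slack.
  have t2 : bad * n ≤ 2 * Z := by
    calc bad * n ≤ 2 * a * b ^ (10 * H - 4) * (a * b ^ (10 * H)) := Nat.mul_le_mul hbad hna
      _ = 2 * (a ^ 2 * b ^ (10 * H - 4 + 10 * H)) := by rw [pow_add]; ring
      _ ≤ 2 * (a ^ 2 * E) := by gcongr; exact hpow (by omega)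
      _ ≤ 2 * Z := Nat.mul_le_mul_left _ ha2Z
  -- The oracle calls dominate: `2 * (9 * H + 6)` and `2 * H - 13` add up to exactly `20 * H - 1`.
  -- Writing the instances is no more expensive because `H - 1 ≤ 2 * H - 13`, which is `12 ≤ H`.
  have t3 : m₁ * m₁ * (80 * b ^ (H - 1) + (2 * T + R + 4) + 100) ≤ (2 * C + R + 184) * Z := by
    have e1 : 80 * b ^ (H - 1) + (2 * T + R + 4) + 100 ≤ (2 * C + R + 184) * b ^ (2 * H - 13) := by
      have := hpow (i := H - 1) (j := 2 * H - 13) (by omega)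
      have : 1 ≤ b ^ (2 * H - 13) := Nat.pow_pos (by omega)
      nlinarith [Nat.mul_le_mul_left R this]
    have e2 : b ^ (9 * H + 6) * b ^ (9 * H + 6) * b ^ (2 * H - 13) = E := by
      rw [← pow_add, ← pow_add, show 9 * H + 6 + (9 * H + 6) + (2 * H - 13) = 20 * H - 1 by omega]
    calc m₁ * m₁ * (80 * b ^ (H - 1) + (2 * T + R + 4) + 100)
        ≤ b ^ (9 * H + 6) * b ^ (9 * H + 6) * ((2 * C + R + 184) * b ^ (2 * H - 13)) :=
          Nat.mul_le_mul (Nat.mul_le_mul hm₁ hm₁) e1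
      _ = (2 * C + R + 184) * (b ^ (9 * H + 6) * b ^ (9 * H + 6) * b ^ (2 * H - 13)) := by ac_rfl
      _ = (2 * C + R + 184) * E := by rw [e2]
      _ ≤ _ := Nat.mul_le_mul_left _ hZE
  -- The checks of positive answers: `18 * H + 2 * (H - 2) = 20 * H - 4`.
  have t4 : (FT + 1) * (b ^ (H - 2) * (40 * b ^ (H - 2) + 30) + 3) ≤ 146 * Z := by
    have e1 : b ^ (H - 2) * (40 * b ^ (H - 2) + 30) + 3 ≤ 73 * (b ^ (H - 2) * b ^ (H - 2)) := by
      have : 1 ≤ b ^ (H - 2) := Nat.pow_pos (by omega)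
      clear_value E Z
      generalize b ^ (H - 2) = y at *
      nlinarith [Nat.mul_le_mul this this]
    have e2 : FT + 1 ≤ 2 * a * b ^ (18 * H) := by
      have : 1 ≤ a * b ^ (18 * H) := Nat.mul_pos ha1 (Nat.pow_pos (by omega))
      rw [Nat.mul_assoc]
      omega
    have e3 : b ^ (18 * H) * (b ^ (H - 2) * b ^ (H - 2)) ≤ E := by
      rw [← pow_add, ← pow_add]
      exact hpow (by omega)
    refine (Nat.mul_le_mul e2 e1).trans ?_
    calc 2 * a * b ^ (18 * H) * (73 * (b ^ (H - 2) * b ^ (H - 2)))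
        = 146 * (a * (b ^ (18 * H) * (b ^ (H - 2) * b ^ (H - 2)))) := by
          generalize b ^ (18 * H) = x
          generalize b ^ (H - 2) = y
          ring
      _ ≤ 146 * (a * E) := Nat.mul_le_mul_left _ (Nat.mul_le_mul_left _ e3)
      _ ≤ 146 * Z := Nat.mul_le_mul_left _ haZ
  have t5 : bad ≤ 2 * Z := le_trans (Nat.le_mul_of_pos_right _ hn1) t2
  have t6 : 12 * H * (b * (1200 * (Nat.clog 2 (b ^ (12 * H)) + 1) *
      3 ^ Nat.clog 2 (b ^ (12 * H)) + 40 * n + 350) + 30) ≤ 12 * H * (62820 * H * Z) := by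
    refine Nat.mul_le_mul_left _ ?_
    have e1 : 1 * Z ≤ H * Z := Nat.mul_le_mul_right _ (by omega)
    calc _ = 1200 * (b * ((Nat.clog 2 (b ^ (12 * H)) + 1) * 3 ^ Nat.clog 2 (b ^ (12 * H)))) +
          40 * (b * n) + 350 * b + 30 := by ring
      _ ≤ 62820 * (H * Z) := by
        rw [Nat.mul_assoc] at t1
        omega
      _ = _ := by ring
  have t7 : H * 1 ≤ H ^ 2 * Z := Nat.mul_le_mul (by nlinarith) (by omega)
  have t8 : 12 * H * (62820 * H * Z) = 753840 * (H ^ 2 * Z) := by ring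
  have t9 : (800000 * H ^ 2 + 2 * C + R + 2000) * a ^ 2 * l * E =
    800000 * (H ^ 2 * Z) + (2 * C + R + 184) * Z + 1816 * Z := by rw [hZ]; ring
  have t10 : bad * (60 * n + 50) = 60 * (bad * n) + 50 * bad := by ring
  rw [t8] at t6
  rw [t9, t10]
  clear_value E Z
  generalize 12 * H * _ = y₁ at t6 ⊢
  generalize m₁ * m₁ * _ = y₂ at t3 ⊢
  generalize (FT + 1) * _ = y₃ at t4 ⊢
  generalize (2 * C + R + 184) * Z = y₄ at t3 ⊢
  generalize bad * n = y₅ at t2 ⊢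
  generalize H ^ 2 * Z = y₆ at t6 t7 ⊢
  clear t1 t8 t9 t10 hpow
  omega

/-- The algorithm for large inputs. -/
def heavyCom (H : ℕ) : Com := setupCom H ;; bucketCom ;; pairCom

theorem heavyCom_spec {n b H l C : ℕ} {a : ℕ → ℕ} {s : St} (ha : s.Input n a) (hT : s.Table n a)
    (hb : s.reg .b = b) (hans : s.reg .ans = 0) (hB : ∀ x, s.arr .cntB x = 0)
    (hR : ∀ x, s.arr .cntR x = 0) (hF : ∀ x, s.arr .fill x = 0) (hd : ∀ d i, s.dyn d i = 0)
    (hb0 : 6 ≤ b) (hH : 12 ≤ H) (hbn : b ^ (10 * H) ≤ n) (hnb : n < (b + 1) ^ (10 * H))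
    (hHY : 9 * H + 6 < X.Y) (hnY : 1000 * (n + 1) ^ 4 < X.Y) (haY : ∀ i < n, 2 * a i < X.Y)
    (hw : 2 ^ wordLength X.κ (b ^ (H - 1)) ((b ^ (H - 1)) ^ 3) ≤ X.Y)
    (hl : ∀ i < n, 2 * a i < 2 ^ (l + 1)) (hbl : Nat.clog 2 (b + 1) ≤ l)
    (ha0 : ∀ i < n, 1 ≤ a i) (hinj : ∀ i < n, ∀ j < n, a i = a j → i = j)
    (hC : X.T (b ^ (H - 1)) ≤ C * b ^ (2 * H - 13)) :
    wp X (heavyCom H) (fun s' => s'.reg .ans ≤ 1 ∧ (s'.reg .ans = 1 ↔ Sum3 n a) ∧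
      s'.time ≤ s.time + (800000 * H ^ 2 + 2 * C + X.O.regBound + 2000) *
        (2 * 2 ^ (30 * H) * (2 * l ^ 2) ^ (12 * H)) ^ 2 * l * b ^ (20 * H - 1)) s := by
  have hpow : ∀ {i j}, i ≤ j → b ^ i ≤ b ^ j := fun h => Nat.pow_le_pow_right (by omega) h
  have hn1 : 1 ≤ n := le_trans (Nat.pow_pos (by omega)) hbn
  have hl1 : 1 ≤ l := le_trans (Nat.clog_pos one_lt_two (by omega)) hbl
  have hsq : b ^ (20 * H) ≤ n ^ 2 := by
    calc b ^ (20 * H) = (b ^ (10 * H)) ^ 2 := by rw [← pow_mul]; congr 1; ring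
      _ ≤ n ^ 2 := Nat.pow_le_pow_left hbn 2
  have hn4 : n ≤ (n + 1) ^ 4 ∧ n ^ 2 ≤ (n + 1) ^ 4 ∧ n ^ 3 ≤ (n + 1) ^ 4 ∧ n ^ 4 ≤ (n + 1) ^ 4 ∧
      1 ≤ (n + 1) ^ 4 := by
    have h : ∀ i ≤ 4, n ^ i ≤ (n + 1) ^ 4 := fun i hi =>
      (Nat.pow_le_pow_left (by omega) i).trans (Nat.pow_le_pow_right (by omega) hi)
    exact ⟨by simpa using h 1, h 2 (by omega), h 3 (by omega), h 4 le_rfl, by simpa using h 0⟩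
  obtain ⟨n1, n2, n3, n4, n0⟩ := hn4
  have haY' : ∀ i < n, a i < X.Y := fun i hi => by have := haY i hi; omega
  set L := Nat.clog 2 (b ^ (12 * H)) with hL
  have h3L : 4 * (L + 1) * 3 ^ L < X.Y := by
    have e1 := three_pow_clog_le (b := b) (H := H) (by omega) (by omega)
    rw [← hL] at e1
    have e2 : L + 1 ≤ 2 * n ^ 2 := by
      have : L ≤ b ^ (12 * H) := (Nat.clog_le_iff_le_pow one_lt_two).2 Nat.lt_two_pow_self.le
      have := hpow (i := 12 * H) (j := 20 * H) (by omega)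
      have : 1 ≤ b ^ (12 * H) := Nat.pow_pos (by omega)
      omega
    have e3 : b ^ (20 * H - 2) ≤ n ^ 2 := (hpow (by omega)).trans hsq
    have e4 : (L + 1) * 3 ^ L ≤ 2 * n ^ 2 * (4 * n ^ 2) := Nat.mul_le_mul e2 (by omega)
    have e5 : 2 * n ^ 2 * (4 * n ^ 2) = 8 * n ^ 4 := by ring
    rw [Nat.mul_assoc]
    omega
  have hs : b ^ (H - 2) ≤ b ^ (20 * H) := hpow (by omega)
  have h12 : b ^ (12 * H) ≤ b ^ (20 * H) := hpow (by omega)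
  simp only [heavyCom, wp_seq]
  refine wp_use (setupCom_spec (L := L) (l := l) ha hb (by omega) (by omega) hn1 le_rfl hHY
    (by omega) h3L (by omega) haY' hl) ?_
  rintro s1 ⟨m₁, m₂, g1, g2, g3, g4, g5, g6, g7, g8, g9, g10, g11, g12, g13, g14⟩ f1
  have hmY : m₁ * b ^ (H - 2) ≤ b ^ (20 * H) := by
    calc m₁ * b ^ (H - 2) ≤ b ^ (9 * H + 6) * b ^ (H - 2) := Nat.mul_le_mul_right _ g3
      _ = b ^ (9 * H + 6 + (H - 2)) := (pow_add _ _ _).symm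
      _ ≤ b ^ (20 * H) := hpow (by omega)
  have hmm : m₁ * m₁ ≤ b ^ (20 * H) := by
    calc m₁ * m₁ ≤ b ^ (9 * H + 6) * b ^ (9 * H + 6) := Nat.mul_le_mul g3 g3
      _ = b ^ (9 * H + 6 + (9 * H + 6)) := (pow_add _ _ _).symm
      _ ≤ b ^ (20 * H) := hpow (by omega)
  have hm1' : m₁ ≤ b ^ (20 * H) := g3.trans (hpow (by omega))
  rw [wp_seq]
  refine wp_use (bucketCom_spec (m₁ := m₁) (m := m₁ * m₂) (sz := b ^ (H - 2)) (ha.frame f1 rfl rfl)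
    (hT.frame f1 rfl) g6 g8 g9 (f1.reg hans rfl) (by rw [f1.arr .cntB rfl]; exact hB)
    (by rw [f1.arr .cntR rfl]; exact hR) (by rw [f1.arr .fill rfl]; exact hF) g1 (by omega)
    (by omega) haY ha0 hinj) ?_
  rintro s2 ⟨j1, j2, j3, j4⟩ f2
  have hdyn : s2.dyn = s.dyn := (f2.2.2 rfl).trans (f1.2.2 rfl)
  have env : s2.Env n a m₁ m₂ (b ^ (H - 2)) (b ^ (H - 1)) (b ^ (H - 1) + 4 * m₂ + 4) :=
    ⟨(ha.frame f1 rfl rfl).frame f2 rfl rfl, (hT.frame f1 rfl).frame f2 rfl, j2, f2.reg g6 rfl,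
      f2.reg g7 rfl, f2.reg g8 rfl, f2.reg g9 rfl, f2.reg g10 rfl, f2.reg g11 rfl⟩
  have e1 : b * b ^ (H - 2) = b ^ (H - 1) := by rw [← pow_succ']; congr 1; omega
  have e2 : 6 * b ^ (H - 2) ≤ b * b ^ (H - 2) := Nat.mul_le_mul_right _ hb0
  have e3 : 1 ≤ b ^ (H - 2) := Nat.pow_pos (by omega)
  have hm2' : m₂ ≤ b ^ (20 * H) := g4.trans (hpow (by omega))
  have hN' : b ^ (H - 1) ≤ b ^ (20 * H) := hpow (by omega)
  -- Values of an instance are at most `17 * L`, which is at most `17 * 9 * b ^ (3 * H - 6)`. Since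
  -- `153 < 6 ^ 3`, the assumption `6 ≤ b` suffices.
  have hLN : 17 * (b ^ (H - 1) + 4 * m₂ + 4) ≤ (b ^ (H - 1)) ^ 3 := by
    have e4 : (b ^ (H - 1)) ^ 3 = b ^ 3 * b ^ (3 * H - 6) := by
      rw [← pow_mul, ← pow_add]; congr 1; omega
    have e5 : 6 ^ 3 * b ^ (3 * H - 6) ≤ b ^ 3 * b ^ (3 * H - 6) :=
      Nat.mul_le_mul_right _ (Nat.pow_le_pow_left hb0 3)
    have e6 : b ^ (H - 1) ≤ b ^ (3 * H - 6) := hpow (by omega)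
    omega
  refine wp_mono ?_ (pairCom_spec env j1 (by rw [hdyn]; exact hd)
    (fun i hi j hj k hk h hG => j3 i hi j hj k hk h hG) g1 g2 (by omega) (by omega) le_rfl hLN
    (by omega) hw (by omega) (by omega) haY)
  rintro s3 ⟨k1, k2, k3⟩
  refine ⟨k1, k2, ?_⟩
  have hn0 : n * (falsePairs n a m₁).card ≤ falseColl n a m₁ := by unfold falseColl; omega
  obtain ⟨c1, c2, c3⟩ := false_solutions_le (FP₁ := (falsePairs n a m₁).card)
    (FPm := (falsePairs n a (m₁ * m₂)).card) (FT := (falseTriples n a (m₁ * m₂)).card) hH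
    (show 2 ≤ b by omega) hn1 hnb hl1 ((le_primeCounting_mul_clog (by omega)).trans
      (Nat.mul_le_mul_right _ (Nat.mul_le_mul_left _ hbl))) rfl
    ((Nat.mul_le_mul_right _ hn0).trans g12) g13 (card_not_good_le hinj m₁ (m₁ * m₂) (b ^ (H - 2)))
  have := heavy_time_le (R := X.O.regBound) hH (by omega) hn1
    (Nat.mul_pos (by positivity) (Nat.pow_pos (by positivity))) hl1 hbl g3 c1 c2 c3 hC
  rw [← hL] at this
  simp only [oracleCost] at k3
  omega

/-- The algorithm after the computation of the region size. -/
def mainCom (H : ℕ) : Com :=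
  tableCom ;; rootCom (10 * H) ;; .ans ::= num 0 ;;
  .ite (v .b) (num 6) bruteCom (heavyCom H)

theorem mainCom_spec {n H l C : ℕ} {a : ℕ → ℕ} {s : St} (ha : s.Input n a)
    (h0 : ∀ A, A ≠ .input → ∀ x, s.arr A x = 0) (hd : ∀ d i, s.dyn d i = 0) (hH : 12 ≤ H)
    (hHY : 10 * H < X.Y) (hnY : 1000 * (n + 1) ^ 4 < X.Y) (hnY' : n ^ (10 * H) + n + 1 < X.Y)
    (haY : ∀ i < n, 2 * a i < X.Y) (hw : ∀ N ≤ n, 2 ^ wordLength X.κ N (N ^ 3) ≤ X.Y)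
    (hl : ∀ i < n, 2 * a i < 2 ^ (l + 1)) (hnl : Nat.clog 2 (n + 1) ≤ l)
    (ha0 : ∀ i < n, 1 ≤ a i) (hinj : ∀ i < n, ∀ j < n, a i = a j → i = j)
    (hC : ∀ b, 1 ≤ b → X.T (b ^ (H - 1)) ≤ C * b ^ (2 * H - 13)) :
    wp X (mainCom H) (fun s' => s'.reg .ans ≤ 1 ∧ (s'.reg .ans = 1 ↔ Sum3 n a) ∧
      ∃ b, b ^ (10 * H) ≤ n ∧ s'.time ≤ s.time + (n * (200 * H + 60 + 40 * 6 ^ (10 * H) + 20) + 50 +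
        (800000 * H ^ 2 + 2 * C + X.O.regBound + 2000) *
        (2 * 2 ^ (30 * H) * (2 * l ^ 2) ^ (12 * H)) ^ 2 * l * b ^ (20 * H - 1))) s := by
  have haY' : ∀ i < n, a i < X.Y := fun i hi => by have := haY i hi; omega
  have hY1 : 10 < X.Y := by omega
  simp only [mainCom, wp_seq]
  refine wp_use (tableCom_spec ha (by omega) (h0 .table (by decide)) haY') ?_
  rintro s1 ⟨T1, t1⟩ f1
  have a1 := ha.frame f1 rfl rfl
  rw [wp_seq]
  refine wp_use (rootCom_spec a1.1 (by omega) hHY hnY') ?_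
  rintro s2 ⟨r1, r2, t2⟩ f2
  have a2 := a1.frame f2 rfl rfl
  have T2 := T1.frame f2 rfl
  set b := s2.reg .b with hb
  have hbn : b ≤ n := (Nat.le_self_pow (by omega) b).trans r1
  have harr : ∀ A, A ≠ .input → A ≠ .table → ∀ x, s2.arr A x = 0 := by
    intro A h1 h2 x
    have e1 : s2.arr A = s.arr A := by
      cases A <;> first | exact absurd rfl h1 | exact absurd rfl h2 |
        exact (f2.arr _ rfl).trans (f1.arr _ rfl)
    rw [e1, h0 A h1]
  have hdyn : s2.dyn = s.dyn := (f2.2.2 rfl).trans (f1.2.2 rfl)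
  simp only [wp_seq, wp_assign, wp_ite, Exp.eval_num, Exp.eval_var, St.tick_reg, St.set_reg,
    reduceCtorEq, if_false, ← hb]
  have e1 : n * (20 * (10 * H) + 40) = n * (200 * H) + 40 * n := by ring
  have e2 : n * (200 * H + 60 + 40 * 6 ^ (10 * H) + 20) =
      n * (200 * H) + 60 * n + n * (40 * 6 ^ (10 * H) + 20) := by ring
  refine ⟨by omega, fun hlt => ?_, fun hlt => ?_⟩
  · refine wp_mono ?_ (bruteCom_spec (n := n) (a := a) ⟨by simpa using a2.1, by simpa using a2.2⟩
      T2 (by omega) (by simp) haY)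
    rintro s3 ⟨k1, k2, k3⟩
    refine ⟨k1, k2, b, r1, ?_⟩
    -- For `b < 6` the size of the input is bounded by a constant, so quadratic search takes linear
    -- time.
    have hn6 : n ≤ 6 ^ (10 * H) := r2.le.trans (Nat.pow_le_pow_left (by omega) _)
    have : n * (40 * n + 20) ≤ n * (40 * 6 ^ (10 * H) + 20) := Nat.mul_le_mul_left _ (by omega)
    simp at k3
    omega
  · refine wp_mono ?_ (heavyCom_spec (n := n) (a := a) (b := b) (l := l) (C := C)
      ⟨by simpa using a2.1, by simpa using a2.2⟩ T2 (by simp [hb]) (by simp)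
      (harr .cntB (by decide) (by decide)) (harr .cntR (by decide) (by decide))
      (harr .fill (by decide) (by decide)) (by simpa [hdyn] using hd) (by omega) hH r1 r2
      (by omega) hnY haY (hw _ ((Nat.pow_le_pow_right (by omega) (by omega)).trans r1)) hl
      ((Nat.clog_mono_right 2 (by omega)).trans hnl) ha0 hinj (hC b (by omega)))
    rintro s3 ⟨k1, k2, k3⟩
    refine ⟨k1, k2, b, r1, ?_⟩
    simp at k3
    omega

/-! ### Assembling the program for an arbitrary universe -/

theorem two_pow_clog_le {x : ℕ} (hx : 2 ≤ x) : 2 ^ Nat.clog 2 x ≤ 2 * x := by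
  have h1 : 1 ≤ Nat.clog 2 x := Nat.clog_pos one_lt_two hx
  have h2 := Nat.pow_pred_clog_lt_self one_lt_two hx
  rw [show Nat.clog 2 x = (Nat.clog 2 x).pred + 1 by simp; omega, pow_succ]
  omega

theorem mem_iff_getD {xs : List ℕ} {x : ℕ} : x ∈ xs ↔ ∃ i < xs.length, xs.getD i 0 = x := by
  rw [List.mem_iff_getElem]
  constructor
  · rintro ⟨i, hi, h⟩
    exact ⟨i, hi, by rw [List.getD_eq_getElem _ _ hi, h]⟩
  · rintro ⟨i, hi, h⟩
    exact ⟨i, hi, by rw [← h, List.getD_eq_getElem _ _ hi]⟩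

theorem hasThreeSum_iff_sum3 (xs : List ℕ) :
    HasThreeSum xs.toFinset ↔ Sum3 xs.length fun i => xs.getD i 0 := by
  unfold HasThreeSum Sum3
  simp only [List.mem_toFinset]
  constructor
  · rintro ⟨x, hx, y, hy, z, hz, h⟩
    obtain ⟨i, hi, rfl⟩ := mem_iff_getD.1 hx
    obtain ⟨j, hj, rfl⟩ := mem_iff_getD.1 hy
    obtain ⟨k, hk, rfl⟩ := mem_iff_getD.1 hz
    exact ⟨i, hi, j, hj, k, hk, h⟩
  · rintro ⟨i, hi, j, hj, k, hk, h⟩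
    exact ⟨_, mem_iff_getD.2 ⟨i, hi, rfl⟩, _, mem_iff_getD.2 ⟨j, hj, rfl⟩, _,
      mem_iff_getD.2 ⟨k, hk, rfl⟩, h⟩

/-- The program for an arbitrary universe, built from a program for a cubic universe. -/
def reduction (O : Program) (κ H : ℕ) : Program :=
  twoPhase O (boundCom (6 * κ + 10 * H + 59)) (mainCom H)

/-- The size bounds that the algorithm needs hold for numbers below a large power of `G`. -/
theorem size_bounds {n G κ H Y : ℕ} (hG : n + 2 ≤ G) (hY : Y = G ^ (6 * κ + 10 * H + 60))
    (hH : 1 ≤ H) : 10 * H < Y ∧ 1000 * (n + 1) ^ 4 < Y ∧ n ^ (10 * H) + n + 1 < Y ∧ 2 * G ≤ Y ∧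
      ∀ N ≤ n, 2 ^ wordLength κ N (N ^ 3) ≤ Y := by
  have key : ∀ {i}, i ≤ 6 * κ + 10 * H + 60 → G ^ i ≤ Y := fun h => by
    rw [hY]; exact Nat.pow_le_pow_right (by omega) h
  have h2 : ∀ i, 2 ^ i ≤ G ^ i := fun i => Nat.pow_le_pow_left (by omega) i
  refine ⟨?_, ?_, ?_, ?_, fun N hN => ?_⟩
  · calc 10 * H < 2 ^ (10 * H) := Nat.lt_two_pow_self
      _ ≤ G ^ (10 * H) := h2 _
      _ ≤ Y := key (by omega)
  · calc 1000 * (n + 1) ^ 4 < 2 ^ 10 * (n + 1) ^ 4 :=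
          Nat.mul_lt_mul_of_pos_right (by norm_num) (by positivity)
      _ ≤ G ^ 10 * G ^ 4 := Nat.mul_le_mul (h2 10) (Nat.pow_le_pow_left (by omega) 4)
      _ = G ^ 14 := by rw [← pow_add]
      _ ≤ Y := key (by omega)
  · have h3 : n ^ (10 * H) ≤ G ^ (10 * H) := Nat.pow_le_pow_left (by omega) _
    have h4 : G ≤ G ^ (10 * H) := Nat.le_self_pow (by omega) G
    calc n ^ (10 * H) + n + 1 < G ^ (10 * H) * 2 := by omega
      _ ≤ G ^ (10 * H) * G := Nat.mul_le_mul_left _ (by omega)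
      _ = G ^ (10 * H + 1) := (pow_succ _ _).symm
      _ ≤ Y := key (by omega)
  · calc 2 * G ≤ G * G := Nat.mul_le_mul_right _ (by omega)
      _ = G ^ 2 := by ring
      _ ≤ Y := key (by omega)
  · have h3 : N ^ 3 ≤ G ^ 3 := Nat.pow_le_pow_left (by omega) 3
    have h4 : G ≤ G ^ 3 := Nat.le_self_pow (by omega) G
    have h5 : 2 ^ Nat.clog 2 (N + N ^ 3 + 2) ≤ G ^ 6 := by
      calc 2 ^ Nat.clog 2 (N + N ^ 3 + 2) ≤ 2 * (N + N ^ 3 + 2) := two_pow_clog_le (by omega)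
        _ ≤ 2 ^ 3 * G ^ 3 := by omega
        _ ≤ G ^ 3 * G ^ 3 := Nat.mul_le_mul_right _ (h2 3)
        _ = G ^ 6 := by ring
    calc 2 ^ wordLength κ N (N ^ 3) = (2 ^ Nat.clog 2 (N + N ^ 3 + 2)) ^ κ := by
          rw [wordLength, Nat.mul_comm, pow_mul]
      _ ≤ (G ^ 6) ^ κ := Nat.pow_le_pow_left h5 κ
      _ = G ^ (6 * κ) := (pow_mul _ _ _).symm
      _ ≤ Y := key (by omega)

/-- In the exponent of `Y`, the part `6 * κ` provides room for the address space of the simulated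
program and `10 * H` for the powers computed by `rootCom`; the rest is slack. The base is `n + B + 2
≤ n + U + 2`, where `B` is the maximum of the input, so 40 times this exponent as word length
parameter gives `Y ^ 40 ≤ 2 ^ w`. -/
theorem reduction_run {O : Program} {κ H C : ℕ} {T : ℕ → ℕ}
    (hO : ∀ Y, Ctx.OracleOK ⟨Y, O, κ, T⟩) (hH : 12 ≤ H)
    (hC : ∀ b, 1 ≤ b → T (b ^ (H - 1)) ≤ C * b ^ (2 * H - 13)) {U : ℕ} {xs : List ℕ}
    (hxs : xs.Nodup) (hU : xs.toFinset ⊆ Finset.Icc 1 U) :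
    ∃ t ans, run (wordLength (40 * (6 * κ + 10 * H + 60)) xs.length U) (reduction O κ H) xs t =
      .halted ans ∧ (ans = true ↔ HasThreeSum xs.toFinset) ∧ ∃ b, b ^ (10 * H) ≤ xs.length ∧
      t ≤ xs.length * (200 * H + 60 + 40 * 6 ^ (10 * H) + 50) +
        (20 * (6 * κ + 10 * H + 60) + 150) +
        (800000 * H ^ 2 + 2 * C + O.regBound + 2000) *
        (2 * 2 ^ (30 * H) * (2 * Nat.clog 2 (U + 1) ^ 2) ^ (12 * H)) ^ 2 * Nat.clog 2 (U + 1) *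
        b ^ (20 * H - 1) := by
  set n := xs.length with hn
  set a : ℕ → ℕ := fun i => xs.getD i 0 with ha
  have hrange : ∀ x ∈ xs, 1 ≤ x ∧ x ≤ U := fun x hx => by
    simpa using hU (List.mem_toFinset.2 hx)
  have haU : ∀ i < n, 1 ≤ a i ∧ a i ≤ U := fun i hi => hrange _ (mem_iff_getD.2 ⟨i, hi, rfl⟩)
  have hinj : ∀ i < n, ∀ j < n, a i = a j → i = j := fun i hi j hj h => by
    simp only [ha, List.getD_eq_getElem _ _ hi, List.getD_eq_getElem _ _ hj] at h
    exact (hxs.getElem_inj_iff).1 h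
  have hnU : n ≤ U := by
    have := Finset.card_le_card hU
    rwa [List.toFinset_card_of_nodup hxs, Nat.card_Icc, Nat.add_sub_cancel] at this
  set B := (Finset.range n).sup a with hB
  have hBU : B ≤ U := Finset.sup_le fun i hi => (haU i (Finset.mem_range.1 hi)).2
  have haB : ∀ i < n, a i ≤ B := fun i hi => Finset.le_sup (f := a) (Finset.mem_range.2 hi)
  set G := n + B + 2 with hG
  obtain ⟨Y, hY⟩ : ∃ Y, Y = G ^ (6 * κ + 10 * H + 60) := ⟨_, rfl⟩
  let X : Ctx := ⟨Y, O, κ, T⟩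
  obtain ⟨y1, y2, y3, y4, y5⟩ := size_bounds (n := n) (show n + 2 ≤ G by omega) hY (by omega)
  have hlt : 6 * κ + 10 * H + 59 < Y := by
    calc 6 * κ + 10 * H + 59 < 2 ^ (6 * κ + 10 * H + 59) := Nat.lt_two_pow_self
      _ ≤ G ^ (6 * κ + 10 * H + 59) := Nat.pow_le_pow_left (by omega) _
      _ ≤ Y := by rw [hY]; exact Nat.pow_le_pow_right (by omega) (by omega)
  have hw : Y ^ 40 ≤ 2 ^ wordLength (40 * (6 * κ + 10 * H + 60)) n U := by
    calc Y ^ 40 = G ^ (40 * (6 * κ + 10 * H + 60)) := by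
          rw [hY, ← pow_mul, Nat.mul_comm 40]
      _ ≤ (2 ^ Nat.clog 2 (n + U + 2)) ^ (40 * (6 * κ + 10 * H + 60)) :=
        Nat.pow_le_pow_left (le_trans (by omega) (Nat.le_pow_clog one_lt_two _)) _
      _ = _ := by rw [wordLength, ← pow_mul, Nat.mul_comm]
  have hl : ∀ i < n, 2 * a i < 2 ^ (Nat.clog 2 (U + 1) + 1) := fun i hi => by
    have h1 := (haU i hi).2
    have h2 := Nat.le_pow_clog one_lt_two (U + 1)
    rw [pow_succ]
    omega
  have hinp : (St.start xs).Input n a := ⟨by simp [St.start, hn], fun i _ => by simp [St.start, ha]⟩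
  obtain ⟨s, t, ans, ⟨q1, q2, b, q3, q4⟩, h1, h2, h3⟩ := twoPhase_run (X := X)
    (c₁ := boundCom (6 * κ + 10 * H + 59)) (c₂ := mainCom H) (xs := xs)
    (Q := fun s' => s'.reg .ans ≤ 1 ∧ (s'.reg .ans = 1 ↔ Sum3 n a) ∧
      ∃ b, b ^ (10 * H) ≤ n ∧ s'.time ≤ 30 * n + 20 * (6 * κ + 10 * H + 59) + 50 +
        (n * (200 * H + 60 + 40 * 6 ^ (10 * H) + 20) + 50 +
        (800000 * H ^ 2 + 2 * C + O.regBound + 2000) *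
        (2 * 2 ^ (30 * H) * (2 * Nat.clog 2 (U + 1) ^ 2) ^ (12 * H)) ^ 2 * Nat.clog 2 (U + 1) *
        b ^ (20 * H - 1))) (show 2 ≤ Y by omega) hw (hO Y) rfl rfl rfl (show n < Y by omega)
    (fun x hx => by
      obtain ⟨i, hi, rfl⟩ := mem_iff_getD.1 hx
      have := haB i hi
      show a i < Y
      omega) (by
      refine wp_use (boundCom_spec (B := B) hinp haB hlt hY.ge (show G < Y by omega)) ?_
      rintro s1 ⟨⟨mx, g1, g2, g3, g4⟩, g5⟩ f1
      have hmx : mx = B := le_antisymm g1 (Finset.sup_le fun i hi => g2 i (Finset.mem_range.1 hi))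
      rw [hmx] at g3 g4
      refine ⟨by rw [g3, g4, ← pow_succ]; exact hY.symm, ?_⟩
      refine wp_mono ?_ (mainCom_spec (X := X) (hinp.frame f1 rfl rfl)
        (fun A hA x => by rw [f1.arr A (by cases A <;> rfl)]; simp [St.start, hA])
        (fun d i => by rw [f1.2.2 rfl]; rfl) hH y1 y2 y3 (fun i hi => ?_) y5 hl
        (Nat.clog_mono_right 2 (by omega)) (fun i hi => (haU i hi).1) hinj hC)
      · rintro s2 ⟨k1, k2, b, k3, k4⟩
        refine ⟨k1, k2, b, k3, k4.trans (Nat.add_le_add_right (g5.trans ?_) _)⟩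
        simp [St.start]
      · have := haB i hi
        show 2 * a i < Y
        omega)
  refine ⟨t, ans, h1, ?_, b, q3, ?_⟩
  · rw [h2, hasThreeSum_iff_sum3, ← q2]
    omega
  · have : n * (200 * H + 60 + 40 * 6 ^ (10 * H) + 50) =
      30 * n + n * (200 * H + 60 + 40 * 6 ^ (10 * H) + 20) := by ring
    omega

end WordRAM

/-! ### Asymptotics -/

/-- The ceiling costs at most one, which `2 ≤ U` lets `log U / log 2` absorb; and `2 / log 2 < 3`.
-/
theorem clog_le_log {U : ℕ} (hU : 2 ≤ U) : (Nat.clog 2 (U + 1) : ℝ) ≤ 3 * Real.log U := by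
  set l := Nat.clog 2 (U + 1) with hl
  have h1 : 1 ≤ l := Nat.clog_pos one_lt_two (by omega)
  have h2 : 2 ^ (l - 1) ≤ U := by
    have := Nat.pow_pred_clog_lt_self one_lt_two (show 1 < U + 1 by omega)
    rw [← hl] at this
    exact Nat.lt_succ_iff.1 this
  have h3 : ((l : ℝ) - 1) * Real.log 2 ≤ Real.log U := by
    have : Real.log ((2 : ℝ) ^ (l - 1)) ≤ Real.log U :=
      Real.log_le_log (by positivity) (by exact_mod_cast h2)
    rwa [Real.log_pow, Nat.cast_sub h1, Nat.cast_one] at this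
  have h4 : Real.log 2 ≤ Real.log U := Real.log_le_log (by norm_num) (by exact_mod_cast hU)
  have h5 := Real.log_two_gt_d9
  have h6 : (1 : ℝ) ≤ l := by exact_mod_cast h1
  nlinarith

/-- One saved factor `b` is a saving of `1 / (10 * H)` in the exponent of `n`, as `20 * H - 1 = 10 *
H * (2 - 1 / (10 * H))`. -/
theorem pow_le_rpow_of_pow_le {b n H : ℕ} (hH : 1 ≤ H) (h : b ^ (10 * H) ≤ n) :
    ((b ^ (20 * H - 1) : ℕ) : ℝ) ≤ (n : ℝ) ^ (2 - 1 / (10 * H : ℝ)) := by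
  have hH0 : (0 : ℝ) < 10 * H := by positivity
  have h1 : ((b : ℝ) ^ (10 * H : ℝ)) ≤ n := by
    rw [show (10 * H : ℝ) = ((10 * H : ℕ) : ℝ) by push_cast; ring, Real.rpow_natCast]
    exact_mod_cast h
  have h1H : (1 : ℝ) ≤ H := by exact_mod_cast hH
  have he : 0 ≤ 2 - 1 / (10 * H : ℝ) := by
    rw [sub_nonneg, div_le_iff₀ hH0]
    linarith
  calc ((b ^ (20 * H - 1) : ℕ) : ℝ) = (b : ℝ) ^ ((20 * H - 1 : ℕ) : ℝ) := by
        rw [Real.rpow_natCast]; push_cast; rfl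
    _ = ((b : ℝ) ^ (10 * H : ℝ)) ^ (2 - 1 / (10 * H : ℝ)) := by
        rw [← Real.rpow_mul (Nat.cast_nonneg b)]
        congr 1
        rw [Nat.cast_sub (by omega)]
        push_cast
        field_simp
        ring
    _ ≤ (n : ℝ) ^ (2 - 1 / (10 * H : ℝ)) := Real.rpow_le_rpow (by positivity) h1 he

/-- `(H - 1) * (2 - ε) ≤ 2 * H - 2 - 11`. The slack 11 is what the oracle calls need: with a
quadratic oracle they would cost `b ^ (18 * H + 12 + 2 * H - 2)`, and `b ^ (20 * H - 1)` is wanted.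
-/
theorem floor_mul_rpow_le {C ε : ℝ} {H b : ℕ} (hH : 12 ≤ H) (hε : 11 ≤ ε * (H - 1))
    (hb : 1 ≤ b) : ⌊C * ((b ^ (H - 1) : ℕ) : ℝ) ^ (2 - ε)⌋₊ ≤ ⌈C⌉₊ * b ^ (2 * H - 13) := by
  refine Nat.floor_le_of_le ?_
  push_cast
  have hb' : (1 : ℝ) ≤ b := by exact_mod_cast hb
  refine mul_le_mul (Nat.le_ceil C) ?_ (by positivity) (by positivity)
  rw [← Real.rpow_natCast, ← Real.rpow_natCast, ← Real.rpow_mul (by positivity)]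
  refine Real.rpow_le_rpow_of_exponent_le hb' ?_
  rw [Nat.cast_sub (by omega), Nat.cast_sub (by omega)]
  push_cast
  nlinarith

/-- The assumed time bound applies only if `2 ≤ N ^ 3`, hence the restriction to `N ≥ 2`. Passing to
a smaller saving `δ` allows the later choice `δ ≤ 1`, and `|C|` makes the weakening monotone. -/
theorem oracleOK_of_solvable {ε C : ℝ} {O : WordRAM.Program} {κ : ℕ} (hκ : 1 ≤ κ)
    (h : ∀ (U : ℕ) (xs : List ℕ), xs.Nodup → xs.toFinset ⊆ Finset.Icc 1 U →
      U = xs.length ^ 3 → ∃ (t : ℕ) (answer : Bool),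
        WordRAM.run (wordLength κ xs.length U) O xs t = .halted answer ∧
        (answer = true ↔ HasThreeSum xs.toFinset) ∧
        (1 ≤ xs.length → 2 ≤ U → (t : ℝ) ≤ C * (xs.length : ℝ) ^ (2 - ε))) {δ : ℝ} (hδ : δ ≤ ε)
    (Y : ℕ) : WordRAM.Ctx.OracleOK ⟨Y, O, κ, fun N => ⌊|C| * (N : ℝ) ^ (2 - δ)⌋₊⟩ := by
  refine ⟨hκ, fun N xs hN hl hnd hs => ?_⟩
  obtain ⟨t, ans, h1, h2, h3⟩ := h (N ^ 3) xs hnd hs (by rw [hl])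
  rw [hl] at h1 h3
  refine ⟨t, ans, Nat.le_floor ?_, h1, h2⟩
  have hN' : (1 : ℝ) ≤ N := by exact_mod_cast (by omega : 1 ≤ N)
  calc (t : ℝ) ≤ C * (N : ℝ) ^ (2 - ε) := h3 (by omega) (by
        have := Nat.le_self_pow (n := 3) (by omega) N; omega)
    _ ≤ |C| * (N : ℝ) ^ (2 - δ) := mul_le_mul (le_abs_self C)
        (Real.rpow_le_rpow_of_exponent_le hN' (by linarith)) (by positivity) (abs_nonneg C)

theorem steps_le {H n U b t c₁ c₂ c₃ : ℕ} (hH : 1 ≤ H) (hn : 1 ≤ n) (hU : 2 ≤ U)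
    (hb : b ^ (10 * H) ≤ n)
    (ht : t ≤ n * c₁ + c₂ + c₃ * Nat.clog 2 (U + 1) ^ (48 * H + 1) * b ^ (20 * H - 1)) :
    (t : ℝ) ≤ ((c₁ + c₂ + c₃ : ℕ) : ℝ) * 3 ^ (48 * H + 1) *
      ((n : ℝ) ^ (2 - 1 / (10 * H : ℝ)) * Real.log U ^ ((48 * H + 1 : ℕ) : ℝ)) := by
  have hn1 : (1 : ℝ) ≤ n := by exact_mod_cast hn
  have hH1 : (1 : ℝ) ≤ H := by exact_mod_cast hH
  have he : 1 ≤ 2 - 1 / (10 * H : ℝ) := by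
    rw [le_sub_comm, div_le_iff₀ (by linarith)]
    linarith
  have x2 : (n : ℝ) ≤ (n : ℝ) ^ (2 - 1 / (10 * H : ℝ)) := Real.self_le_rpow_of_one_le hn1 he
  have x3 := pow_le_rpow_of_pow_le hH hb
  have hl : 1 ≤ Nat.clog 2 (U + 1) := Nat.clog_pos one_lt_two (by omega)
  have hlog := clog_le_log hU
  rw [Real.rpow_natCast]
  generalize (n : ℝ) ^ (2 - 1 / (10 * H : ℝ)) = X at *
  generalize b ^ (20 * H - 1) = B at *
  generalize Nat.clog 2 (U + 1) = l at *
  generalize 48 * H + 1 = m at *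
  have hl' : (1 : ℝ) ≤ l := by exact_mod_cast hl
  have y1 : (1 : ℝ) ≤ (l : ℝ) ^ m := one_le_pow₀ hl'
  have y2 : (l : ℝ) ^ m ≤ 3 ^ m * Real.log U ^ m := by
    rw [← mul_pow]
    exact pow_le_pow_left₀ (by linarith) hlog m
  have hX : 0 ≤ X := by linarith
  have ht' : (t : ℝ) ≤ n * c₁ + c₂ + c₃ * (l : ℝ) ^ m * B := by exact_mod_cast ht
  calc (t : ℝ) ≤ n * c₁ + c₂ + c₃ * (l : ℝ) ^ m * B := ht'
    _ ≤ (X * (l : ℝ) ^ m) * c₁ + (X * (l : ℝ) ^ m) * c₂ + c₃ * (l : ℝ) ^ m * X := by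
        have z : X ≤ X * (l : ℝ) ^ m := le_mul_of_one_le_right hX y1
        gcongr
        · exact x2.trans z
        · exact le_mul_of_one_le_left (Nat.cast_nonneg _) (by linarith)
    _ = (c₁ + c₂ + c₃) * X * (l : ℝ) ^ m := by ring
    _ ≤ (c₁ + c₂ + c₃) * X * (3 ^ m * Real.log U ^ m) :=
        mul_le_mul_of_nonneg_left y2 (by positivity)
    _ = ((c₁ + c₂ + c₃ : ℕ) : ℝ) * 3 ^ m * (X * Real.log U ^ m) := by push_cast; ring

theorem exists_mul_pred_ge {δ : ℝ} (h0 : 0 < δ) (h1 : δ ≤ 1) :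
    ∃ H : ℕ, 11 ≤ δ * ((H : ℝ) - 1) ∧ 12 ≤ H := by
  have h := Nat.le_ceil (11 / δ)
  refine ⟨⌈11 / δ⌉₊ + 1, ?_, ?_⟩
  · rw [div_le_iff₀ h0] at h
    push_cast
    linarith
  · have : (11 : ℝ) ≤ (⌈11 / δ⌉₊ : ℕ) := by
      refine le_trans ?_ h
      rw [le_div_iff₀ h0]
      linarith
    have : 11 ≤ ⌈11 / δ⌉₊ := by exact_mod_cast this
    omega

theorem sq_mul_log_pow (a l H : ℕ) :
    (2 * 2 ^ (30 * H) * (a * l ^ 2) ^ (12 * H)) ^ 2 * l =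
      (2 * 2 ^ (30 * H) * a ^ (12 * H)) ^ 2 * l ^ (48 * H + 1) := by
  have h : ((l ^ 2) ^ (12 * H)) ^ 2 * l = l ^ (48 * H + 1) := by
    rw [← pow_mul, ← pow_mul, ← pow_succ]
    congr 1
    ring
  rw [mul_pow a, ← mul_assoc, mul_pow, mul_assoc, h]

/-- The saving used is `min ε 1`, since `δ ≤ 1` forces `12 ≤ H` in `exists_mul_pred_ge`. The time
contains `a ^ 2 * l`, where `a` is proportional to `l ^ (24 * H)`; this gives the exponent `48 * H +
1` of the logarithm. -/
theorem universe_reduction {ε : ℝ} (hε : 0 < ε) (h : ThreeSumOverPowSolvable 3 (2 - ε)) :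
    ∃ ε' : ℝ, 0 < ε' ∧ ∃ c : ℝ, 0 < c ∧ ThreeSumOverAnySolvable (2 - ε') c := by
  obtain ⟨O, κ, C, hκ, hO⟩ := h
  obtain ⟨H, hδH, hH⟩ := exists_mul_pred_ge (lt_min hε one_pos) (min_le_right ε 1)
  have hH0 : (0 : ℝ) < 10 * H := by
    have : (12 : ℝ) ≤ H := by exact_mod_cast hH
    linarith
  obtain ⟨c₃, hc₃⟩ : ∃ c₃, c₃ = (800000 * H ^ 2 + 2 * ⌈|C|⌉₊ + O.regBound + 2000) *
    (2 * 2 ^ (30 * H) * 2 ^ (12 * H)) ^ 2 := ⟨_, rfl⟩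
  refine ⟨1 / (10 * H), one_div_pos.2 hH0, ((48 * H + 1 : ℕ) : ℝ),
    Nat.cast_pos.2 (Nat.succ_pos _), WordRAM.reduction O κ H, 40 * (6 * κ + 10 * H + 60),
    ((200 * H + 60 + 40 * 6 ^ (10 * H) + 50 + (20 * (6 * κ + 10 * H + 60) + 150) + c₃ : ℕ) : ℝ) *
      3 ^ (48 * H + 1), by omega, fun U xs hnd hs _ => ?_⟩
  obtain ⟨t, ans, h1, h2, b, h3, h4⟩ := WordRAM.reduction_run
    (oracleOK_of_solvable hκ hO (min_le_left ε 1)) hH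
    (fun b hb => floor_mul_rpow_le hH hδH hb) hnd hs
  refine ⟨t, ans, h1, h2, fun hn hU => steps_le (by omega) hn hU h3 (h4.trans_eq ?_)⟩
  rw [mul_assoc _ (_ ^ 2) (Nat.clog 2 (U + 1)), sq_mul_log_pow, hc₃, ← mul_assoc]

/-- On `U = n ^ k` one has `log U = k * log n`, and `log n` is bounded by a constant times `n ^ (ε /
(2 * c))`. Raised to the power `c`, this consumes half of the saving `ε`. -/
theorem pow_solvable_of_any {ε c : ℝ} (hε : 0 < ε) (hc : 0 < c)
    (h : ThreeSumOverAnySolvable (2 - ε) c) (k : ℕ) :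
    ThreeSumOverPowSolvable k (2 - ε / 2) := by
  obtain ⟨P, κ, C, hκ, hP⟩ := h
  refine ⟨P, κ, |C| * ((k : ℝ) * (2 * c / ε)) ^ c, hκ, fun U xs hnd hs hU => ?_⟩
  obtain ⟨t, ans, h1, h2, h3⟩ := hP U xs hnd hs trivial
  refine ⟨t, ans, h1, h2, fun hn hU2 => (h3 hn hU2).trans ?_⟩
  set n := xs.length with hndef
  have hn0 : (0 : ℝ) < n := by exact_mod_cast hn
  have hn1 : (1 : ℝ) ≤ n := by exact_mod_cast hn
  have hδ : 0 < ε / (2 * c) := by positivity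
  have hlog : Real.log n ≤ (n : ℝ) ^ (ε / (2 * c)) / (ε / (2 * c)) :=
    Real.log_le_rpow_div hn0.le hδ
  have hlog0 : 0 ≤ Real.log n := Real.log_nonneg hn1
  have hU' : Real.log U = k * Real.log n := by rw [hU]; push_cast; rw [Real.log_pow]
  have e1 : Real.log U ^ c ≤ ((k : ℝ) * (2 * c / ε)) ^ c * (n : ℝ) ^ (ε / 2) := by
    calc Real.log U ^ c ≤ ((k : ℝ) * (2 * c / ε) * (n : ℝ) ^ (ε / (2 * c))) ^ c := by
          rw [hU']
          refine Real.rpow_le_rpow (by positivity) ?_ hc.le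
          rw [mul_assoc]
          refine mul_le_mul_of_nonneg_left (hlog.trans_eq ?_) (by positivity)
          field_simp
      _ = ((k : ℝ) * (2 * c / ε)) ^ c * (n : ℝ) ^ (ε / 2) := by
          rw [Real.mul_rpow (by positivity) (by positivity), ← Real.rpow_mul hn0.le]
          congr 2
          field_simp
  have hlogU : 0 ≤ Real.log U := by rw [hU']; positivity
  calc C * ((n : ℝ) ^ (2 - ε) * Real.log U ^ c)
      ≤ |C| * ((n : ℝ) ^ (2 - ε) * (((k : ℝ) * (2 * c / ε)) ^ c * (n : ℝ) ^ (ε / 2))) := by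
        refine mul_le_mul (le_abs_self C) ?_ (by positivity) (abs_nonneg C)
        exact mul_le_mul_of_nonneg_left e1 (by positivity)
    _ = |C| * ((k : ℝ) * (2 * c / ε)) ^ c * (n : ℝ) ^ (2 - ε / 2) := by
        rw [show 2 - ε / 2 = (2 - ε) + ε / 2 by ring, Real.rpow_add hn0]
        ring

theorem theorem1p2 :
    (∀ ε : ℝ, 0 < ε → ThreeSumOverPowSolvable 3 (2 - ε) →
      ∃ ε' : ℝ, 0 < ε' ∧ ∃ c : ℝ, 0 < c ∧ ThreeSumOverAnySolvable (2 - ε') c) ∧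
    (DeterministicThreeSumHypothesis →
      ∀ ε : ℝ, 0 < ε → ¬ ThreeSumOverPowSolvable 3 (2 - ε)) := by
  refine ⟨fun ε hε h => universe_reduction hε h, fun hyp ε hε h => ?_⟩
  obtain ⟨ε', hε', c, hc, h'⟩ := universe_reduction hε h
  obtain ⟨k, hk⟩ := hyp (ε' / 2) (by positivity)
  exact hk (pow_solvable_of_any hε' hc h' k)
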